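/- Let $(\mathcal C,\oplus,0,\gamma)$ be a small permutative category, i.e. a small category with a functor $\oplus:\mathcal C\times\mathcal C\to\mathcal C$ that is strictly associative with strict unit $0$, and with a natural symmetry $\gamma:a\oplus b\cong b\oplus a$ that makes it a symmetric (strict) monoidal category. *Segal's construction.* For a finite based set $A$, let $\overline{\mathcal C}_A$ be the category whose objects are systems $\{C_S,\rho_{S,T}\}$, where $S$ runs over the subsets of $A$ not containing the basepoint, $C_S$ is an object of $\mathcal C$, and for disjoint $S,T$ the map $\rho_{S,T}:C_S\oplus C_T\to C_{S\cup T}$ is an isomorphism, such that $C_\emptyset=0$; $\rho_{S,T}=\mathrm{id}$ if $S$ or $T$ is empty; $\rho_{S,T}=\rho_{T,S}\circ\gamma$; and $\rho_{S\cup T,U}\circ(\rho_{S,T}\oplus \mathrm{id})=\rho_{S,T\cup U}\circ(\mathrm{id}\oplus\rho_{T,U})$ for pairwise disjoint $S,T,U$. A morphism $\{C_S,\rho_{S,T}\}\to\{C'_S,\rho'_{S,T}\}$ is a family of maps $f_S:C_S\to C'_S$ with $f_\emptyset=\mathrm{id}_0$ and $f_{S\cup T}\circ\rho_{S,T}=\rho'_{S,T}\circ(f_S\oplus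 f_T)$. A based map $g:A\to B$ induces the functor $\overline{\mathcal C}_A\to\overline{\mathcal C}_B$, $\{C_S\}\mapsto\{C_{g^{-1}(S)}\}$ (with the corresponding $\rho$'s). *The multivariable construction.* For finite based sets $A_1,\dots,A_n$, let $\overline{\mathcal C}_{(A_1,\dots,A_n)}$ be the category whose objects are systems $\{C_{\langle S\rangle},\rho_{\langle S\rangle;i,T,U}\}$, where $\langle S\rangle=(S_1,\dots,S_n)$ runs over the tuples of subsets $S_i\subset A_i$ not containing the basepoint, and for every $i$ and every decomposition $S_i=T\amalg U$ there is a map (not necessarily an isomorphism) $$\rho_{\langle S\rangle;i,T,U}: C_{\langle S\rangle[S_i\to T]}\oplus C_{\langle S\rangle[S_i\to U]}\to C_{\langle S\rangle},$$ where $[S_i\to T]$ means that the $i$-th entry is replaced by $T$, such that: $C_{\langle S\rangle}=0$ if some $S_k=\emptyset$; $\rho_{\langle S\rangle;i,T,U}=\mathrm{id}$ if $T$, $U$ or some $S_k$ is empty; for each fixed $i$ the maps $\rho_{\langle S\rangle;i,T,U}$ satisfy the symmetry and associativity conditions as above; and for $i\ne j$, $S_i=T\amalg U$, $S_j=V\amalg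 W$, the two maps $$C_{TV}\oplus C_{UV}\oplus C_{TW}\oplus C_{UW}\to C_{\langle S\rangle}$$ agree, the first being $\rho_{\langle S\rangle;j,V,W}\circ(\rho_{i}\oplus\rho_{i})$ and the second $\rho_{\langle S\rangle;i,T,U}\circ(\rho_{j}\oplus\rho_{j})\circ(\mathrm{id}\oplus\gamma\oplus\mathrm{id})$, where $C_{TV}=C_{\langle S\rangle[S_i\to T,S_j\to V]}$ etc. Morphisms are families of maps $f_{\langle S\rangle}$ commuting with all $\rho$'s, with $f_{\langle S\rangle}=\mathrm{id}_0$ whenever some $S_k=\emptyset$. For $n=0$ there is one (empty) tuple and $\overline{\mathcal C}_{()}=\mathcal C$. The construction is functorial in the based sets $A_i$ by preimages; a permutation $\sigma\in\Sigma_n$ induces a functor $\overline{\mathcal C}_{(A_{\sigma(1)},\dots,A_{\sigma(n)})}\to\overline{\mathcal C}_{(A_1,\dots,A_n)}$, $\{C_{\langle S\rangle}\}\mapsto\{C_{(S_{\sigma(1)},\dots,S_{\sigma(n)})}\}$; and an element $x\in A_{n+1}$ induces an extension functor $\overline{\mathcal C}_{(A_1,\dots,A_n)}\to\overline{\mathcal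 C}_{(A_1,\dots,A_{n+1})}$ that sends $\{C_{\langle S\rangle}\}$ to the system with value $C_{(S_1,\dots,S_n)}$ at $(S_1,\dots,S_{n+1})$ if $x\in S_{n+1}$, and $0$ if $x\notin S_{n+1}$. *The spectra.* Let $S^1=\Delta^1/\partial\Delta^1$ be the simplicial circle, with set of $q$-simplices $S^1_q=\{0,\dots,q\}$ based at $0$, and let $N$ denote the nerve, followed by the diagonal when applied to a simplicial category. A symmetric spectrum (of simplicial sets) is a sequence of based simplicial sets $X(n)$ with actions of $\Sigma_n$ and based structure maps $X(n)\wedge S^1\to X(n+1)$ whose iterates $X(n)\wedge (S^1)^{\wedge q}\to X(n+q)$ are $(\Sigma_n\times\Sigma_q)$-equivariant. Then: - $K^{\mathrm{Seg}}\mathcal C$ is the symmetric spectrum with $n$-th space $N\overline{\mathcal C}_{S^1\wedge\cdots\wedge S^1}$ ($n$ factors; for $n=0$ the smash product is $S^0$). The group $\Sigma_n$ acts by permuting the smash factors, and the structure map on $q$-simplices is induced, for $x\in S^1_q$, by the based map $y\mapsto y\wedge x$. - $K^{\mathrm{new}}\mathcal C$ is the symmetric spectrum with $n$-th space $N\overline{\mathcal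 C}_{(S^1,\dots,S^1)}$ ($n$ entries). The group $\Sigma_n$ acts by the permutation functors, and the structure map on $q$-simplices is induced, for $x\in S^1_q$, by the extension functor of $x$. In both cases the basepoints are given by the system with all objects $0$ and all maps identities. The functors $$\overline{\mathcal C}_{A_1\wedge\cdots\wedge A_n}\to\overline{\mathcal C}_{(A_1,\dots,A_n)},\qquad \{C_S\}\mapsto\{C_{S_1\times\cdots\times S_n}\}_{(S_1,\dots,S_n)},$$ commute with the functors induced by based maps, permutations and extensions, and so define a map of symmetric spectra $K^{\mathrm{Seg}}\mathcal C\to K^{\mathrm{new}}\mathcal C$. **Theorem.** For every small permutative category $\mathcal C$, the map of symmetric spectra $K^{\mathrm{Seg}}\mathcal C\to K^{\mathrm{new}}\mathcal C$ is a level equivalence: for every $n\ge 0$, the map of $n$-th spaces $(K^{\mathrm{Seg}}\mathcal C)(n)\to(K^{\mathrm{new}}\mathcal C)(n)$ is a weak equivalence of simplicial sets, i.e. its geometric realization is a homotopy equivalence. -/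

import Mathlib

universe v u

open CategoryTheory MonoidalCategory Opposite

lemma eqToHom_heq_eqToHom {C : Type u} [Category.{v} C] {A B A' B' : C} (hA : A = A')
    (h : A = B) (h' : A' = B') : HEq (eqToHom h) (eqToHom h') := by
  subst h h' hA
  rfl

/-- A permutative category: a symmetric monoidal category whose associativity and unit
isomorphisms are identities. -/
class PermutativeCategory (C : Type u) [Category.{v} C] [MonoidalCategory C]
    [SymmetricCategory C] : Prop where
  tensor_assoc (X Y Z : C) : (X ⊗ Y) ⊗ Z = X ⊗ (Y ⊗ Z)
  unit_tensor (X : C) : 𝟙_ C ⊗ X = X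
  tensor_unit (X : C) : X ⊗ 𝟙_ C = X
  associator_eq (X Y Z : C) : (α_ X Y Z).hom = eqToHom (tensor_assoc X Y Z)
  leftUnitor_eq (X : C) : (λ_ X).hom = eqToHom (unit_tensor X)
  rightUnitor_eq (X : C) : (ρ_ X).hom = eqToHom (tensor_unit X)

/-- The combinatorics that indexes a system of objects and sum maps: a type of indices, some of
which are declared empty, and for each direction `i` a relation `Split i S T U`, read
"`S` is the disjoint union of `T` and `U` in direction `i`". -/
structure Shape where
  Idx : Type
  Dir : Type
  IsEmpty : Idx → Prop
  Split : Dir → Idx → Idx → Idx → Prop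
  symm : ∀ {i S T U}, Split i S T U → Split i S U T
  unique : ∀ {i S S' T U}, Split i S T U → Split i S' T U → S = S'
  assoc : ∀ {i S TU T U V}, Split i S TU V → Split i TU T U →
    ∃ UV, Split i UV U V ∧ Split i S T UV

namespace Shape

/-- The relation `Split` after a further empty index `none` and a further direction `none` have
been adjoined; in the new direction only the trivial splittings `S = S ⊔ ∅ = ∅ ⊔ S` exist. -/
def SplitPlus (J : Shape) :
    Option J.Dir → Option J.Idx → Option J.Idx → Option J.Idx → Prop
  | some i, some S, some T, some U => J.Split i S T U
  | some _, none, none, none => True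
  | none, S, T, U => (T = S ∧ U = none) ∨ (T = none ∧ U = S)
  | _, _, _, _ => False

lemma splitPlus_some (J : Shape) {i : J.Dir} {S T U : Option J.Idx}
    (h : J.SplitPlus (some i) S T U) : (S = none ∧ T = none ∧ U = none) ∨
      ∃ s t u, S = some s ∧ T = some t ∧ U = some u ∧ J.Split i s t u := by
  rcases S with _ | S <;> rcases T with _ | T <;> rcases U with _ | U <;>
    simp_all [SplitPlus]

/-- The shape `J` with a further empty index and a further direction adjoined. -/
abbrev plus (J : Shape) : Shape where
  Idx := Option J.Idx
  Dir := Option J.Dir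
  IsEmpty S := ∀ k ∈ S, J.IsEmpty k
  Split := J.SplitPlus
  symm {i S T U} h := by
    rcases i with _ | i <;> rcases S with _ | S <;> rcases T with _ | T <;>
      rcases U with _ | U <;> simp_all [SplitPlus] <;> exact J.symm h
  unique {i S S' T U} h h' := by
    rcases i with _ | i <;> rcases S with _ | S <;> rcases S' with _ | S' <;>
      rcases T with _ | T <;> rcases U with _ | U <;> simp_all [SplitPlus]
    exact J.unique h h'
  assoc {i S TU T U V} h h' := by
    rcases i with _ | i
    · simp only [SplitPlus] at *
      rcases h with ⟨rfl, rfl⟩ | ⟨rfl, rfl⟩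
      · exact ⟨U, by simp, h'⟩
      · have : T = none ∧ U = none := by
          rcases h' with h' | h' <;> simp_all
        exact ⟨V, by simp [this], by simp [this]⟩
    · rcases TU with _ | TU <;> rcases S with _ | S <;> rcases T with _ | T <;>
        rcases U with _ | U <;> rcases V with _ | V <;> simp_all [SplitPlus]
      · exact ⟨none, by simp⟩
      · obtain ⟨UV, h₁, h₂⟩ := J.assoc h h'
        exact ⟨some UV, h₁, h₂⟩

/-- A map of shapes: it preserves empty indices and splittings. -/
@[ext]
structure Hom (J K : Shape) where
  idx : J.Idx → K.Idx
  dir : J.Dir → K.Dir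
  empty : ∀ {S}, J.IsEmpty S → K.IsEmpty (idx S)
  split : ∀ {i S T U}, J.Split i S T U → K.Split (dir i) (idx S) (idx T) (idx U)

/-- A partial map of shapes `J → K`; the indices that are not mapped to an index of `K` are
mapped to an additional empty index. -/
abbrev PMap (J K : Shape) := Hom J K.plus

namespace PMap

variable {J K L : Shape}

/-- A map of shapes as a partial map. -/
def ofTotal (φ : Hom J K) : PMap J K where
  idx S := some (φ.idx S)
  dir i := some (φ.dir i)
  empty h := by
    rintro _ ⟨⟩
    exact φ.empty h
  split h := φ.split h

/-- Composition of partial maps. -/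
def comp (φ : PMap J K) (ψ : PMap K L) : PMap J L where
  idx S := Option.bind (φ.idx S) ψ.idx
  dir i := Option.bind (φ.dir i) ψ.dir
  empty {S} h := by
    have h' := φ.empty h
    generalize φ.idx S = o at h'
    rcases o with _ | k
    · simp [plus]
    · exact ψ.empty (h' k rfl)
  split {i S T U} h := by
    have h' := φ.split h
    generalize φ.idx S = s at h'
    generalize φ.idx T = t at h'
    generalize φ.idx U = u at h'
    generalize φ.dir i = d at h'
    rcases d with _ | d
    · rcases h' with ⟨rfl, rfl⟩ | ⟨rfl, rfl⟩
      · exact Or.inl ⟨rfl, rfl⟩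
      · exact Or.inr ⟨rfl, rfl⟩
    · rcases splitPlus_some _ h' with ⟨rfl, rfl, rfl⟩ | ⟨s, t, u, rfl, rfl, rfl, h''⟩
      · show SplitPlus L (Option.bind (some d) ψ.dir) none none none
        rw [Option.bind_some]
        generalize ψ.dir d = e
        rcases e with _ | e
        · exact Or.inl ⟨rfl, rfl⟩
        · trivial
      · exact ψ.split h''

end PMap

end Shape

section Systems

variable (C : Type u) [Category.{v} C] [MonoidalCategory C] [SymmetricCategory C]

/-- A system `{C_S, ρ_{i,S,T,U}}` of objects of `C` and maps `ρ : C_T ⊕ C_U ⟶ C_S`, one for each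
splitting `S = T ⊔ U` in direction `i`; the maps `ρ` are required to lie in the class `W`. -/
structure System (J : Shape) (W : MorphismProperty C) where
  obj : J.Idx → C
  ρ : ∀ {i S T U}, J.Split i S T U → (obj T ⊗ obj U ⟶ obj S)
  mem : ∀ {i S T U} (h : J.Split i S T U), W (ρ h)
  obj_empty : ∀ {S}, J.IsEmpty S → obj S = 𝟙_ C
  ρ_empty : ∀ {i S T U} (h : J.Split i S T U), J.IsEmpty T ∨ J.IsEmpty U →
    ∃ e : obj T ⊗ obj U = obj S, ρ h = eqToHom e
  ρ_symm : ∀ {i S T U} (h : J.Split i S T U),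
    (β_ (obj T) (obj U)).hom ≫ ρ (J.symm h) = ρ h
  ρ_assoc : ∀ {i S TU UV T U V} (h₁ : J.Split i TU T U) (h₂ : J.Split i S TU V)
    (h₃ : J.Split i UV U V) (h₄ : J.Split i S T UV),
    ρ h₁ ▷ obj V ≫ ρ h₂ = (α_ (obj T) (obj U) (obj V)).hom ≫ obj T ◁ ρ h₃ ≫ ρ h₄
  ρ_interchange : ∀ {i j}, i ≠ j → ∀ {S T U V W TV UV TW UW}
    (hV : J.Split i V TV UV) (hW : J.Split i W TW UW) (hVW : J.Split j S V W)
    (hT : J.Split j T TV TW) (hU : J.Split j U UV UW) (hTU : J.Split i S T U),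
    (ρ hV ⊗ₘ ρ hW) ≫ ρ hVW =
      tensorμ (obj TV) (obj UV) (obj TW) (obj UW) ≫ (ρ hT ⊗ₘ ρ hU) ≫ ρ hTU

variable {C}

namespace System

variable {J : Shape} {W : MorphismProperty C}

/-- A morphism of systems: morphisms `f_S : C_S ⟶ C'_S` compatible with the maps `ρ`, which are
identities for empty `S`. -/
@[ext]
structure Hom (X Y : System C J W) where
  app : ∀ S, X.obj S ⟶ Y.obj S
  app_empty : ∀ {S} (h : J.IsEmpty S),
    app S = eqToHom ((X.obj_empty h).trans (Y.obj_empty h).symm)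
  comm : ∀ {i S T U} (h : J.Split i S T U),
    X.ρ h ≫ app S = (app T ⊗ₘ app U) ≫ Y.ρ h

instance : Category (System C J W) where
  Hom := Hom
  id X := { app := fun S => 𝟙 _, app_empty := fun h => by simp, comm := fun h => by simp }
  comp f g :=
    { app := fun S => f.app S ≫ g.app S
      app_empty := fun h => by simp [f.app_empty h, g.app_empty h]
      comm := fun h => by
        rw [← Category.assoc, f.comm, Category.assoc, g.comm, ← Category.assoc,
          tensorHom_comp_tensorHom] }
  id_comp f := Hom.ext (funext fun S => Category.id_comp _)
  comp_id f := Hom.ext (funext fun S => Category.comp_id _)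
  assoc f g h := Hom.ext (funext fun S => Category.assoc _ _ _)

lemma id_app (X : System C J W) (S : J.Idx) : Hom.app (𝟙 X) S = 𝟙 _ := rfl

lemma comp_app {X Y Z : System C J W} (f : X ⟶ Y) (g : Y ⟶ Z) (S : J.Idx) :
    Hom.app (f ≫ g) S = Hom.app f S ≫ Hom.app g S := rfl

lemma ext_heq {X Y : System C J W} (h₁ : ∀ S, X.obj S = Y.obj S)
    (h₂ : ∀ {i S T U} (h : J.Split i S T U), HEq (X.ρ h) (Y.ρ h)) : X = Y := by
  obtain ⟨o, r, _, _, _, _, _, _⟩ := X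
  obtain ⟨o', r', _, _, _, _, _, _⟩ := Y
  obtain rfl : o = o' := funext h₁
  obtain rfl : @r = @r' := by
    funext i S T U h
    exact eq_of_heq (h₂ h)
  rfl

lemma hom_heq {X Y X' Y' : System C J W} (hX : X = X') (hY : Y = Y') (f : X ⟶ Y)
    (g : X' ⟶ Y') (h : ∀ S, HEq (Hom.app f S) (Hom.app g S)) : HEq f g := by
  subst hX hY
  exact heq_of_eq (Hom.ext (funext fun S => eq_of_heq (h S)))

/-- The interchange law within a single direction follows from associativity and symmetry. -/
lemma interchange (X : System C J W) {i j : J.Dir} {S T U V W TV UV TW UW : J.Idx}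
    (hV : J.Split i V TV UV) (hW : J.Split i W TW UW) (hVW : J.Split j S V W)
    (hT : J.Split j T TV TW) (hU : J.Split j U UV UW) (hTU : J.Split i S T U) :
    (X.ρ hV ⊗ₘ X.ρ hW) ≫ X.ρ hVW =
      tensorμ (X.obj TV) (X.obj UV) (X.obj TW) (X.obj UW) ≫
        (X.ρ hT ⊗ₘ X.ρ hU) ≫ X.ρ hTU := by
  by_cases hij : i = j
  · subst hij
    obtain ⟨N, hN, hSN⟩ := J.assoc hVW hV
    obtain ⟨M', hM', hNM'⟩ := J.assoc (J.symm hN) (J.symm hW)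
    have hM := J.symm hM'
    have hNM := J.symm hNM'
    obtain ⟨U', hU', hNU⟩ := J.assoc hNM hM'
    obtain rfl : U' = U := J.unique hU' hU
    have e1 := X.ρ_assoc hV hVW hN hSN
    have e2 := X.ρ_assoc hM hNM hW hN
    have e3 := X.ρ_assoc hM' hNM hU hNU
    have e4 := X.ρ_assoc hT hTU hNU hSN
    have e5 := X.ρ_symm hM
    have e2' : X.obj UV ◁ X.ρ hW ≫ X.ρ hN =
        (α_ _ _ _).inv ≫ X.ρ hM ▷ _ ≫ X.ρ hNM := by
      rw [e2]; simp
    have e3' : X.ρ hM ▷ X.obj UW ≫ X.ρ hNM =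
        (β_ _ _).hom ▷ _ ≫ (α_ _ _ _).hom ≫ X.obj TW ◁ X.ρ hU ≫ X.ρ hNU := by
      rw [← e3, ← e5]; simp
    rw [MonoidalCategory.tensorHom_def', MonoidalCategory.tensorHom_def', Category.assoc,
      Category.assoc, e1, e4, associator_naturality_right_assoc,
      associator_naturality_right_assoc, ← whiskerLeft_comp_assoc, e2', e3', tensorμ]
    simp
  · exact X.ρ_interchange hij hV hW hVW hT hU hTU


end System

section Strict

variable [PermutativeCategory C]

open PermutativeCategory

lemma strict_associator_inv (X Y Z : C) :
    (α_ X Y Z).inv = eqToHom (tensor_assoc X Y Z).symm := by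
  rw [← cancel_epi (α_ X Y Z).hom, Iso.hom_inv_id, associator_eq, eqToHom_trans, eqToHom_refl]

lemma interchange_unit₁ (X Y : C) {Z : C} (f : X ⊗ Y ⟶ Z) :
    (eqToHom (unit_tensor X) ⊗ₘ eqToHom (unit_tensor Y)) ≫ f =
      tensorμ (𝟙_ C) X (𝟙_ C) Y ≫ (eqToHom (unit_tensor (𝟙_ C)) ⊗ₘ f) ≫
        eqToHom (unit_tensor Z) := by
  simp only [← leftUnitor_eq]
  rw [leftUnitor_monoidal, MonoidalCategory.tensorHom_def]
  simp

lemma interchange_unit₂ (X Y : C) {Z : C} (f : X ⊗ Y ⟶ Z) :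
    (eqToHom (tensor_unit X) ⊗ₘ eqToHom (tensor_unit Y)) ≫ f =
      tensorμ X (𝟙_ C) Y (𝟙_ C) ≫ (f ⊗ₘ eqToHom (unit_tensor (𝟙_ C))) ≫
        eqToHom (tensor_unit Z) := by
  simp only [← leftUnitor_eq, ← rightUnitor_eq]
  rw [rightUnitor_monoidal, MonoidalCategory.tensorHom_def']
  simp

lemma interchange_unit₃ (X Y : C) {Z : C} (f : X ⊗ Y ⟶ Z) :
    (eqToHom (unit_tensor (𝟙_ C)) ⊗ₘ f) ≫ eqToHom (unit_tensor Z) =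
      tensorμ (𝟙_ C) (𝟙_ C) X Y ≫
        (eqToHom (unit_tensor X) ⊗ₘ eqToHom (unit_tensor Y)) ≫ f := by
  have := tensor_left_unitality X Y
  rw [← cancel_epi ((λ_ (𝟙_ C)).inv ▷ (X ⊗ Y)), ← Category.assoc, ← Category.assoc,
    ← Category.assoc]
  simp only [← leftUnitor_eq]
  rw [Category.assoc _ (tensorμ _ _ _ _), ← this, MonoidalCategory.tensorHom_def]
  simp

lemma interchange_unit₄ (X Y : C) {Z : C} (f : X ⊗ Y ⟶ Z) :
    (f ⊗ₘ eqToHom (unit_tensor (𝟙_ C))) ≫ eqToHom (tensor_unit Z) =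
      tensorμ X Y (𝟙_ C) (𝟙_ C) ≫
        (eqToHom (tensor_unit X) ⊗ₘ eqToHom (tensor_unit Y)) ≫ f := by
  have := tensor_right_unitality X Y
  rw [← cancel_epi ((X ⊗ Y) ◁ (λ_ (𝟙_ C)).inv), ← Category.assoc, ← Category.assoc,
    ← Category.assoc]
  simp only [← leftUnitor_eq, ← rightUnitor_eq]
  rw [Category.assoc _ (tensorμ _ _ _ _), ← this, MonoidalCategory.tensorHom_def']
  simp

namespace System

variable {J : Shape} {W : MorphismProperty C}

/-- The objects of a system, extended by `0` to a further empty index. -/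
def objPlus (X : System C J W) : Option J.Idx → C
  | none => 𝟙_ C
  | some S => X.obj S

lemma objPlus_eq (X : System C J W) {S T U : Option J.Idx} (h : J.SplitPlus none S T U) :
    X.objPlus T ⊗ X.objPlus U = X.objPlus S := by
  rcases h with ⟨rfl, rfl⟩ | ⟨rfl, rfl⟩
  · exact tensor_unit _
  · exact unit_tensor _

/-- The maps `ρ` of a system, extended by identities to the trivial splittings. -/
def ρPlus (X : System C J W) : ∀ {i : Option J.Dir} {S T U : Option J.Idx},
    J.SplitPlus i S T U → (X.objPlus T ⊗ X.objPlus U ⟶ X.objPlus S)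
  | some _, some _, some _, some _, h => X.ρ h
  | some _, none, none, none, _ => eqToHom (unit_tensor (𝟙_ C))
  | none, _, _, _, h => eqToHom (X.objPlus_eq h)

/-- The extension by zero of a system. -/
def plus [W.ContainsIdentities] (X : System C J W) : System C J.plus W where
  obj := X.objPlus
  ρ := X.ρPlus
  mem {i S T U} h := by
    rcases i with _ | i
    · exact MorphismProperty.ContainsIdentities.eqToHom W (X.objPlus_eq h)
    · rcases S with _ | S <;> rcases T with _ | T <;> rcases U with _ | U <;>
        first | exact h.elim | skip
      · exact MorphismProperty.ContainsIdentities.eqToHom W (unit_tensor (𝟙_ C))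
      · exact X.mem h
  obj_empty {S} h := by
    rcases S with _ | S
    · rfl
    · exact X.obj_empty (h S rfl)
  ρ_empty {i S T U} h h' := by
    rcases i with _ | i
    · exact ⟨X.objPlus_eq h, rfl⟩
    · rcases S with _ | S <;> rcases T with _ | T <;> rcases U with _ | U <;>
        first | exact h.elim | skip
      · exact ⟨unit_tensor (𝟙_ C), rfl⟩
      · exact X.ρ_empty h (h'.imp (fun k => k T rfl) (fun k => k U rfl))
  ρ_symm {i S T U} h := by
    rcases i with _ | i
    · rcases h with ⟨rfl, rfl⟩ | ⟨rfl, rfl⟩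
      · simp [ρPlus, objPlus, ← rightUnitor_eq, ← leftUnitor_eq]
      · simp [ρPlus, objPlus, ← rightUnitor_eq, ← leftUnitor_eq]
    · rcases S with _ | S <;> rcases T with _ | T <;> rcases U with _ | U <;>
        first | exact h.elim | skip
      · simp [ρPlus, objPlus, ← leftUnitor_eq, ← unitors_equal]
      · exact X.ρ_symm h
  ρ_assoc {i S TU UV T U V} h₁ h₂ h₃ h₄ := by
    rcases i with _ | i
    · simp [ρPlus, associator_eq]
    · rcases S with _ | S <;> rcases T with _ | T <;> rcases U with _ | U <;>
        rcases V with _ | V <;> rcases TU with _ | TU <;> rcases UV with _ | UV <;>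
        first | exact h₁.elim | exact h₂.elim | exact h₃.elim | exact h₄.elim | skip
      · simp only [ρPlus, objPlus, associator_eq, eqToHom_whiskerRight, whiskerLeft_eqToHom,
          eqToHom_trans]
      · exact X.ρ_assoc h₁ h₂ h₃ h₄
  ρ_interchange {i j} hij {S T U V W TV UV TW UW} hV hW hVW hT hU hTU := by
    rcases i with _ | i <;> rcases j with _ | j
    · exact (hij rfl).elim
    · rcases J.splitPlus_some hT with ⟨rfl, rfl, rfl⟩ | ⟨t, tv, tw, rfl, rfl, rfl, -⟩ <;>
      rcases J.splitPlus_some hU with ⟨rfl, rfl, rfl⟩ | ⟨u, uv, uw, rfl, rfl, rfl, -⟩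
      · obtain rfl : V = none := by rcases hV with h | h <;> simp_all
        obtain rfl : W = none := by rcases hW with h | h <;> simp_all
        obtain rfl : S = none := by rcases hTU with h | h <;> simp_all
        exact interchange_unit₁ _ _ (eqToHom (unit_tensor (𝟙_ C)))
      · obtain rfl : V = some uv := by rcases hV with h | h <;> simp_all
        obtain rfl : W = some uw := by rcases hW with h | h <;> simp_all
        obtain rfl : S = some u := by rcases hTU with h | h <;> simp_all
        exact interchange_unit₁ _ _ (X.ρ hU)
      · obtain rfl : V = some tv := by rcases hV with h | h <;> simp_all
        obtain rfl : W = some tw := by rcases hW with h | h <;> simp_all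
        obtain rfl : S = some t := by rcases hTU with h | h <;> simp_all
        exact interchange_unit₂ _ _ (X.ρ hT)
      · rcases hTU with h | h <;> simp at h
    · rcases J.splitPlus_some hV with ⟨rfl, rfl, rfl⟩ | ⟨v, tv, uv, rfl, rfl, rfl, -⟩ <;>
      rcases J.splitPlus_some hW with ⟨rfl, rfl, rfl⟩ | ⟨w, tw, uw, rfl, rfl, rfl, -⟩
      · obtain rfl : T = none := by rcases hT with h | h <;> simp_all
        obtain rfl : U = none := by rcases hU with h | h <;> simp_all
        obtain rfl : S = none := by rcases hVW with h | h <;> simp_all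
        exact interchange_unit₃ _ _ (eqToHom (unit_tensor (𝟙_ C)))
      · obtain rfl : T = some tw := by rcases hT with h | h <;> simp_all
        obtain rfl : U = some uw := by rcases hU with h | h <;> simp_all
        obtain rfl : S = some w := by rcases hVW with h | h <;> simp_all
        exact interchange_unit₃ _ _ (X.ρ hW)
      · obtain rfl : T = some tv := by rcases hT with h | h <;> simp_all
        obtain rfl : U = some uv := by rcases hU with h | h <;> simp_all
        obtain rfl : S = some v := by rcases hVW with h | h <;> simp_all
        exact interchange_unit₄ _ _ (X.ρ hV)
      · rcases hVW with h | h <;> simp at h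
    · rcases J.splitPlus_some hVW with ⟨rfl, rfl, rfl⟩ | ⟨s, v, w, rfl, rfl, rfl, -⟩ <;>
      rcases J.splitPlus_some hT with ⟨rfl, rfl, rfl⟩ | ⟨t, tv, tw, rfl, rfl, rfl, -⟩ <;>
      rcases J.splitPlus_some hU with ⟨rfl, rfl, rfl⟩ | ⟨u, uv, uw, rfl, rfl, rfl, -⟩ <;>
      first | exact hTU.elim | exact hV.elim | skip
      · exact interchange_unit₁ _ _ (eqToHom (unit_tensor (𝟙_ C)))
      · exact X.ρ_interchange (fun e => hij (congrArg some e)) hV hW hVW hT hU hTU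


lemma plus_ρ_some [W.ContainsIdentities] (X : System C J W) {i S T U}
    (h : J.Split i S T U) :
    X.plus.ρ (i := some i) (S := some S) (T := some T) (U := some U) h = X.ρ h := rfl

/-- The extension of a morphism of systems by the identity of `0`. -/
def Hom.plus [W.ContainsIdentities] {X Y : System C J W} (f : Hom X Y) :
    Hom X.plus Y.plus where
  app
    | none => 𝟙 (𝟙_ C)
    | some S => f.app S
  app_empty {S} h := by
    rcases S with _ | S
    · rfl
    · exact f.app_empty (h S rfl)
  comm {i S T U} h := by
    rcases i with _ | i
    · rcases h with ⟨rfl, rfl⟩ | ⟨rfl, rfl⟩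
      · rcases T with _ | T
        · simp [System.plus, ρPlus, objPlus]
        · simp [System.plus, ρPlus, objPlus, ← rightUnitor_eq]
      · rcases U with _ | U
        · simp [System.plus, ρPlus, objPlus]
        · simp [System.plus, ρPlus, objPlus, ← leftUnitor_eq]
    · rcases Shape.splitPlus_some _ h with ⟨rfl, rfl, rfl⟩ | ⟨s, t, u, rfl, rfl, rfl, h'⟩
      · simp [System.plus, ρPlus, objPlus]
      · exact f.comm h'

variable {K L : Shape} {W' W'' : MorphismProperty C} [W.ContainsIdentities]

/-- The functor that reindexes systems along a partial map of shapes: `C_S` becomes `C_{φ S}`,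
and `ρ_{i,S,T,U}` becomes `ρ_{φ i,φ S,φ T,φ U}`. -/
def pull (φ : Shape.PMap J K) (hW : W ≤ W') : System C K W ⥤ System C J W' where
  obj X :=
    { obj := fun S => X.plus.obj (φ.idx S)
      ρ := fun h => X.plus.ρ (φ.split h)
      mem := fun h => hW _ (X.plus.mem _)
      obj_empty := fun h => X.plus.obj_empty (φ.empty h)
      ρ_empty := fun h h' => X.plus.ρ_empty _ (h'.imp φ.empty φ.empty)
      ρ_symm := fun h => X.plus.ρ_symm (φ.split h)
      ρ_assoc := fun h₁ h₂ h₃ h₄ =>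
        X.plus.ρ_assoc (φ.split h₁) (φ.split h₂) (φ.split h₃) (φ.split h₄)
      ρ_interchange := fun _ _ _ _ _ _ _ _ _ _ hV hW hVW hT hU hTU =>
        X.plus.interchange (φ.split hV) (φ.split hW) (φ.split hVW) (φ.split hT) (φ.split hU)
          (φ.split hTU) }
  map f :=
    { app := fun S => (Hom.plus f).app (φ.idx S)
      app_empty := fun h => (Hom.plus f).app_empty (φ.empty h)
      comm := fun h => (Hom.plus f).comm (φ.split h) }
  map_id X := by
    refine Hom.ext (funext fun S => ?_)
    show (Hom.plus (𝟙 X)).app (φ.idx S) = 𝟙 (X.objPlus (φ.idx S))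
    generalize φ.idx S = o
    rcases o with _ | o <;> rfl
  map_comp f g := by
    refine Hom.ext (funext fun S => ?_)
    show (Hom.plus (f ≫ g)).app (φ.idx S) =
      (Hom.plus f).app (φ.idx S) ≫ (Hom.plus g).app (φ.idx S)
    generalize φ.idx S = o
    rcases o with _ | o
    · exact (Category.id_comp _).symm
    · rfl

lemma pull_ofTotal_id : pull (Shape.PMap.ofTotal ⟨id, id, id, id⟩) (le_refl W) =
    𝟭 (System C J W) := by
  refine Functor.hext (fun X => ?_) (fun X Y f => ?_)
  · exact ext_heq (fun _ => rfl) (fun _ => HEq.rfl)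
  · exact hom_heq rfl rfl _ _ (fun _ => HEq.rfl)

lemma pull_pull_obj [W'.ContainsIdentities] (ψ : Shape.PMap K L) (h : W ≤ W') (X : System C L W)
    (S : Option K.Idx) :
    ((pull ψ h).obj X).plus.obj S = X.plus.obj (Option.bind S ψ.idx) := by
  rcases S with _ | S <;> rfl

lemma pull_pull_ρ [W'.ContainsIdentities] (ψ : Shape.PMap K L) (h : W ≤ W') (X : System C L W)
    {i : Option K.Dir} {S T U : Option K.Idx} (k : K.plus.Split i S T U)
    (k' : L.plus.Split (Option.bind i ψ.dir) (Option.bind S ψ.idx) (Option.bind T ψ.idx)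
      (Option.bind U ψ.idx)) :
    HEq (((pull ψ h).obj X).plus.ρ k) (X.plus.ρ k') := by
  rcases i with _ | i
  · refine eqToHom_heq_eqToHom ?_ (((pull ψ h).obj X).objPlus_eq k) (X.objPlus_eq k')
    exact congrArg₂ tensorObj (pull_pull_obj ψ h X T) (pull_pull_obj ψ h X U)
  · rcases Shape.splitPlus_some _ k with ⟨rfl, rfl, rfl⟩ | ⟨s, t, u, rfl, rfl, rfl, k''⟩
    · obtain ⟨e, he⟩ := X.plus.ρ_empty k' (Or.inl (fun _ h => by simp at h))
      rw [he]
      exact eqToHom_heq_eqToHom rfl (unit_tensor (𝟙_ C)) e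
    · exact HEq.rfl

lemma pull_comp [W'.ContainsIdentities] (φ : Shape.PMap J K) (ψ : Shape.PMap K L) (h : W ≤ W') (h' : W' ≤ W'') :
    pull ψ h ⋙ pull φ h' = pull (C := C) (φ.comp ψ) (h.trans h') := by
  have hobj : ∀ X : System C L W,
      (pull ψ h ⋙ pull φ h').obj X = (pull (φ.comp ψ) (h.trans h')).obj X := fun X =>
    ext_heq (fun S => pull_pull_obj ψ h X (φ.idx S))
      (fun k => pull_pull_ρ ψ h X (φ.split k) ((φ.comp ψ).split k))
  refine Functor.hext hobj (fun X Y f => hom_heq (hobj X) (hobj Y) _ _ (fun S => ?_))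
  show HEq ((Hom.plus ((pull ψ h).map f)).app (φ.idx S))
    ((Hom.plus f).app (Option.bind (φ.idx S) ψ.idx))
  generalize φ.idx S = o
  rcases o with _ | o <;> rfl

lemma pull_congr {φ ψ : Shape.PMap J K} (h : W ≤ W')
    (h₁ : ∀ S, φ.idx S = ψ.idx S ∨ (K.plus.IsEmpty (φ.idx S) ∧ K.plus.IsEmpty (ψ.idx S)))
    (h₂ : ∀ i, φ.dir i = ψ.dir i ∨ ∀ S T U, J.Split i S T U →
      K.plus.IsEmpty (φ.idx T) ∨ K.plus.IsEmpty (φ.idx U)) :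
    pull (C := C) φ h = pull ψ h := by
  have ho : ∀ (X : System C K W) S, X.plus.obj (φ.idx S) = X.plus.obj (ψ.idx S) := by
    intro X S
    rcases h₁ S with e | ⟨e, e'⟩
    · rw [e]
    · rw [X.plus.obj_empty e, X.plus.obj_empty e']
  have he : ∀ S, K.plus.IsEmpty (φ.idx S) → K.plus.IsEmpty (ψ.idx S) := by
    intro S e
    rcases h₁ S with e' | ⟨-, e'⟩
    · rwa [← e']
    · exact e'
  have hobj : ∀ X : System C K W, (pull φ h).obj X = (pull ψ h).obj X := by
    intro X
    refine ext_heq (ho X) (fun {i S T U} k => ?_)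
    show HEq (X.plus.ρ (φ.split k)) (X.plus.ρ (ψ.split k))
    by_cases hE : K.plus.IsEmpty (φ.idx T) ∨ K.plus.IsEmpty (φ.idx U)
    · obtain ⟨e₁, r₁⟩ := X.plus.ρ_empty (φ.split k) hE
      obtain ⟨e₂, r₂⟩ := X.plus.ρ_empty (ψ.split k) (hE.imp (he T) (he U))
      rw [r₁, r₂]
      exact eqToHom_heq_eqToHom (congrArg₂ tensorObj (ho X T) (ho X U)) _ _
    · have hd : φ.dir i = ψ.dir i := (h₂ i).resolve_right (fun e => hE (e S T U k))
      have hT : φ.idx T = ψ.idx T := (h₁ T).resolve_right (fun e => hE (Or.inl e.1))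
      have hU : φ.idx U = ψ.idx U := (h₁ U).resolve_right (fun e => hE (Or.inr e.1))
      have k₁ := φ.split k
      have k₂ := ψ.split k
      show HEq (X.plus.ρ k₁) (X.plus.ρ k₂)
      generalize φ.dir i = d at *
      generalize φ.idx T = t at *
      generalize φ.idx U = u at *
      subst hd hT hU
      have hS := K.plus.unique k₁ k₂
      generalize φ.idx S = s at *
      subst hS
      rfl
  refine Functor.hext hobj (fun X Y f => hom_heq (hobj X) (hobj Y) _ _ (fun S => ?_))
  show HEq ((Hom.plus f).app (φ.idx S)) ((Hom.plus f).app (ψ.idx S))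
  rcases h₁ S with e | ⟨e, e'⟩
  · rw [e]
  · rw [(Hom.plus f).app_empty e, (Hom.plus f).app_empty e']
    exact eqToHom_heq_eqToHom (ho X S) _ _

end System

end Strict

end Systems

section Shapes

/-- The subsets of a based set that do not contain the basepoint. -/
abbrev FreeSet (A : Pointed.{0}) := {S : Set A // A.point ∉ S}

/-- `S` is the disjoint union of `T` and `U`. -/
def IsDisjUnion {X : Type} (S T U : Set X) : Prop := T ∪ U = S ∧ T ∩ U = ∅

/-- The indices for Segal's construction on a based set `A`: the subsets of `A` that do not
contain the basepoint, with their decompositions as disjoint unions. -/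
abbrev segShape (A : Pointed.{0}) : Shape where
  Idx := FreeSet A
  Dir := Unit
  IsEmpty S := S.1 = ∅
  Split _ S T U := IsDisjUnion S.1 T.1 U.1
  symm h := ⟨by rw [Set.union_comm]; exact h.1, by rw [Set.inter_comm]; exact h.2⟩
  unique h h' := Subtype.ext (h.1.symm.trans h'.1)
  assoc {_ S TU T U V} h h' := by
    obtain ⟨h₁, h₂⟩ := h
    obtain ⟨k₁, k₂⟩ := h'
    refine ⟨⟨U.1 ∪ V.1, fun h => h.elim U.2 V.2⟩, ⟨rfl, ?_⟩, ?_, ?_⟩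
    · rw [← k₁] at h₂; grind
    · rw [← h₁, ← k₁, Set.union_assoc]
    · rw [← k₁] at h₂; grind

/-- The indices for the multivariable construction on a tuple `A` of based sets: tuples `S` of
subsets `S i ⊆ A i` that do not contain the basepoint; a tuple is empty if one of its entries is,
and a splitting in direction `i` decomposes `S i` as a disjoint union and leaves the other entries
unchanged. -/
abbrev multiShape {ι : Type} (A : ι → Pointed.{0}) : Shape where
  Idx := ∀ i, FreeSet (A i)
  Dir := ι
  IsEmpty S := ∃ i, (S i).1 = ∅
  Split i S T U := (∀ j, j ≠ i → T j = S j ∧ U j = S j) ∧ IsDisjUnion (S i).1 (T i).1 (U i).1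
  symm {i _ _ _} h := ⟨fun j hj => (h.1 j hj).symm, (segShape (A i)).symm (i := ()) h.2⟩
  unique {i S S' T U} h h' := by
    funext j
    by_cases hj : j = i
    · subst hj
      exact (segShape (A j)).unique (i := ()) h.2 h'.2
    · rw [← (h.1 j hj).1, ← (h'.1 j hj).1]
  assoc {i S TU T U V} h h' := by
    classical
    obtain ⟨UV, h₁, h₂⟩ := (segShape (A i)).assoc (i := ()) h.2 h'.2
    refine ⟨Function.update S i UV, ⟨fun j hj => ?_, ?_⟩, fun j hj => ?_, ?_⟩
    · rw [Function.update_of_ne hj, (h'.1 j hj).2, (h.1 j hj).1, (h.1 j hj).2]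
      exact ⟨rfl, rfl⟩
    · rw [Function.update_self]; exact h₁
    · rw [Function.update_of_ne hj, (h'.1 j hj).1, (h.1 j hj).1]
      exact ⟨rfl, rfl⟩
    · rw [Function.update_self]; exact h₂

/-- The preimage of a basepoint-free subset under a based map. -/
def FreeSet.preimage {A B : Pointed.{0}} (f : A ⟶ B) (S : FreeSet B) : FreeSet A :=
  ⟨f.toFun ⁻¹' S.1, by rw [Set.mem_preimage, f.map_point]; exact S.2⟩

lemma IsDisjUnion.preimage {X Y : Type} (f : X → Y) {S T U : Set Y} (h : IsDisjUnion S T U) :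
    IsDisjUnion (f ⁻¹' S) (f ⁻¹' T) (f ⁻¹' U) :=
  ⟨by rw [← h.1]; rfl, by rw [← Set.preimage_inter, h.2, Set.preimage_empty]⟩

/-- The map of index shapes induced by a based map. -/
def segShapeMap {A B : Pointed.{0}} (f : A ⟶ B) : Shape.Hom (segShape B) (segShape A) where
  idx := FreeSet.preimage f
  dir := id
  empty {S} h := by
    show f.toFun ⁻¹' S.1 = ∅
    rw [show S.1 = ∅ from h, Set.preimage_empty]
  split h := h.preimage f.toFun

/-- The map of index shapes induced by a tuple of based maps. -/
def multiShapeMap {ι : Type} {A B : ι → Pointed.{0}} (f : A ⟶ B) :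
    Shape.Hom (multiShape B) (multiShape A) where
  idx S i := FreeSet.preimage (f i) (S i)
  dir := id
  empty {S} := fun ⟨i, h⟩ => ⟨i, by
    show (f i).toFun ⁻¹' (S i).1 = ∅
    rw [h, Set.preimage_empty]⟩
  split {i S T U} h := ⟨fun j hj => ⟨congrArg _ (h.1 j hj).1, congrArg _ (h.1 j hj).2⟩,
    h.2.preimage _⟩

/-- The map of index shapes that permutes the entries of a tuple. -/
def permShapeMap {ι κ : Type} (e : ι ≃ κ) (A : κ → Pointed.{0}) :
    Shape.Hom (multiShape A) (multiShape (fun i => A (e i))) where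
  idx S i := S (e i)
  dir := e.symm
  empty {S} := fun ⟨k, h⟩ => by
    obtain ⟨i, rfl⟩ := e.surjective k
    exact ⟨i, h⟩
  split {i S T U} h := by
    obtain ⟨i, rfl⟩ := e.surjective i
    rw [e.symm_apply_apply]
    exact ⟨fun j hj => h.1 (e j) (fun hk => hj (e.injective hk)), h.2⟩

open Classical in
/-- The partial map of index shapes that sends `(S₁, …, Sₙ, Sₙ₊₁)` to `(S₁, …, Sₙ)` if `x ∈ Sₙ₊₁`,
and to the additional empty index otherwise. -/
noncomputable def extShapeMap {n : ℕ} (A : Fin (n + 1) → Pointed.{0}) (x : A (Fin.last n)) :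
    Shape.PMap (multiShape A) (multiShape (fun i : Fin n => A i.castSucc)) where
  idx S := if x ∈ (S (Fin.last n)).1 then some (fun i => S i.castSucc) else none
  dir i := Fin.lastCases (motive := fun _ => Option (Fin n)) none some i
  empty {S} := fun ⟨i, h⟩ => by
    induction i using Fin.lastCases with
    | last => simp [h]
    | cast i =>
      intro k hk
      split_ifs at hk with hx
      · cases hk
        exact ⟨i, h⟩
      · cases hk
  split {i S T U} h := by
    induction i using Fin.lastCases with
    | last =>
      rw [Fin.lastCases_last]
      have hT : (fun i : Fin n => T i.castSucc) = fun i : Fin n => S i.castSucc :=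
        funext fun j => (h.1 _ (Fin.castSucc_lt_last j).ne).1
      have hU : (fun i : Fin n => U i.castSucc) = fun i : Fin n => S i.castSucc :=
        funext fun j => (h.1 _ (Fin.castSucc_lt_last j).ne).2
      have h₁ : x ∈ (S (Fin.last n)).1 ↔ x ∈ (T (Fin.last n)).1 ∨ x ∈ (U (Fin.last n)).1 := by
        rw [← h.2.1]; rfl
      have h₂ : ¬ (x ∈ (T (Fin.last n)).1 ∧ x ∈ (U (Fin.last n)).1) := by
        have : x ∉ (T (Fin.last n)).1 ∩ (U (Fin.last n)).1 := by rw [h.2.2]; simp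
        exact this
      show (_ ∧ _) ∨ (_ ∧ _)
      rw [hT, hU]
      by_cases ht : x ∈ (T (Fin.last n)).1 <;> by_cases hu : x ∈ (U (Fin.last n)).1 <;>
        simp_all
    | cast i =>
      rw [Fin.lastCases_castSucc]
      have hl := h.1 (Fin.last n) (Fin.castSucc_lt_last i).ne'
      rw [hl.1, hl.2]
      by_cases hx : x ∈ (S (Fin.last n)).1
      · rw [if_pos hx, if_pos hx, if_pos hx]
        exact ⟨fun j hj => h.1 _ (fun e => hj (Fin.castSucc_injective n e)), h.2⟩
      · rw [if_neg hx, if_neg hx, if_neg hx]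
        trivial

/-- The smash product of a finite family of based sets: the tuples without basepoint entries,
together with a basepoint. For the empty family it has one element besides the basepoint. -/
def smash {ι : Type} (A : ι → Pointed.{0}) : Pointed.{0} where
  X := Option {a : ∀ i, A i // ∀ i, a i ≠ (A i).point}
  point := none

open Classical in
/-- The element of the smash product represented by a tuple. -/
noncomputable def smash.mk {ι : Type} {A : ι → Pointed.{0}} (a : ∀ i, A i) : smash A :=
  if h : ∀ i, a i ≠ (A i).point then some ⟨a, h⟩ else none

/-- The map of index shapes that sends `(S₁, …, Sₙ)` to `S₁ × ⋯ × Sₙ`. -/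
def prodShapeMap {ι : Type} (A : ι → Pointed.{0}) :
    Shape.Hom (multiShape A) (segShape (smash A)) where
  idx S := ⟨{z | ∃ a, z = some a ∧ ∀ i, a.1 i ∈ (S i).1}, fun ⟨_, h, _⟩ => by cases h⟩
  dir _ := ()
  empty {S} := fun ⟨i, h⟩ => by
    refine Set.eq_empty_of_forall_notMem ?_
    rintro _ ⟨a, -, ha⟩
    have := ha i
    rw [h] at this
    exact this
  split {i S T U} h := by
    have hT : ∀ a : ∀ i, A i, (∀ j, a j ∈ (T j).1) ↔ (∀ j, a j ∈ (S j).1) ∧ a i ∈ (T i).1 := by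
      intro a
      refine ⟨fun ha => ⟨fun j => ?_, ha i⟩, fun ha j => ?_⟩
      · by_cases hj : j = i
        · subst hj; rw [← h.2.1]; exact Or.inl (ha j)
        · rw [← (h.1 j hj).1]; exact ha j
      · by_cases hj : j = i
        · subst hj; exact ha.2
        · rw [(h.1 j hj).1]; exact ha.1 j
    have hU : ∀ a : ∀ i, A i, (∀ j, a j ∈ (U j).1) ↔ (∀ j, a j ∈ (S j).1) ∧ a i ∈ (U i).1 := by
      intro a
      refine ⟨fun ha => ⟨fun j => ?_, ha i⟩, fun ha j => ?_⟩
      · by_cases hj : j = i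
        · subst hj; rw [← h.2.1]; exact Or.inr (ha j)
        · rw [← (h.1 j hj).2]; exact ha j
      · by_cases hj : j = i
        · subst hj; exact ha.2
        · rw [(h.1 j hj).2]; exact ha.1 j
    constructor
    · ext z
      constructor
      · rintro (⟨a, rfl, ha⟩ | ⟨a, rfl, ha⟩)
        · exact ⟨a, rfl, ((hT _).1 ha).1⟩
        · exact ⟨a, rfl, ((hU _).1 ha).1⟩
      · rintro ⟨a, rfl, ha⟩
        have : a.1 i ∈ (T i).1 ∪ (U i).1 := by rw [h.2.1]; exact ha i
        rcases this with k | k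
        · exact Or.inl ⟨a, rfl, (hT _).2 ⟨ha, k⟩⟩
        · exact Or.inr ⟨a, rfl, (hU _).2 ⟨ha, k⟩⟩
    · refine Set.eq_empty_of_forall_notMem ?_
      rintro _ ⟨⟨a, rfl, ha⟩, ⟨b, hb, hb'⟩⟩
      cases hb
      have : a.1 i ∈ (T i).1 ∩ (U i).1 := ⟨ha i, hb' i⟩
      rw [h.2.2] at this
      exact this

end Shapes

section Spectra

/-- The face and degeneracy maps of the simplicial circle: for a monotone map
`θ : {0, …, a} → {0, …, b}`, an element `j` of `{0, …, b}` is sent to the number of `k` with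
`θ k < j`, where the number `a + 1` is read as `0`. -/
def simplicialCircleMap {a b : ℕ} (θ : Fin (a + 1) →o Fin (b + 1)) (j : Fin (b + 1)) : Fin (a + 1) :=
  if h : (Finset.univ.filter (fun k => θ k < j)).card < a + 1 then ⟨_, h⟩ else 0

lemma circle_lt_card_iff {a b : ℕ} (θ : Fin (a + 1) →o Fin (b + 1)) (j : Fin (b + 1))
    (k : Fin (a + 1)) : k.1 < (Finset.univ.filter (fun k => θ k < j)).card ↔ θ k < j := by
  constructor
  · intro h
    by_contra hk
    have : Finset.univ.filter (fun k => θ k < j) ⊆ Finset.Iio k := by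
      intro l hl
      simp only [Finset.mem_filter, Finset.mem_univ, true_and] at hl
      rw [Finset.mem_Iio]
      by_contra hkl
      exact hk (lt_of_le_of_lt (θ.monotone (not_lt.1 hkl)) hl)
    have := Finset.card_le_card this
    rw [Fin.card_Iio] at this
    omega
  · intro h
    have : Finset.Iic k ⊆ Finset.univ.filter (fun k => θ k < j) := by
      intro l hl
      simp only [Finset.mem_filter, Finset.mem_univ, true_and]
      exact lt_of_le_of_lt (θ.monotone (Finset.mem_Iic.1 hl)) h
    have := Finset.card_le_card this
    rw [Fin.card_Iic] at this
    omega

lemma simplicialCircleMap_zero {a b : ℕ} (θ : Fin (a + 1) →o Fin (b + 1)) : simplicialCircleMap θ 0 = 0 := by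
  simp [simplicialCircleMap]

lemma simplicialCircleMap_id {a : ℕ} (j : Fin (a + 1)) : simplicialCircleMap OrderHom.id j = j := by
  have : (Finset.univ.filter (fun k : Fin (a + 1) => k < j)).card = j.1 := by
    rw [Finset.filter_gt_eq_Iio, Fin.card_Iio]
  have h' : (Finset.univ.filter (fun k => (OrderHom.id : Fin (a + 1) →o _) k < j)).card = j.1 :=
    this
  rw [simplicialCircleMap, dif_pos (by rw [h']; exact j.2)]
  exact Fin.ext h'

lemma simplicialCircleMap_comp {a b c : ℕ} (θ : Fin (a + 1) →o Fin (b + 1)) (η : Fin (b + 1) →o Fin (c + 1))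
    (j : Fin (c + 1)) : simplicialCircleMap (η.comp θ) j = simplicialCircleMap θ (simplicialCircleMap η j) := by
  by_cases h : (Finset.univ.filter (fun k => η k < j)).card < b + 1
  · have e : simplicialCircleMap η j = ⟨_, h⟩ := dif_pos h
    have : ∀ k, (η.comp θ) k < j ↔ θ k < simplicialCircleMap η j := by
      intro k
      rw [e]
      exact (circle_lt_card_iff η j (θ k)).symm
    unfold simplicialCircleMap
    simp only [this]
    rfl
  · have e : simplicialCircleMap η j = 0 := dif_neg h
    rw [e, simplicialCircleMap_zero]
    have : ∀ k, (η.comp θ) k < j := by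
      intro k
      exact (circle_lt_card_iff η j (θ k)).1 (by omega)
    rw [simplicialCircleMap, dif_neg]
    rw [Finset.filter_true_of_mem (fun k _ => this k), Finset.card_univ, Fintype.card_fin]
    omega

/-- The simplicial circle, a simplicial object in based sets: its set of `n`-simplices is
`{0, …, n}`, with basepoint `0`. -/
def circle : SimplexCategoryᵒᵖ ⥤ Pointed.{0} where
  obj n := ⟨Fin (n.unop.len + 1), 0⟩
  map θ := ⟨simplicialCircleMap θ.unop.toOrderHom, simplicialCircleMap_zero _⟩
  map_id _ := Pointed.Hom.ext (funext fun j => simplicialCircleMap_id j)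
  map_comp _ _ := Pointed.Hom.ext (funext fun j => simplicialCircleMap_comp _ _ j)

/-- The product `X × S¹` of a simplicial set with the simplicial circle. -/
def prodCircle (X : SSet.{u}) : SSet.{u} where
  obj n := X.obj n × circle.obj n
  map f := ↾fun z => (X.map f z.1, (circle.map f).toFun z.2)
  map_id n := by
    refine ConcreteCategory.hom_ext _ _ (fun z => ?_)
    exact congrArg₂ Prod.mk (congrArg (fun g : X.obj n ⟶ X.obj n => g z.1) (X.map_id n))
      (congrFun (congrArg Pointed.Hom.toFun (circle.map_id n)) z.2)
  map_comp f g := by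
    refine ConcreteCategory.hom_ext _ _ (fun z => ?_)
    exact congrArg₂ Prod.mk (congrArg (fun h : X.obj _ ⟶ X.obj _ => h z.1) (X.map_comp f g))
      (congrFun (congrArg Pointed.Hom.toFun (circle.map_comp f g)) z.2)

/-- The iterated maps `X(p) × (S¹)^q ⟶ X(p + q)`. -/
def suspIter (X : ℕ → SSet.{u}) (susp : ∀ p, prodCircle (X p) ⟶ X (p + 1)) (p : ℕ) :
    ∀ (q : ℕ) (n : SimplexCategoryᵒᵖ), (X p).obj n → (Fin q → circle.obj n) → (X (p + q)).obj n
  | 0, _, x, _ => x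
  | q + 1, n, x, t =>
    (susp (p + q)).app n (suspIter X susp p q n x (fun i => t i.castSucc), t (Fin.last q))

/-- The permutation of `{1, …, p + q}` given by permutations of the first `p` and of the last `q`
elements. -/
def blockPerm {p q : ℕ} (α : Equiv.Perm (Fin p)) (β : Equiv.Perm (Fin q)) :
    Equiv.Perm (Fin (p + q)) :=
  finSumFinEquiv.permCongr (Equiv.sumCongr α β)

/-- A symmetric spectrum (of simplicial sets): based simplicial sets `X(p)` with an action of the
symmetric group `Σ_p` and maps `X(p) × S¹ ⟶ X(p + 1)` which factor through `X(p) ∧ S¹`, such that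
the iterated maps `X(p) × (S¹)^q ⟶ X(p + q)` are `(Σ_p × Σ_q)`-equivariant. -/
structure SymmetricSpectrum where
  level : ℕ → SSet.{u}
  act : ∀ p, Equiv.Perm (Fin p) →* End (level p)
  pt : ∀ p n, (level p).obj n
  pt_map : ∀ p {m n} (f : m ⟶ n), (level p).map f (pt p m) = pt p n
  act_pt : ∀ p α n, NatTrans.app (act p α) n (pt p n) = pt p n
  susp : ∀ p, prodCircle (level p) ⟶ level (p + 1)
  susp_pt_left : ∀ p n (t : circle.obj n), (susp p).app n (pt p n, t) = pt (p + 1) n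
  susp_pt_right : ∀ p n (x : (level p).obj n),
    (susp p).app n (x, (circle.obj n).point) = pt (p + 1) n
  equivariant : ∀ p q (α : Equiv.Perm (Fin p)) (β : Equiv.Perm (Fin q)) n
    (x : (level p).obj n) (t : Fin q → circle.obj n),
    suspIter level susp p q n (NatTrans.app (act p α) n x) (fun i => t (β.symm i)) =
      NatTrans.app (act (p + q) (blockPerm α β)) n (suspIter level susp p q n x t)

namespace SymmetricSpectrum

/-- A map of symmetric spectra: maps `X(p) ⟶ Y(p)` that preserve the basepoints, the actions of
the symmetric groups and the structure maps. -/
@[ext]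
structure Hom (X Y : SymmetricSpectrum.{u}) where
  app : ∀ p, X.level p ⟶ Y.level p
  app_pt : ∀ p n, (app p).app n (X.pt p n) = Y.pt p n
  app_act : ∀ p α n (x : (X.level p).obj n),
    (app p).app n (NatTrans.app (X.act p α) n x) = NatTrans.app (Y.act p α) n ((app p).app n x)
  app_susp : ∀ p n (x : (X.level p).obj n) (t : circle.obj n),
    (app (p + 1)).app n ((X.susp p).app n (x, t)) = (Y.susp p).app n ((app p).app n x, t)

instance : Category SymmetricSpectrum.{u} where
  Hom := Hom
  id X :=
    { app := fun _ => 𝟙 _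
      app_pt := fun _ _ => rfl
      app_act := fun _ _ _ _ => rfl
      app_susp := fun _ _ _ _ => rfl }
  comp f g :=
    { app := fun p => f.app p ≫ g.app p
      app_pt := fun p n => by simp [f.app_pt, g.app_pt]
      app_act := fun p α n x => by simp [f.app_act, g.app_act]
      app_susp := fun p n x t => by simp [f.app_susp, g.app_susp] }

/-- A map of simplicial sets is a weak equivalence if its geometric realization is a homotopy
equivalence. -/
def WeakEquiv {X Y : SSet.{u}} (f : X ⟶ Y) : Prop :=
  ∃ e : ContinuousMap.HomotopyEquiv (SSet.toTop.obj X) (SSet.toTop.obj Y),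
    e.toFun = (SSet.toTop.map f).hom

/-- A map of symmetric spectra is a level equivalence if each of the maps `X(p) ⟶ Y(p)` is a
weak equivalence of simplicial sets. -/
def IsLevelEquiv {X Y : SymmetricSpectrum.{u}} (f : X ⟶ Y) : Prop :=
  ∀ p, WeakEquiv (Hom.app f p)

end SymmetricSpectrum

/-- The diagonal of a bisimplicial set. -/
def diagonal : (SimplexCategoryᵒᵖ ⥤ SSet.{u}) ⥤ SSet.{u} where
  obj X :=
    { obj := fun n => (X.obj n).obj n
      map := fun {m n} f => (X.obj m).map f ≫ (X.map f).app n
      map_id := fun n => by simp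
      map_comp := fun f g => by simp }
  map η := { app := fun n => (η.app n).app n }

end Spectra

section Construction

/-- The data from which a symmetric spectrum is built: for each `p` a functor `F p` from based sets
to categories, with an action of `Σ_p`, distinguished objects `0`, and for each element `x` of `A`
an extension functor `F p A ⥤ F (p + 1) A`. -/
structure SymmetricSequence where
  F : ℕ → Pointed.{0} ⥤ Cat.{u, u}
  perm : ∀ p, Equiv.Perm (Fin p) →* End (F p)
  zero : ∀ p A, (F p).obj A
  map_zero : ∀ p {A B} (f : A ⟶ B), ((F p).map f).toFunctor.obj (zero p A) = zero p B
  perm_zero : ∀ p α A, (NatTrans.app (perm p α) A).toFunctor.obj (zero p A) = zero p A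
  ext : ∀ p {A : Pointed.{0}} (_ : A), (F p).obj A ⟶ (F (p + 1)).obj A
  ext_natural : ∀ p {A B : Pointed.{0}} (f : A ⟶ B) (x : A),
    ext p x ≫ (F (p + 1)).map f = (F p).map f ≫ ext p (f.toFun x)
  ext_zero : ∀ p {A : Pointed.{0}} (x : A), (ext p x).toFunctor.obj (zero p A) = zero (p + 1) A
  ext_point : ∀ p (A : Pointed.{0}),
    (ext p A.point).toFunctor = (Functor.const _).obj (zero (p + 1) A)
  iter : ∀ p q {A : Pointed.{0}} (_ : Fin q → A), (F p).obj A ⟶ (F (p + q)).obj A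
  iter_zero : ∀ p {A : Pointed.{0}} (t : Fin 0 → A), iter p 0 t = 𝟙 _
  iter_succ : ∀ p q {A : Pointed.{0}} (t : Fin (q + 1) → A),
    iter p (q + 1) t = iter p q (fun i => t i.castSucc) ≫ ext (p + q) (t (Fin.last q))
  equivariant : ∀ p q {A : Pointed.{0}} (α : Equiv.Perm (Fin p)) (β : Equiv.Perm (Fin q))
    (t : Fin q → A),
    NatTrans.app (perm p α) A ≫ iter p q (fun i => t (β.symm i)) =
      iter p q t ≫ NatTrans.app (perm (p + q) (blockPerm α β)) A

namespace SymmetricSequence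

/-- The bisimplicial set `(m, n) ↦ (N (F p (S¹ m))) n`. -/
abbrev bisimplicial (F : Pointed.{0} ⥤ Cat.{u, u}) : SimplexCategoryᵒᵖ ⥤ SSet.{u} :=
  circle ⋙ F ⋙ nerveFunctor

lemma const_comp_eq {I C D : Type*} [Category I] [Category C] [Category D] (X : C) (G : C ⥤ D) :
    (Functor.const I).obj X ⋙ G = (Functor.const I).obj (G.obj X) :=
  CategoryTheory.Functor.ext (fun _ => rfl) (fun _ _ _ => by simp)

/-- The structure maps of the symmetric spectrum: on `n`-simplices, the map indexed by an
`n`-simplex `x` of the circle is induced by the extension functor of `x`. -/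
def suspMap (F : SymmetricSequence.{u}) (p : ℕ) :
    prodCircle (diagonal.obj (bisimplicial (F.F p))) ⟶
      diagonal.obj (bisimplicial (F.F (p + 1))) where
  app := fun n => ↾fun z => (nerveFunctor.map (F.ext p z.2)).app n z.1
  naturality m n f := by
    refine ConcreteCategory.hom_ext _ _ (fun z => ?_)
    exact congrArg (fun G : (F.F p).obj (circle.obj m) ⟶ (F.F (p + 1)).obj (circle.obj n) =>
      (nerveFunctor.map G).app n ((nerve _).map f z.1))
      (F.ext_natural p (circle.map f) z.2).symm

lemma suspIter_eq (F : SymmetricSequence.{u}) (p q : ℕ) (n : SimplexCategoryᵒᵖ)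
    (x : (diagonal.obj (bisimplicial (F.F p))).obj n) (t : Fin q → circle.obj n) :
    suspIter (fun p => diagonal.obj (bisimplicial (F.F p))) F.suspMap p q n x t =
      (nerveFunctor.map (F.iter p q t)).app n x := by
  induction q with
  | zero =>
    rw [F.iter_zero]
    rfl
  | succ q ih =>
    rw [F.iter_succ, suspIter, ih]
    rfl

/-- The symmetric spectrum with `p`-th level the diagonal of the nerve of the simplicial category
`F p (S¹)`. -/
def spectrum (F : SymmetricSequence.{u}) : SymmetricSpectrum.{u} where
  level p := diagonal.obj (bisimplicial (F.F p))
  act p :=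
    { toFun := fun α => diagonal.map
        (Functor.whiskerLeft circle (Functor.whiskerRight (F.perm p α) nerveFunctor))
      map_one' := by
        rw [map_one]
        rfl
      map_mul' := fun α β => by
        rw [map_mul]
        rfl }
  pt p n := (Functor.const _).obj (F.zero p (circle.obj n))
  pt_map p m n f := by
    show ((Functor.const _).obj (F.zero p (circle.obj m))) ⋙ ((F.F p).map (circle.map f)).toFunctor
      = _
    rw [const_comp_eq, F.map_zero]
  act_pt p α n := by
    show ((Functor.const _).obj (F.zero p (circle.obj n))) ⋙
      (NatTrans.app (F.perm p α) (circle.obj n)).toFunctor = _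
    rw [const_comp_eq, F.perm_zero]
  susp p := F.suspMap p
  susp_pt_left p n t := by
    show ((Functor.const _).obj (F.zero p (circle.obj n))) ⋙ (F.ext p t).toFunctor = _
    rw [const_comp_eq, F.ext_zero]
  susp_pt_right p n x := by
    show Functor.comp x (F.ext p (circle.obj n).point).toFunctor = _
    rw [F.ext_point]
    rfl
  equivariant p q α β n x t := by
    rw [suspIter_eq, suspIter_eq]
    exact congrArg (fun G : (F.F p).obj (circle.obj n) ⟶ (F.F (p + q)).obj (circle.obj n) =>
      (nerveFunctor.map G).app n x) (F.equivariant p q α β t)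

/-- A map of the data from which symmetric spectra are built. -/
structure Hom (F G : SymmetricSequence.{u}) where
  app : ∀ p, F.F p ⟶ G.F p
  app_zero : ∀ p A, ((app p).app A).toFunctor.obj (F.zero p A) = G.zero p A
  app_perm : ∀ p α, F.perm p α ≫ app p = app p ≫ G.perm p α
  app_ext : ∀ p {A : Pointed.{0}} (x : A),
    F.ext p x ≫ (app (p + 1)).app A = (app p).app A ≫ G.ext p x

/-- The induced map of symmetric spectra. -/
def Hom.spectrumMap {F G : SymmetricSequence.{u}} (f : Hom F G) : F.spectrum ⟶ G.spectrum :=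
  SymmetricSpectrum.Hom.mk
    (app := fun p => diagonal.map
      (Functor.whiskerLeft circle (Functor.whiskerRight (f.app p) nerveFunctor)))
    (app_pt := fun p n => by
      show ((Functor.const _).obj (F.zero p (circle.obj n))) ⋙
        ((f.app p).app (circle.obj n)).toFunctor = _
      rw [const_comp_eq, f.app_zero]
      rfl)
    (app_act := fun p α n x => congrArg (fun η : F.F p ⟶ G.F p =>
      (nerveFunctor.map (η.app (circle.obj n))).app n x) (f.app_perm p α))
    (app_susp := fun p n x t => congrArg
      (fun g : (F.F p).obj (circle.obj n) ⟶ (G.F (p + 1)).obj (circle.obj n) =>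
        (nerveFunctor.map g).app n x) (f.app_ext p t))

end SymmetricSequence

end Construction

namespace smash

variable {ι κ : Type} {A : ι → Pointed.{0}}

lemma mk_of_ne (a : ∀ i, A i) (h : ∀ i, a i ≠ (A i).point) : mk a = some ⟨a, h⟩ := dif_pos h

lemma mk_of_eq (a : ∀ i, A i) (i : ι) (h : a i = (A i).point) : mk a = (smash A).point :=
  dif_neg fun h' => h' i h

/-- The based map out of a smash product given by a map `g` on tuples. -/
def lift {B : Pointed.{0}} (g : (∀ i, A i) → B) : smash A ⟶ B :=
  ⟨fun z => Option.elim z B.point (fun a => g a.1), rfl⟩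

lemma lift_mk {B : Pointed.{0}} (g : (∀ i, A i) → B)
    (hg : ∀ a i, a i = (A i).point → g a = B.point) (a : ∀ i, A i) :
    (lift g).toFun (mk a) = g a := by
  by_cases h : ∀ i, a i ≠ (A i).point
  · rw [mk_of_ne a h]
    rfl
  · push Not at h
    obtain ⟨i, hi⟩ := h
    rw [mk_of_eq a i hi, hg a i hi]
    rfl

lemma hom_ext {B : Pointed.{0}} {f g : smash A ⟶ B}
    (h : ∀ a : ∀ i, A i, (∀ i, a i ≠ (A i).point) → f.toFun (mk a) = g.toFun (mk a)) :
    f = g := by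
  refine Pointed.Hom.ext (funext fun z => ?_)
  rcases z with _ | ⟨a, ha⟩
  · exact f.map_point.trans g.map_point.symm
  · rw [← mk_of_ne a ha]
    exact h a ha

/-- The smash product of based maps. -/
noncomputable def map {B : ι → Pointed.{0}} (f : ∀ i, A i ⟶ B i) : smash A ⟶ smash B :=
  lift fun a => mk fun i => (f i).toFun (a i)

lemma map_mk {B : ι → Pointed.{0}} (f : ∀ i, A i ⟶ B i) (a : ∀ i, A i) :
    (map f).toFun (mk a) = mk fun i => (f i).toFun (a i) :=
  lift_mk _ (fun a i h => mk_of_eq _ i (by rw [h, (f i).map_point])) a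

variable {B : Pointed.{0}} {p q : ℕ}

/-- The permutation of the factors of a smash power. -/
noncomputable def perm (α : Equiv.Perm (Fin p)) :
    smash (fun _ : Fin p => B) ⟶ smash (fun _ : Fin p => B) :=
  lift fun a => mk fun i => a (α.symm i)

lemma perm_mk (α : Equiv.Perm (Fin p)) (a : Fin p → B) :
    (perm α).toFun (mk a) = mk fun i => a (α.symm i) :=
  lift_mk _ (fun a i h => mk_of_eq _ (α i) (by rw [α.symm_apply_apply]; exact h)) a

/-- The map `y ↦ y ∧ t₁ ∧ ⋯ ∧ t_q` of smash powers. -/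
noncomputable def append (t : Fin q → B) :
    smash (fun _ : Fin p => B) ⟶ smash (fun _ : Fin (p + q) => B) :=
  lift fun a => mk (Fin.append a t)

lemma append_mk (t : Fin q → B) (a : Fin p → B) :
    (append t).toFun (mk a) = mk (A := fun _ : Fin (p + q) => B) (Fin.append a t) :=
  lift_mk _ (fun a i h => mk_of_eq _ (Fin.castAdd q i) (by rw [Fin.append_left]; exact h)) a

/-- The map `y ↦ y ∧ x` of smash powers. -/
noncomputable def ext (x : B) :
    smash (fun _ : Fin p => B) ⟶ smash (fun _ : Fin (p + 1) => B) :=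
  lift fun a => mk (Fin.snoc (α := fun _ => B) a x)

lemma ext_mk (x : B) (a : Fin p → B) :
    (ext x).toFun (mk a) = mk (A := fun _ : Fin (p + 1) => B) (Fin.snoc (α := fun _ => B) a x) :=
  lift_mk _ (fun a i h => mk_of_eq _ i.castSucc (by rw [Fin.snoc_castSucc]; exact h)) a

/-- The functor `A ↦ A ∧ ⋯ ∧ A`. -/
noncomputable def pow (p : ℕ) : Pointed.{0} ⥤ Pointed.{0} where
  obj A := smash (fun _ : Fin p => A)
  map f := map fun _ => f
  map_id A := hom_ext fun a _ => map_mk _ a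
  map_comp f g := hom_ext fun a _ => by
    show _ = (map _).toFun ((map _).toFun (mk a))
    rw [map_mk, map_mk, map_mk]
    rfl

/-- The action of the symmetric group on smash powers. -/
noncomputable def powPerm (p : ℕ) : Equiv.Perm (Fin p) →* End (pow p) where
  toFun α :=
    { app := fun A => perm α
      naturality := fun A B f => hom_ext fun a _ => by
        simp only [pow, Pointed.Hom.comp_toFun', Function.comp_apply, map_mk, perm_mk] }
  map_one' := NatTrans.ext (funext fun A => hom_ext fun a _ => perm_mk _ a)
  map_mul' α β := NatTrans.ext (funext fun A => hom_ext fun a _ => by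
    show (perm (α * β)).toFun (mk a) = (perm α).toFun ((perm β).toFun (mk a))
    rw [perm_mk, perm_mk, perm_mk]
    rfl)

end smash

lemma blockPerm_symm_castAdd {p q : ℕ} (α : Equiv.Perm (Fin p)) (β : Equiv.Perm (Fin q))
    (i : Fin p) : (blockPerm α β).symm (Fin.castAdd q i) = Fin.castAdd q (α.symm i) := by
  rw [Equiv.symm_apply_eq]
  simp [blockPerm, Equiv.permCongr_apply]

lemma blockPerm_symm_natAdd {p q : ℕ} (α : Equiv.Perm (Fin p)) (β : Equiv.Perm (Fin q))
    (i : Fin q) : (blockPerm α β).symm (Fin.natAdd p i) = Fin.natAdd p (β.symm i) := by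
  rw [Equiv.symm_apply_eq]
  simp [blockPerm, Equiv.permCongr_apply]

lemma append_comp_blockPerm {B : Type} {p q : ℕ} (α : Equiv.Perm (Fin p))
    (β : Equiv.Perm (Fin q)) (a : Fin p → B) (t : Fin q → B) :
    Fin.append (fun i => a (α.symm i)) (fun i => t (β.symm i)) =
      fun i => Fin.append a t ((blockPerm α β).symm i) := by
  funext i
  induction i using Fin.addCases with
  | left i => rw [blockPerm_symm_castAdd, Fin.append_left, Fin.append_left]
  | right i => rw [blockPerm_symm_natAdd, Fin.append_right, Fin.append_right]

lemma append_succ {B : Type} {p q : ℕ} (a : Fin p → B) (t : Fin (q + 1) → B) :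
    Fin.append a t = Fin.snoc (α := fun _ => B) (Fin.append a fun i => t i.castSucc)
      (t (Fin.last q)) := by
  funext i
  induction i using Fin.lastCases (n := p + q) with
  | last =>
    refine Eq.trans ?_ (Fin.snoc_last (α := fun _ => B) _ _).symm
    exact Fin.append_right a t (Fin.last q)
  | cast i =>
    refine Eq.trans ?_ (Fin.snoc_castSucc (α := fun _ => B) _ _ _).symm
    induction i using Fin.addCases with
    | left i =>
      rw [Fin.append_left]
      exact Fin.append_left a t i
    | right i =>
      rw [Fin.append_right]
      exact Fin.append_right a t i.castSucc

section KTheory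

namespace Shape.PMap

/-- The partial map of shapes that is nowhere defined. -/
def trivial (J K : Shape) : PMap J K where
  idx _ := none
  dir _ := none
  empty _ _ h := by cases h
  split _ := Or.inl ⟨rfl, rfl⟩

end Shape.PMap

/-- The shape without indices. -/
abbrev emptyShape : Shape where
  Idx := Empty
  Dir := Empty
  IsEmpty _ := True
  Split _ _ _ _ := False
  symm h := h
  unique h := h.elim
  assoc h := h.elim

variable (C : Type u) [SmallCategory C] [MonoidalCategory C] [SymmetricCategory C]
  [PermutativeCategory C]

namespace System

variable {C}
variable {J K : Shape} {W W' : MorphismProperty C} [W.ContainsIdentities]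

/-- The system without objects. -/
def empty : System C emptyShape W where
  obj := Empty.elim
  ρ h := h.elim
  mem h := h.elim
  obj_empty {S} := S.elim
  ρ_empty h := h.elim
  ρ_symm h := h.elim
  ρ_assoc h := h.elim
  ρ_interchange {i} := i.elim

/-- The system with all objects `0` and all maps `ρ` the identity. -/
def zero : System C J W := (pull (Shape.PMap.trivial J emptyShape) le_rfl).obj empty

lemma pull_zero [W'.ContainsIdentities] (φ : Shape.PMap J K) (h : W ≤ W') :
    (pull φ h).obj (zero : System C K W) = zero := by
  have h₁ := pull_comp (C := C) φ (Shape.PMap.trivial K emptyShape) (le_refl W) h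
  have h₂ := pull_congr (C := C) (φ := φ.comp (Shape.PMap.trivial K emptyShape))
    (ψ := Shape.PMap.trivial J emptyShape) h
    (fun S => Or.inl (by
      show Option.bind (φ.idx S) (fun _ => none) = none
      simp))
    (fun i => Or.inl (by
      show Option.bind (φ.dir i) (fun _ => none) = none
      simp))
  exact (Functor.congr_obj h₁ empty).trans (Functor.congr_obj h₂ empty)

lemma pull_eq_const [W'.ContainsIdentities] (φ : Shape.PMap J K) (h : W ≤ W')
    (hφ : ∀ S, K.plus.IsEmpty (φ.idx S)) :
    pull φ h = (Functor.const (System C K W)).obj zero := by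
  have h₁ := pull_congr (C := C) (φ := φ) (ψ := Shape.PMap.trivial J K) h
    (fun S => Or.inr ⟨hφ S, fun _ h => by cases h⟩) (fun i => Or.inr fun _ T _ _ => Or.inl (hφ T))
  rw [h₁]
  have hobj : ∀ X : System C K W, (pull (Shape.PMap.trivial J K) h).obj X = zero := fun X =>
    ext_heq (fun _ => rfl) (fun _ => HEq.rfl)
  exact Functor.hext hobj (fun X Y f => hom_heq (hobj X) (hobj Y) _ _ (fun S => HEq.rfl))

lemma pull_square {K' L : Shape} {V V' : MorphismProperty C} [V.ContainsIdentities]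
    [V'.ContainsIdentities] (φ : Shape.PMap J K) (ψ : Shape.PMap K L)
    (φ' : Shape.PMap J K') (ψ' : Shape.PMap K' L) (h₁ : W ≤ V) (h₂ : V ≤ W') (h₁' : W ≤ V')
    (h₂' : V' ≤ W')
    (h : ∀ S, (φ.comp ψ).idx S = (φ'.comp ψ').idx S ∨
      (L.plus.IsEmpty ((φ.comp ψ).idx S) ∧ L.plus.IsEmpty ((φ'.comp ψ').idx S)))
    (h' : ∀ i, (φ.comp ψ).dir i = (φ'.comp ψ').dir i ∨ ∀ S T U, J.Split i S T U →
      L.plus.IsEmpty ((φ.comp ψ).idx T) ∨ L.plus.IsEmpty ((φ.comp ψ).idx U)) :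
    (pull (C := C) ψ h₁).toCatHom ≫ (pull φ h₂).toCatHom =
      (pull ψ' h₁').toCatHom ≫ (pull φ' h₂').toCatHom :=
  congrArg Functor.toCatHom ((pull_comp φ ψ h₁ h₂).trans
    ((pull_congr _ h h').trans (pull_comp φ' ψ' h₁' h₂').symm))

end System

/-- Segal's construction as a functor from based sets to categories: an object of `C̄_A` is a
system of objects `C_S` and isomorphisms `ρ_{S,T} : C_S ⊕ C_T ⟶ C_{S ∪ T}`, and a based map `f`
acts by reindexing along preimages. -/
def segalCat : Pointed.{0} ⥤ Cat.{u, u} where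
  obj A := Cat.of (System C (segShape A) (MorphismProperty.isomorphisms C))
  map f := (System.pull (Shape.PMap.ofTotal (segShapeMap f)) le_rfl).toCatHom
  map_id _ := congrArg Functor.toCatHom System.pull_ofTotal_id
  map_comp f g := congrArg Functor.toCatHom (System.pull_comp
    (Shape.PMap.ofTotal (segShapeMap g)) (Shape.PMap.ofTotal (segShapeMap f)) le_rfl le_rfl).symm

/-- The multivariable construction `C̄_{(A₁, …, Aₙ)}`, as a functor from tuples of based sets to
categories: the maps `ρ` need not be isomorphisms. -/
def multiCat (ι : Type) : (ι → Pointed.{0}) ⥤ Cat.{u, u} where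
  obj A := Cat.of (System C (multiShape A) ⊤)
  map f := (System.pull (Shape.PMap.ofTotal (multiShapeMap f)) le_rfl).toCatHom
  map_id _ := congrArg Functor.toCatHom System.pull_ofTotal_id
  map_comp f g := congrArg Functor.toCatHom (System.pull_comp
    (Shape.PMap.ofTotal (multiShapeMap g)) (Shape.PMap.ofTotal (multiShapeMap f))
    le_rfl le_rfl).symm

/-- The permutation functors of the multivariable construction. -/
def permFunctor {ι κ : Type} (e : ι ≃ κ) (A : κ → Pointed.{0}) :
    (multiCat C ι).obj (fun i => A (e i)) ⟶ (multiCat C κ).obj A :=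
  (System.pull (Shape.PMap.ofTotal (permShapeMap e A)) le_rfl).toCatHom

/-- The extension functors of the multivariable construction: for `x ∈ Aₙ₊₁`, the system
`{C_{(S₁, …, Sₙ)}}` is sent to the system whose value at `(S₁, …, Sₙ₊₁)` is `C_{(S₁, …, Sₙ)}` if
`x ∈ Sₙ₊₁` and `0` otherwise. -/
noncomputable def extFunctor {n : ℕ} (A : Fin (n + 1) → Pointed.{0}) (x : A (Fin.last n)) :
    (multiCat C (Fin n)).obj (fun i => A i.castSucc) ⟶ (multiCat C (Fin (n + 1))).obj A :=
  (System.pull (extShapeMap A x) le_rfl).toCatHom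

/-- The canonical functor `C̄_{A₁ ∧ ⋯ ∧ Aₙ} ⥤ C̄_{(A₁, …, Aₙ)}`, which sends `{C_S}` to the system
with value `C_{S₁ × ⋯ × Sₙ}` at `(S₁, …, Sₙ)`. -/
def compareFunctor {ι : Type} (A : ι → Pointed.{0}) :
    (segalCat C).obj (smash A) ⟶ (multiCat C ι).obj A :=
  (System.pull (Shape.PMap.ofTotal (prodShapeMap A)) le_top).toCatHom

/-- Segal's construction on smash powers, `A ↦ C̄_{A ∧ ⋯ ∧ A}`. -/
noncomputable def segalSequence : SymmetricSequence.{u} where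
  F p := smash.pow p ⋙ segalCat C
  perm p :=
    { toFun := fun α => Functor.whiskerRight (smash.powPerm p α) (segalCat C)
      map_one' := by
        rw [map_one]
        exact Functor.whiskerRight_id' _
      map_mul' := fun α β => by
        rw [map_mul]
        exact Functor.whiskerRight_comp _ _ _ }
  zero p A := System.zero
  map_zero p A B f := System.pull_zero _ le_rfl
  perm_zero p α A := System.pull_zero _ le_rfl
  ext p A x := (segalCat C).map (smash.ext x)
  ext_natural p A B f x := by
    refine ((segalCat C).map_comp _ _).symm.trans (Eq.trans ?_ ((segalCat C).map_comp _ _))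
    refine congrArg _ (smash.hom_ext fun a _ => ?_)
    show (smash.map _).toFun ((smash.ext x).toFun (smash.mk a)) =
      (smash.ext _).toFun ((smash.map _).toFun (smash.mk a))
    rw [smash.ext_mk, smash.map_mk, smash.map_mk, smash.ext_mk]
    congr 1
    funext i
    induction i using Fin.lastCases with
    | last => simp
    | cast i => simp
  ext_zero p A x := System.pull_zero _ le_rfl
  ext_point p A := System.pull_eq_const _ le_rfl fun S k hk => by
    cases hk
    refine Set.eq_empty_of_forall_notMem fun z hz => ?_
    have : (smash.ext A.point).toFun z = (smash (fun _ : Fin (p + 1) => A)).point := by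
      rcases z with _ | ⟨a, ha⟩
      · rfl
      · rw [← smash.mk_of_ne a ha, smash.ext_mk]
        exact smash.mk_of_eq _ (Fin.last p) (Fin.snoc_last _ _)
    have hz' : (smash.ext A.point).toFun z ∈ S.1 := hz
    rw [this] at hz'
    exact S.2 hz'
  iter p q A t := (segalCat C).map (smash.append t)
  iter_zero p A t := by
    refine Eq.trans (congrArg _ ?_) ((segalCat C).map_id _)
    refine smash.hom_ext fun a _ => ?_
    refine (smash.append_mk t a).trans ?_
    rw [Fin.append_right_nil _ _ rfl]
    rfl
  iter_succ p q A t := by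
    refine Eq.trans (congrArg _ ?_) ((segalCat C).map_comp _ _)
    refine smash.hom_ext fun a _ => ?_
    show _ = (smash.ext _).toFun ((smash.append _).toFun (smash.mk a))
    rw [smash.append_mk, smash.append_mk, smash.ext_mk, append_succ]
  equivariant p q A α β t := by
    refine ((segalCat C).map_comp _ _).symm.trans (Eq.trans ?_ ((segalCat C).map_comp _ _))
    refine congrArg _ (smash.hom_ext fun a _ => ?_)
    show (smash.append _).toFun ((smash.perm α).toFun (smash.mk a)) =
      (smash.perm _).toFun ((smash.append t).toFun (smash.mk a))
    rw [smash.perm_mk, smash.append_mk, smash.append_mk, smash.perm_mk, append_comp_blockPerm]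

lemma extShapeMap_idx_of_mem {n : ℕ} (A : Fin (n + 1) → Pointed.{0}) (x : A (Fin.last n))
    (S : ∀ i, FreeSet (A i)) (h : x ∈ (S (Fin.last n)).1) :
    (extShapeMap A x).idx S = some (fun i : Fin n => S i.castSucc) := if_pos h

lemma extShapeMap_idx_of_notMem {n : ℕ} (A : Fin (n + 1) → Pointed.{0}) (x : A (Fin.last n))
    (S : ∀ i, FreeSet (A i)) (h : x ∉ (S (Fin.last n)).1) :
    (extShapeMap A x).idx S = none := if_neg h

lemma extShapeMap_dir_last {n : ℕ} (A : Fin (n + 1) → Pointed.{0}) (x : A (Fin.last n)) :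
    (extShapeMap A x).dir (Fin.last n) = none :=
  Fin.lastCases_last (motive := fun _ => Option (Fin n))

lemma extShapeMap_dir_castSucc {n : ℕ} (A : Fin (n + 1) → Pointed.{0}) (x : A (Fin.last n))
    (i : Fin n) : (extShapeMap A x).dir i.castSucc = some i :=
  Fin.lastCases_castSucc (motive := fun _ => Option (Fin n)) _

lemma blockPerm_castAdd {p q : ℕ} (α : Equiv.Perm (Fin p)) (β : Equiv.Perm (Fin q))
    (i : Fin p) : blockPerm α β (Fin.castAdd q i) = Fin.castAdd q (α i) := by
  simp [blockPerm, Equiv.permCongr_apply]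

lemma blockPerm_natAdd {p q : ℕ} (α : Equiv.Perm (Fin p)) (β : Equiv.Perm (Fin q))
    (i : Fin q) : blockPerm α β (Fin.natAdd p i) = Fin.natAdd p (β i) := by
  simp [blockPerm, Equiv.permCongr_apply]

lemma mk_mem_prodShapeMap {ι : Type} {A : ι → Pointed.{0}} (S : ∀ i, FreeSet (A i))
    (a : ∀ i, A i) : smash.mk a ∈ ((prodShapeMap A).idx S).1 ↔ ∀ i, a i ∈ (S i).1 := by
  constructor
  · rintro ⟨b, hb, hb'⟩
    by_cases h : ∀ i, a i ≠ (A i).point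
    · rw [smash.mk_of_ne a h] at hb
      cases hb
      exact hb'
    · push Not at h
      obtain ⟨i, hi⟩ := h
      rw [smash.mk_of_eq a i hi] at hb
      cases hb
  · intro h
    have h' : ∀ i, a i ≠ (A i).point := fun i hi => (S i).2 (by
      have := h i
      rwa [hi] at this)
    exact ⟨⟨a, h'⟩, smash.mk_of_ne a h', h⟩

lemma smash.freeSet_ext {ι : Type} {A : ι → Pointed.{0}} {S T : FreeSet (smash A)}
    (h : ∀ a, (∀ i, a i ≠ (A i).point) → (smash.mk a ∈ S.1 ↔ smash.mk a ∈ T.1)) : S = T := by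
  refine Subtype.ext (Set.ext fun z => ?_)
  rcases z with _ | ⟨a, ha⟩
  · exact ⟨fun k => (S.2 k).elim, fun k => (T.2 k).elim⟩
  · rw [← smash.mk_of_ne a ha]
    exact h a ha

/-- The partial map of index shapes underlying an iterated extension functor. -/
noncomputable def iterShapeMap (p : ℕ) {A : Pointed.{0}} : ∀ (q : ℕ) (_ : Fin q → A),
    Shape.PMap (multiShape (fun _ : Fin (p + q) => A)) (multiShape (fun _ : Fin p => A))
  | 0, _ => Shape.PMap.ofTotal ⟨id, id, id, id⟩
  | q + 1, t => (extShapeMap (fun _ : Fin (p + q + 1) => A) (t (Fin.last q))).comp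
      (iterShapeMap p q fun i => t i.castSucc)

open Classical in
lemma iterShapeMap_idx (p q : ℕ) {A : Pointed.{0}} (t : Fin q → A)
    (S : Fin (p + q) → FreeSet A) :
    (iterShapeMap p q t).idx S = if ∀ j, t j ∈ (S (Fin.natAdd p j)).1
      then some (fun i => S (Fin.castAdd q i)) else none := by
  induction q with
  | zero =>
    rw [if_pos (fun j => j.elim0)]
    rfl
  | succ q ih =>
    have h₁ : (∀ j : Fin (q + 1), t j ∈ (S (Fin.natAdd p j)).1) ↔
        t (Fin.last q) ∈ (S (Fin.last (p + q))).1 ∧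
          ∀ j : Fin q, t j.castSucc ∈ (S (Fin.natAdd p j).castSucc).1 := by
      rw [Fin.forall_fin_succ', and_comm]
      rfl
    show Option.bind (if t (Fin.last q) ∈ (S (Fin.last (p + q))).1
      then some (fun i : Fin (p + q) => S i.castSucc) else none) _ = _
    by_cases h : t (Fin.last q) ∈ (S (Fin.last (p + q))).1
    · rw [if_pos h]
      refine (ih (fun i => t i.castSucc) (fun i => S i.castSucc)).trans ?_
      simp only [h₁, h, true_and]
      rfl
    · rw [if_neg h, if_neg (fun k => h (h₁.1 k).1)]
      rfl

lemma iterShapeMap_dir_castAdd (p q : ℕ) {A : Pointed.{0}} (t : Fin q → A) (i : Fin p) :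
    (iterShapeMap p q t).dir (Fin.castAdd q i) = some i := by
  induction q with
  | zero => rfl
  | succ q ih =>
    show Option.bind (Fin.lastCases (motive := fun _ => Option (Fin (p + q))) none some
      (Fin.castAdd q i).castSucc) _ = _
    rw [Fin.lastCases_castSucc]
    exact ih _

lemma iterShapeMap_dir_natAdd (p q : ℕ) {A : Pointed.{0}} (t : Fin q → A) (i : Fin q) :
    (iterShapeMap p q t).dir (Fin.natAdd p i) = none := by
  induction q with
  | zero => exact i.elim0
  | succ q ih =>
    induction i using Fin.lastCases with
    | last =>
      show Option.bind (Fin.lastCases (motive := fun _ => Option (Fin (p + q))) none some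
        (Fin.last (p + q))) _ = _
      rw [Fin.lastCases_last]
      rfl
    | cast i =>
      show Option.bind (Fin.lastCases (motive := fun _ => Option (Fin (p + q))) none some
        (Fin.natAdd p i).castSucc) _ = _
      rw [Fin.lastCases_castSucc]
      exact ih _ i

/-- The functor that sends `A` to the tuple `(A, …, A)`. -/
def constTuple (p : ℕ) : Pointed.{0} ⥤ (Fin p → Pointed.{0}) where
  obj A _ := A
  map f _ := f

/-- The multivariable construction on constant tuples, `A ↦ C̄_{(A, …, A)}`. -/
noncomputable def multiSequence : SymmetricSequence.{u} where
  F p := constTuple p ⋙ multiCat C (Fin p)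
  perm p :=
    { toFun := fun α =>
        { app := fun A => permFunctor C α (fun _ => A)
          naturality := fun A B f => System.pull_square
            (Shape.PMap.ofTotal (permShapeMap α fun _ => B))
            (Shape.PMap.ofTotal (multiShapeMap ((constTuple p).map f)))
            (Shape.PMap.ofTotal (multiShapeMap ((constTuple p).map f)))
            (Shape.PMap.ofTotal (permShapeMap α fun _ => A)) le_rfl le_rfl le_rfl le_rfl
            (fun _ => Or.inl rfl) (fun _ => Or.inl rfl) }
      map_one' := NatTrans.ext (funext fun A => congrArg Functor.toCatHom System.pull_ofTotal_id)
      map_mul' := fun α β => NatTrans.ext (funext fun A => congrArg Functor.toCatHom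
        (System.pull_comp (Shape.PMap.ofTotal (permShapeMap α fun _ => A))
          (Shape.PMap.ofTotal (permShapeMap β fun _ => A)) le_rfl le_rfl).symm) }
  zero p A := System.zero
  map_zero p A B f := System.pull_zero _ le_rfl
  perm_zero p α A := System.pull_zero _ le_rfl
  ext p A x := extFunctor C (fun _ => A) x
  ext_natural p A B f x := by
    refine System.pull_square
      (Shape.PMap.ofTotal (multiShapeMap ((constTuple (p + 1)).map f)))
      (extShapeMap (fun _ => A) x) (extShapeMap (fun _ => B) (f.toFun x))
      (Shape.PMap.ofTotal (multiShapeMap ((constTuple p).map f))) le_rfl le_rfl le_rfl le_rfl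
      (fun S => Or.inl ?_) (fun i => Or.inl ?_)
    · by_cases h : f.toFun x ∈ (S (Fin.last p)).1
      · refine (extShapeMap_idx_of_mem (fun _ => A) x _ h).trans ?_
        show _ = Option.bind ((extShapeMap (fun _ => B) (f.toFun x)).idx S) _
        exact (congrArg (fun o => Option.bind o (Shape.PMap.ofTotal (multiShapeMap
          ((constTuple p).map f))).idx) (extShapeMap_idx_of_mem (fun _ => B) _ S h)).symm
      · refine (extShapeMap_idx_of_notMem (fun _ => A) x _ h).trans ?_
        show _ = Option.bind ((extShapeMap (fun _ => B) (f.toFun x)).idx S) _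
        exact (congrArg (fun o => Option.bind o (Shape.PMap.ofTotal (multiShapeMap
          ((constTuple p).map f))).idx) (extShapeMap_idx_of_notMem (fun _ => B) _ S h)).symm
    · exact (Option.bind_fun_some ((extShapeMap (fun _ => B) (f.toFun x)).dir i)).symm
  ext_zero p A x := System.pull_zero _ le_rfl
  ext_point p A := System.pull_eq_const _ le_rfl fun S k hk => by
    rw [extShapeMap_idx_of_notMem _ _ _ (S (Fin.last p)).2] at hk
    cases hk
  iter p q A t := (System.pull (iterShapeMap p q t) le_rfl).toCatHom
  iter_zero p A t := congrArg Functor.toCatHom System.pull_ofTotal_id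
  iter_succ p q A t := congrArg Functor.toCatHom (System.pull_comp _ _ le_rfl le_rfl).symm
  equivariant p q A α β t := by
    refine System.pull_square (iterShapeMap p q fun i => t (β.symm i))
      (Shape.PMap.ofTotal (permShapeMap α fun _ => A))
      (Shape.PMap.ofTotal (permShapeMap (blockPerm α β) fun _ => A)) (iterShapeMap p q t)
      le_rfl le_rfl le_rfl le_rfl (fun S => Or.inl ?_) (fun i => Or.inl ?_)
    · show Option.bind ((iterShapeMap p q fun i => t (β.symm i)).idx S) _ =
        (iterShapeMap p q t).idx (fun i => S (blockPerm α β i))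
      rw [iterShapeMap_idx, iterShapeMap_idx]
      have h : (∀ j, t (β.symm j) ∈ (S (Fin.natAdd p j)).1) ↔
          ∀ j, t j ∈ (S (blockPerm α β (Fin.natAdd p j))).1 := by
        constructor
        · intro h j
          rw [blockPerm_natAdd]
          simpa using h (β j)
        · intro h j
          have := h (β.symm j)
          rwa [blockPerm_natAdd, β.apply_symm_apply] at this
      by_cases hS : ∀ j, t (β.symm j) ∈ (S (Fin.natAdd p j)).1
      · rw [if_pos hS, if_pos (h.1 hS)]
        refine congrArg some (funext fun i => ?_)
        show S (Fin.castAdd q (α i)) = S (blockPerm α β (Fin.castAdd q i))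
        rw [blockPerm_castAdd]
      · rw [if_neg hS, if_neg (fun k => hS (h.2 k))]
        rfl
    · show Option.bind ((iterShapeMap p q fun i => t (β.symm i)).dir i) _ =
        (iterShapeMap p q t).dir ((blockPerm α β).symm i)
      induction i using Fin.addCases with
      | left i =>
        rw [iterShapeMap_dir_castAdd, blockPerm_symm_castAdd, iterShapeMap_dir_castAdd]
        rfl
      | right i =>
        rw [iterShapeMap_dir_natAdd, blockPerm_symm_natAdd, iterShapeMap_dir_natAdd]
        rfl

/-- The comparison of the two constructions. -/
noncomputable def compareHom : SymmetricSequence.Hom (segalSequence C) (multiSequence C) where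
  app p :=
    { app := fun A => compareFunctor C (fun _ : Fin p => A)
      naturality := fun A B f => System.pull_square
        (Shape.PMap.ofTotal (prodShapeMap fun _ : Fin p => B))
        (Shape.PMap.ofTotal (segShapeMap ((smash.pow p).map f)))
        (Shape.PMap.ofTotal (multiShapeMap ((constTuple p).map f)))
        (Shape.PMap.ofTotal (prodShapeMap fun _ : Fin p => A)) le_rfl le_top le_top le_rfl
        (fun S => Or.inl (congrArg some (smash.freeSet_ext fun a _ => by
          show (smash.map fun _ => f).toFun (smash.mk a) ∈
            ((prodShapeMap fun _ : Fin p => B).idx S).1 ↔ _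
          rw [smash.map_mk, mk_mem_prodShapeMap]
          exact (mk_mem_prodShapeMap (A := fun _ : Fin p => A)
            (fun i => FreeSet.preimage f (S i)) a).symm))) (fun _ => Or.inl rfl) }
  app_zero p A := System.pull_zero _ le_top
  app_perm p α := NatTrans.ext (funext fun A => System.pull_square
    (Shape.PMap.ofTotal (prodShapeMap fun _ : Fin p => A))
    (Shape.PMap.ofTotal (segShapeMap (smash.perm α)))
    (Shape.PMap.ofTotal (permShapeMap α fun _ => A))
    (Shape.PMap.ofTotal (prodShapeMap fun _ : Fin p => A)) le_rfl le_top le_top le_rfl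
    (fun S => Or.inl (congrArg some (smash.freeSet_ext fun a _ => by
      show (smash.perm α).toFun (smash.mk a) ∈ ((prodShapeMap fun _ : Fin p => A).idx S).1 ↔ _
      rw [smash.perm_mk, mk_mem_prodShapeMap, mk_mem_prodShapeMap]
      refine ⟨fun h i => ?_, fun h i => ?_⟩
      · have : a i ∈ (S (α i)).1 := by simpa using h (α i)
        exact this
      · have : a (α.symm i) ∈ (S (α (α.symm i))).1 := h (α.symm i)
        rwa [α.apply_symm_apply] at this))) (fun _ => Or.inl rfl))
  app_ext p A x := by
    have key : ∀ (S : Fin (p + 1) → FreeSet A) (a : Fin p → A),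
        smash.mk a ∈ (FreeSet.preimage (smash.ext x)
          ((prodShapeMap fun _ : Fin (p + 1) => A).idx S)).1 ↔
        (∀ i, a i ∈ (S i.castSucc).1) ∧ x ∈ (S (Fin.last p)).1 := by
      intro S a
      show (smash.ext x).toFun (smash.mk a) ∈
        ((prodShapeMap fun _ : Fin (p + 1) => A).idx S).1 ↔ _
      rw [smash.ext_mk, mk_mem_prodShapeMap, Fin.forall_fin_succ']
      simp
    have hempty : ∀ S : Fin (p + 1) → FreeSet A, x ∉ (S (Fin.last p)).1 →
        (FreeSet.preimage (smash.ext x)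
          ((prodShapeMap fun _ : Fin (p + 1) => A).idx S)).1 = ∅ := by
      intro S hS
      have := smash.freeSet_ext (S := FreeSet.preimage (smash.ext x)
        ((prodShapeMap fun _ : Fin (p + 1) => A).idx S))
        (T := (⟨∅, by simp⟩ : FreeSet (smash fun _ : Fin p => A)))
        (fun a _ => by
          rw [key]
          simp [hS])
      rw [this]
    refine System.pull_square
      (Shape.PMap.ofTotal (prodShapeMap fun _ : Fin (p + 1) => A))
      (Shape.PMap.ofTotal (segShapeMap (smash.ext x)))
      (extShapeMap (fun _ => A) x)
      (Shape.PMap.ofTotal (prodShapeMap fun _ : Fin p => A)) le_rfl le_top le_top le_rfl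
      (fun S => ?_) (fun i => ?_)
    · by_cases hS : x ∈ (S (Fin.last p)).1
      · left
        show _ = Option.bind ((extShapeMap (fun _ => A) x).idx S) _
        rw [extShapeMap_idx_of_mem _ _ _ hS]
        refine congrArg some (smash.freeSet_ext fun a _ => ?_)
        rw [mk_mem_prodShapeMap]
        refine (key S a).trans ?_
        simp [hS]
      · right
        constructor
        · rintro _ ⟨⟩
          exact hempty S hS
        · show ∀ k ∈ Option.bind ((extShapeMap (fun _ => A) x).idx S) _, _
          rw [extShapeMap_idx_of_notMem _ _ _ hS]
          rintro _ ⟨⟩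
    · induction i using Fin.lastCases with
      | last =>
        right
        intro S T U h
        by_cases hT : x ∈ (T (Fin.last p)).1
        · right
          rintro _ ⟨⟩
          refine hempty U fun hU => ?_
          have : x ∈ (T (Fin.last p)).1 ∩ (U (Fin.last p)).1 := ⟨hT, hU⟩
          rw [h.2.2] at this
          exact this
        · left
          rintro _ ⟨⟩
          exact hempty T hT
      | cast i =>
        left
        show _ = Option.bind ((extShapeMap (fun _ => A) x).dir i.castSucc) _
        rw [extShapeMap_dir_castSucc]
        rfl

/-- Segal's construction of the `K`-theory of a permutative category: the symmetric spectrum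
`{N C̄_{Sⁿ}}`. -/
noncomputable def segalK : SymmetricSpectrum.{u} := (segalSequence C).spectrum

/-- The new construction of the `K`-theory of a permutative category: the symmetric spectrum
`{N C̄_{(S¹, …, S¹)}}`. -/
noncomputable def newK : SymmetricSpectrum.{u} := (multiSequence C).spectrum

/-- The natural map of symmetric spectra from Segal's construction to the new one. -/
noncomputable def segalToNew : segalK C ⟶ newK C := (compareHom C).spectrumMap

end KTheory

/-! Fix finite based sets and let `L` be the comparison functor from Segal systems to multivariable
systems. A multivariable system `X` gives a Segal system `R X` whose value at `T` is the sum of the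
objects `X` takes on the one-point tuples `({a₁}, …, {aₙ})`, over the points `(a₁, …, aₙ)` of `T` in
some fixed order. Its sum maps only permute summands, so they are isomorphisms although those of `X`
need not be. Adding the summands up by the maps `ρ` gives natural transformations `ε : L R ⟶ 𝟭` and
`η : R L ⟶ 𝟭` with `L η = ε L`. That these are morphisms of systems is the interchange axiom.
Neither has to be invertible: natural transformations become homotopies of nerves, and that
suffices.

Formally, `R` is built together with `ε` and `η` over larger and larger tuples `B` of subsets
(`CompareApprox`). Over one point it is the value at that point, extended by zero; over a disjoint
union it is the objectwise sum (`CompareApprox.add`). The outcome is `exists_compareFunctor_counit`.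

The order of the summands is not respected by based maps, so `R` is not natural in the simplicial
degree, and an argument is needed to pass to diagonals. The collage of `L`, a mapping cylinder made
of categories, is natural. It contains source and target of `L`, and projects to the target. Both
inclusions are anodyne on nerves in each degree: that of the target always, that of the source
because of `R`, `ε` and `η`. A map of bisimplicial sets that is anodyne in each row has an anodyne
diagonal (`anodyneExtensions_diagonal_map`), so `L` is handled by two out of three
(`weakEquiv_diagonal_nerve`).

Finally, the realization of an anodyne map is a homotopy equivalence
(`weakEquiv_of_anodyneExtensions`). The singular complex of a map with the homotopy lifting property
is a Kan fibration, so by adjunction the realized map lifts against the map to a point, which gives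
a retraction, and against the end points of paths, which gives the homotopy. -/

namespace SSet

/-! ### Homotopy lifting and right cancellation for anodyne extensions -/

open Simplicial HomotopicalAlgebra modelCategoryQuillen CartesianMonoidalCategory

/-- The inclusion `X ⟶ X ⊗ Δ[1]` of the end `e` of the cylinder. -/
noncomputable def endIncl (e : Fin 2) {X : SSet.{u}} : X ⟶ X ⊗ Δ[1] :=
  lift (𝟙 X) (const (stdSimplex.obj₀Equiv.{u}.symm e))

lemma endIncl_comp (e : Fin 2) {X Y : SSet.{u}} (f : X ⟶ Y) :
    endIncl e ≫ f ▷ _ = f ≫ endIncl e := rfl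

lemma eq_endIncl_app (e : Fin 2) {X : SSet.{u}} {m : SimplexCategoryᵒᵖ} (x : X.obj m)
    (d : (Δ[1] : SSet.{u}).obj m) (h : ∀ k, stdSimplex.asOrderHom d k = e) :
    ((x, d) : (X ⊗ Δ[1]).obj m) = (endIncl e).app m x := by
  refine Prod.ext rfl ?_
  refine stdSimplex.objEquiv.injective (SimplexCategory.Hom.ext _ _ (OrderHom.ext _ _ ?_))
  funext k
  exact h k

/-- A simplex of a horn misses some vertex other than `e`. In `Δ[1]` there is only one such vertex,
so this horn is the point `e`. -/
lemma asOrderHom_of_mem_horn_one (e : Fin 2) {m : SimplexCategoryᵒᵖ}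
    (d : (Δ[1] : SSet.{u}).obj m) (h : d ∈ (horn 1 e).obj m) (k) :
    stdSimplex.asOrderHom d k = e := by
  by_contra hk
  refine (mem_horn_iff _ _).1 h (Set.eq_univ_of_forall fun j => ?_)
  by_cases hj : j = e
  · exact Or.inr hj
  · refine Or.inl ⟨k, ?_⟩
    have h₁ : ∀ a b c : Fin 2, a ≠ c → b ≠ c → a = b := by decide
    exact h₁ _ _ _ hk hj

/-- Lifting of homotopies along a fibration, relative to a subcomplex. -/
lemma exists_homotopy_lift (e : Fin 2) {B X Y : SSet.{u}} (A : B.Subcomplex) (p : X ⟶ Y)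
    (hp : fibrations SSet p) (c : B ⟶ X) (h : (A : SSet) ⊗ Δ[1] ⟶ X) (b : B ⊗ Δ[1] ⟶ Y)
    (h₁ : endIncl e ≫ h = A.ι ≫ c) (h₂ : A.ι ▷ _ ≫ b = h ≫ p) (h₃ : endIncl e ≫ b = c ≫ p) :
    ∃ H : B ⊗ Δ[1] ⟶ X, endIncl e ≫ H = c ∧ A.ι ▷ _ ≫ H = h ∧ H ≫ p = b := by
  -- The inclusion of `B × {e} ∪ A × Δ[1]` in `B × Δ[1]` is a pushout-product with an anodyne
  -- factor. The map `c` on the first part and `h` on the second pose the lifting problem.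
  have han := anodyneExtensions_unionProd_ι A (horn.{u} 1 e) (anodyneExtensions.horn_ι e)
  have hpo := Subcomplex.unionProd.isPushout A (horn.{u} 1 e)
  have hw : A.ι ▷ (horn.{u} 1 e : SSet) ≫ (fst _ _ ≫ c) = ((A : SSet) ◁ (horn.{u} 1 e).ι) ≫ h := by
    ext m ⟨a, d⟩
    have h₄ := eq_endIncl_app e a d.1 (asOrderHom_of_mem_horn_one e d.1 d.2)
    have h₅ := ConcreteCategory.congr_hom (NatTrans.congr_app h₁ m) a
    have h₆ := (congrArg (h.app m) h₄).trans h₅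
    exact h₆.symm
  have sq : CommSq (hpo.desc _ _ hw) (A.unionProd (horn.{u} 1 e)).ι p b := ⟨by
    apply hpo.hom_ext
    · rw [hpo.inl_desc_assoc, Subcomplex.unionProd.ι₁_ι_assoc]
      ext m ⟨a, d⟩
      have h₄ := eq_endIncl_app e a d.1 (asOrderHom_of_mem_horn_one e d.1 d.2)
      have h₅ := ConcreteCategory.congr_hom (NatTrans.congr_app h₃ m) a
      exact ((congrArg (b.app m) h₄).trans h₅).symm
    · rw [hpo.inr_desc_assoc, Subcomplex.unionProd.ι₂_ι_assoc, h₂]⟩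
  have := han _ hp
  refine ⟨sq.lift, ?_, ?_, sq.fac_right⟩
  · have h₄ : Subcomplex.unionProd.ι₁ A (horn.{u} 1 e) ≫
        (A.unionProd (horn.{u} 1 e)).ι ≫ sq.lift = fst _ _ ≫ c := by
      rw [sq.fac_left, hpo.inl_desc]
    ext m x
    have hd : (const (stdSimplex.obj₀Equiv.{u}.symm e)).app m x ∈ (horn.{u} 1 e).obj m := by
      rw [mem_horn_iff]
      intro h₅
      have : ∀ e : Fin 2, ∃ j : Fin 2, j ≠ e := by decide
      obtain ⟨j, hj⟩ := this e
      rcases Set.eq_univ_iff_forall.1 h₅ j with ⟨k, hk⟩ | hk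
      · exact hj hk.symm
      · exact hj hk
    exact ConcreteCategory.congr_hom (NatTrans.congr_app h₄ m)
      ((x, ⟨_, hd⟩) : (B ⊗ (horn.{u} 1 e : SSet)).obj m)
  · rw [← Subcomplex.unionProd.ι₂_ι A (horn.{u} 1 e), Category.assoc, sq.fac_left, hpo.inr_desc]

/-- The map on `Y ⊗ ∂Δ[1]` given by two maps on `Y`. -/
noncomputable def bdryDesc {Y Z : SSet.{u}} (f g : Y ⟶ Z) :
    Y ⊗ (boundary.{u} 1 : SSet) ⟶ Z := by
  classical
  exact
  { app := fun m => ↾fun y => if ∃ k, stdSimplex.asOrderHom y.2.1 k = 0 then f.app m y.1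
      else g.app m y.1
    naturality := fun m n θ => by
      ext ⟨y, d, hd⟩
      have hd' : ¬ Function.Surjective (stdSimplex.asOrderHom d) := hd
      show (if ∃ k, stdSimplex.asOrderHom ((Δ[1] : SSet.{u}).map θ d) k = 0
          then f.app n (Y.map θ y) else g.app n (Y.map θ y)) =
        Z.map θ (if ∃ k, stdSimplex.asOrderHom d k = 0 then f.app m y else g.app m y)
      have h : ∀ k, stdSimplex.asOrderHom ((Δ[1] : SSet.{u}).map θ d) k =
        stdSimplex.asOrderHom d (θ.unop.toOrderHom k) := fun k => rfl
      by_cases h₀ : ∃ k, stdSimplex.asOrderHom d k = 0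
      -- The simplices of `∂Δ[1]` are not surjective, hence constant: one value `0` forces all
      -- values to be `0`.
      · have : ∀ k, stdSimplex.asOrderHom d k = 0 := by
          intro k
          by_contra hk
          obtain ⟨l, hl⟩ := h₀
          apply hd'
          have h₁ : ∀ a b : Fin 2, a ≠ 0 → b = 0 ∨ b = a := by decide
          intro b
          rcases h₁ _ b hk with rfl | rfl
          exacts [⟨l, hl⟩, ⟨k, rfl⟩]
        rw [if_pos h₀, if_pos ⟨0, (h 0).trans (this _)⟩]
        exact NatTrans.naturality_apply f θ y
      · rw [if_neg h₀, if_neg (fun ⟨k, hk⟩ => h₀ ⟨_, (h k).symm.trans hk⟩)]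
        exact NatTrans.naturality_apply g θ y }

lemma bdryDesc_app_zero {Y Z : SSet.{u}} (f g : Y ⟶ Z) {m : SimplexCategoryᵒᵖ} (y : Y.obj m)
    (d : (boundary.{u} 1 : SSet).obj m) (h : ∃ k, stdSimplex.asOrderHom d.1 k = 0) :
    (bdryDesc f g).app m ((y, d) : (Y ⊗ (boundary.{u} 1 : SSet)).obj m) = f.app m y := by
  exact if_pos h

lemma bdryDesc_app_one {Y Z : SSet.{u}} (f g : Y ⟶ Z) {m : SimplexCategoryᵒᵖ} (y : Y.obj m)
    (d : (boundary.{u} 1 : SSet).obj m) (h : ¬ ∃ k, stdSimplex.asOrderHom d.1 k = 0) :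
    (bdryDesc f g).app m ((y, d) : (Y ⊗ (boundary.{u} 1 : SSet)).obj m) = g.app m y := by
  exact if_neg h

/-- Two maps which agree on a subcomplex with anodyne inclusion, and after composition with a
fibration, are homotopic relative to the subcomplex and over the base of the fibration. -/
lemma exists_homotopy_of_anodyne {Q X Y : SSet.{u}} (A : Q.Subcomplex)
    (hA : anodyneExtensions A.ι) (p : X ⟶ Y) (hp : fibrations SSet p) (f g : Q ⟶ X)
    (h₁ : A.ι ≫ f = A.ι ≫ g) (h₂ : f ≫ p = g ≫ p) :
    ∃ h : Q ⊗ Δ[1] ⟶ X, endIncl 0 ≫ h = f ∧ endIncl 1 ≫ h = g ∧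
      A.ι ▷ _ ≫ h = fst _ _ ≫ A.ι ≫ f ∧ h ≫ p = fst _ _ ≫ f ≫ p := by
  -- Here the anodyne factor is `A ⊂ Q`. The maps `f`, `g` on the two ends and the constant homotopy
  -- on `A` are to be extended over `Q × Δ[1]`.
  have han := anodyneExtensions_unionProd_ι' A (boundary.{u} 1) hA
  have hpo := Subcomplex.unionProd.isPushout A (boundary.{u} 1)
  have hw : A.ι ▷ (boundary.{u} 1 : SSet) ≫ bdryDesc f g =
      ((A : SSet) ◁ (boundary.{u} 1).ι) ≫ fst _ _ ≫ A.ι ≫ f := by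
    ext m ⟨a, d⟩
    by_cases h : ∃ k, stdSimplex.asOrderHom d.1 k = 0
    · exact bdryDesc_app_zero f g _ _ h
    · exact (bdryDesc_app_one f g _ _ h).trans
        (ConcreteCategory.congr_hom (NatTrans.congr_app h₁ m) a).symm
  have sq : CommSq (hpo.desc _ _ hw) (A.unionProd (boundary.{u} 1)).ι p (fst _ _ ≫ f ≫ p) := ⟨by
    apply hpo.hom_ext
    · rw [hpo.inl_desc_assoc, Subcomplex.unionProd.ι₁_ι_assoc]
      ext m ⟨a, d⟩
      by_cases h : ∃ k, stdSimplex.asOrderHom d.1 k = 0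
      · exact congrArg (p.app m) (bdryDesc_app_zero f g _ _ h)
      · exact (congrArg (p.app m) (bdryDesc_app_one f g _ _ h)).trans
          (ConcreteCategory.congr_hom (NatTrans.congr_app h₂ m) a).symm
    · rw [hpo.inr_desc_assoc, Subcomplex.unionProd.ι₂_ι_assoc]
      rfl⟩
  have := han _ hp
  have h₄ : Subcomplex.unionProd.ι₁ A (boundary.{u} 1) ≫
      (A.unionProd (boundary.{u} 1)).ι ≫ sq.lift = bdryDesc f g := by
    rw [sq.fac_left, hpo.inl_desc]
  have hmem : ∀ (e : Fin 2) {m : SimplexCategoryᵒᵖ} (x : Q.obj m),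
      (const (stdSimplex.obj₀Equiv.{u}.symm e)).app m x ∈ (boundary.{u} 1).obj m := by
    intro e m x h
    have : ∀ e : Fin 2, ∃ j : Fin 2, j ≠ e := by decide
    obtain ⟨j, hj⟩ := this e
    obtain ⟨k, hk⟩ := h j
    exact hj hk.symm
  refine ⟨sq.lift, ?_, ?_, ?_, sq.fac_right⟩
  · ext m x
    refine (ConcreteCategory.congr_hom (NatTrans.congr_app h₄ m)
      ((x, ⟨_, hmem 0 x⟩) : (Q ⊗ (boundary.{u} 1 : SSet)).obj m)).trans ?_
    exact bdryDesc_app_zero f g _ _ ⟨0, rfl⟩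
  · ext m x
    refine (ConcreteCategory.congr_hom (NatTrans.congr_app h₄ m)
      ((x, ⟨_, hmem 1 x⟩) : (Q ⊗ (boundary.{u} 1 : SSet)).obj m)).trans ?_
    refine bdryDesc_app_one f g _ _ ?_
    rintro ⟨k, hk⟩
    have : (1 : Fin 2) = 0 := hk
    exact absurd this (by decide)
  · rw [← Subcomplex.unionProd.ι₂_ι A (boundary.{u} 1), Category.assoc, sq.fac_left, hpo.inr_desc]

/-- The inclusion of a subcomplex is anodyne if the ambient simplicial set can be deformed into
it through maps that preserve the subcomplex. -/
lemma anodyneExtensions_of_deformation (e e' : Fin 2) {B : SSet.{u}} (A : B.Subcomplex)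
    (h : B ⊗ Δ[1] ⟶ B) (hA : (A : SSet) ⊗ Δ[1] ⟶ (A : SSet)) (r : B ⟶ (A : SSet))
    (h₁ : endIncl e ≫ h = r ≫ A.ι) (h₂ : endIncl e' ≫ h = 𝟙 B)
    (h₃ : A.ι ▷ _ ≫ h = hA ≫ A.ι) : anodyneExtensions A.ι := by
  intro X Y p hp
  refine ⟨fun {a b} sq => ?_⟩
  have h₄ : endIncl e' ≫ hA = 𝟙 _ := by
    rw [← cancel_mono A.ι, Category.assoc, ← h₃, ← Category.assoc, endIncl_comp, Category.assoc, h₂,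
      Category.comp_id, Category.id_comp]
  have h₅ : endIncl e ≫ hA = A.ι ≫ r := by
    rw [← cancel_mono A.ι, Category.assoc, ← h₃, ← Category.assoc, endIncl_comp, Category.assoc, h₁,
      Category.assoc]
  -- At the end `e` the problem is solved by `r ≫ a`. This solution is transported along the
  -- deformation to the end `e'`, where the deformation is the identity. The subcomplex may move
  -- within itself.
  obtain ⟨H, H₁, H₂, H₃⟩ := exists_homotopy_lift e A p hp (r ≫ a) (hA ≫ a) (h ≫ b)
    (by rw [← Category.assoc, h₅, Category.assoc])
    (by rw [← Category.assoc, h₃, Category.assoc, Category.assoc, sq.w])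
    (by rw [← Category.assoc, h₁, Category.assoc, Category.assoc, sq.w])
  refine ⟨⟨⟨endIncl e' ≫ H, ?_, ?_⟩⟩⟩
  · rw [← Category.assoc, ← endIncl_comp, Category.assoc, H₂, ← Category.assoc, h₄,
      Category.id_comp]
  · rw [Category.assoc, H₃, ← Category.assoc, h₂, Category.id_comp]

/-- Right cancellation for anodyne extensions among inclusions of subcomplexes. -/
lemma anodyneExtensions_cancel {R : SSet.{u}} (Q : R.Subcomplex)
    (P : (Q : SSet).Subcomplex) (hP : anodyneExtensions P.ι)
    (hPQ : anodyneExtensions (P.ι ≫ Q.ι)) : anodyneExtensions Q.ι := by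
  intro X Y p hp
  refine ⟨fun {a b} sq => ?_⟩
  have := hPQ _ hp
  have sq' : CommSq (P.ι ≫ a) (P.ι ≫ Q.ι) p b := ⟨by rw [Category.assoc, sq.w, Category.assoc]⟩
  -- The lift on `R` extends only the restriction of `a` to `P`. On `Q` it is fibrewise homotopic to
  -- `a`; extending this homotopy over `R` and taking its other end corrects the lift.
  obtain ⟨h, k₁, k₂, k₃, k₄⟩ := exists_homotopy_of_anodyne P hP p hp (Q.ι ≫ sq'.lift) a
    (by rw [← Category.assoc, sq'.fac_left]) (by rw [Category.assoc, sq'.fac_right, sq.w])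
  obtain ⟨H, H₁, H₂, H₃⟩ := exists_homotopy_lift 0 Q p hp sq'.lift h (fst _ _ ≫ b) k₁
    (by rw [k₄, Category.assoc, sq'.fac_right]; rfl)
    (by rw [sq'.fac_right]; rfl)
  refine ⟨⟨⟨endIncl 1 ≫ H, ?_, ?_⟩⟩⟩
  · rw [← Category.assoc, ← endIncl_comp, Category.assoc, H₂, k₂]
  · rw [Category.assoc, H₃]; rfl

end SSet

/-! ### Calculus of anodyne inclusions of subcomplexes -/

namespace SSet

open Simplicial HomotopicalAlgebra modelCategoryQuillen CartesianMonoidalCategory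

lemma anodyneExtensions_of_comp {P Q R : SSet.{u}} (i : P ⟶ Q) (k : Q ⟶ R) [Mono i] [Mono k]
    (hi : anodyneExtensions i) (hik : anodyneExtensions (i ≫ k)) : anodyneExtensions k := by
  let P' : (Subcomplex.range k : SSet).Subcomplex := Subcomplex.range (i ≫ Subcomplex.toRange k)
  have h₁ : i ≫ Subcomplex.toRange k = Subcomplex.toRange (i ≫ Subcomplex.toRange k) ≫ P'.ι := rfl
  have h₂ : anodyneExtensions P'.ι := by
    rw [← MorphismProperty.cancel_left_of_respectsIso anodyneExtensions
      (Subcomplex.toRange (i ≫ Subcomplex.toRange k)), ← h₁,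
      MorphismProperty.cancel_right_of_respectsIso anodyneExtensions]
    exact hi
  have h₃ : anodyneExtensions (P'.ι ≫ (Subcomplex.range k).ι) := by
    rw [← MorphismProperty.cancel_left_of_respectsIso anodyneExtensions
      (Subcomplex.toRange (i ≫ Subcomplex.toRange k)), ← Category.assoc, ← h₁, Category.assoc,
      Subcomplex.toRange_ι]
    exact hik
  have h₄ := anodyneExtensions_cancel _ _ h₂ h₃
  rw [← Subcomplex.toRange_ι k, MorphismProperty.cancel_left_of_respectsIso anodyneExtensions]
  exact h₄

namespace Subcomplex

variable {T : SSet.{u}}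

/-- The subcomplex `P` is contained in `Q` and the inclusion is anodyne. -/
def IsAnodyne (P Q : T.Subcomplex) : Prop :=
  ∃ h : P ≤ Q, anodyneExtensions (homOfLE h)

lemma IsAnodyne.refl (P : T.Subcomplex) : IsAnodyne P P :=
  ⟨le_rfl, MorphismProperty.id_mem anodyneExtensions _⟩

lemma IsAnodyne.trans {P Q R : T.Subcomplex} (h₁ : IsAnodyne P Q) (h₂ : IsAnodyne Q R) :
    IsAnodyne P R :=
  ⟨h₁.1.trans h₂.1, MorphismProperty.comp_mem _ _ _ h₁.2 h₂.2⟩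

lemma IsAnodyne.cancel {P Q R : T.Subcomplex} (h₁ : IsAnodyne P Q) (h₂ : IsAnodyne P R)
    (h : Q ≤ R) : IsAnodyne Q R :=
  ⟨h, anodyneExtensions_of_comp (homOfLE h₁.1) (homOfLE h) h₁.2 h₂.2⟩

/-- A union of subcomplexes is the pushout over their intersection, and anodyne maps are stable
under pushouts. -/
lemma IsAnodyne.sup {P Q : T.Subcomplex} (h : IsAnodyne (P ⊓ Q) Q) : IsAnodyne P (P ⊔ Q) := by
  have sq : BicartSq (P ⊓ Q) P Q (P ⊔ Q) := ⟨rfl, rfl⟩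
  exact ⟨le_sup_left, MorphismProperty.of_isPushout (P := anodyneExtensions) sq.isPushout h.2⟩

lemma sup_inf_distrib (P Q R : T.Subcomplex) : (P ⊔ Q) ⊓ R = (P ⊓ R) ⊔ (Q ⊓ R) :=
  Subfunctor.ext (funext fun _ => Set.union_inter_distrib_right _ _ _)

/-- The property that `X ⊓ A ⊂ A` is anodyne passes from `A`, `B` and `A ⊓ B` to `A ⊔ B`. `A` and
`B` are attached one after the other, both along pushouts; this is how latching subcomplexes are
assembled from images of degeneracies. -/
lemma IsAnodyne.glue {X A B : T.Subcomplex} (hA : IsAnodyne (X ⊓ A) A) (hB : IsAnodyne (X ⊓ B) B)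
    (hAB : IsAnodyne (X ⊓ (A ⊓ B)) (A ⊓ B)) : IsAnodyne (X ⊓ (A ⊔ B)) (A ⊔ B) := by
  have h₁ : IsAnodyne (X ⊓ (A ⊔ B)) (X ⊓ (A ⊔ B) ⊔ A) := by
    refine IsAnodyne.sup ?_
    have : X ⊓ (A ⊔ B) ⊓ A = X ⊓ A := by
      rw [inf_assoc, inf_eq_right.2 (le_sup_left : A ≤ A ⊔ B)]
    rwa [this]
  -- Once `A` is attached, `B` meets the result in this union. It is an anodyne enlargement of `X ⊓
  -- B`, which is itself anodyne in `B`, so cancellation applies.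
  have h₂ : IsAnodyne ((X ⊓ B) ⊔ (A ⊓ B)) B := by
    refine IsAnodyne.cancel (IsAnodyne.sup ?_) hB (sup_le inf_le_right inf_le_right)
    have : X ⊓ B ⊓ (A ⊓ B) = X ⊓ (A ⊓ B) := by
      rw [inf_assoc, inf_eq_right.2 inf_le_right]
    rwa [this]
  have h₃ : IsAnodyne (X ⊓ (A ⊔ B) ⊔ A) ((X ⊓ (A ⊔ B) ⊔ A) ⊔ B) := by
    refine IsAnodyne.sup ?_
    have : (X ⊓ (A ⊔ B) ⊔ A) ⊓ B = (X ⊓ B) ⊔ (A ⊓ B) := by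
      rw [sup_inf_distrib, inf_assoc, inf_eq_right.2 (le_sup_right : B ≤ A ⊔ B)]
    rwa [this]
  have h₄ : (X ⊓ (A ⊔ B) ⊔ A) ⊔ B = A ⊔ B := by
    rw [sup_assoc, sup_eq_right.2 inf_le_right]
  rw [h₄] at h₃
  exact h₁.trans h₃

/-- A monomorphism maps each subcomplex isomorphically onto its image. -/
lemma IsAnodyne.image {T' : SSet.{u}} (f : T ⟶ T') [Mono f] {P Q : T.Subcomplex}
    (h : IsAnodyne P Q) : IsAnodyne (P.image f) (Q.image f) := by
  have hm : ∀ P : T.Subcomplex, IsIso (P.toImage f) := fun P => by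
    have : Mono (P.toImage f) := by
      have : Mono (P.toImage f ≫ (P.image f).ι) := by
        rw [toImage_ι]
        infer_instance
      exact mono_of_mono (P.toImage f) (P.image f).ι
    exact isIso_of_mono_of_epi _
  have := hm P
  have := hm Q
  refine ⟨image_monotone f h.1, ?_⟩
  have e : P.toImage f ≫ homOfLE (image_monotone f h.1) = homOfLE h.1 ≫ Q.toImage f := rfl
  rw [← MorphismProperty.cancel_left_of_respectsIso anodyneExtensions (P.toImage f), e,
    MorphismProperty.cancel_right_of_respectsIso anodyneExtensions]
  exact h.2

lemma isAnodyne_top_iff (P : T.Subcomplex) : IsAnodyne P ⊤ ↔ anodyneExtensions P.ι := by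
  have h : homOfLE (le_top : P ≤ ⊤) ≫ (topIso T).hom = P.ι := rfl
  rw [← h, MorphismProperty.cancel_right_of_respectsIso anodyneExtensions]
  exact ⟨fun h => h.2, fun h => ⟨le_top, h⟩⟩

/-- Attaching a simplicial set along a subcomplex, in terms of subcomplexes. -/
lemma isPushout_of_injective {N : SSet.{u}} (c : N ⟶ T) (F : T.Subcomplex)
    (hc : ∀ n (x y : N.obj n), c.app n x ∉ F.obj n → c.app n x = c.app n y → x = y) :
    IsPushout (F.fromPreimage c) (F.preimage c).ι (homOfLE (le_sup_left : F ≤ F ⊔ range c))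
      (lift c (le_sup_right : range c ≤ F ⊔ range c)) where
  w := rfl
  isColimit' := ⟨Limits.evaluationJointlyReflectsColimits _ (fun n ↦ by
    refine (Limits.isColimitMapCoconePushoutCoconeEquiv _ _).2 (IsPushout.isColimit ?_)
    have hm : Mono (((CategoryTheory.evaluation _ _).obj n).map
        (homOfLE (le_sup_left : F ≤ F ⊔ range c))) := by
      rw [mono_iff_injective]
      intro x y h
      exact Subtype.ext (Subtype.ext_iff.1 h :)
    refine Limits.Types.isPushout_of_isPullback_of_mono' ?_ ?_ ?_
    · rw [Limits.Types.isPullback_iff]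
      refine ⟨rfl, fun x y h => Subtype.ext h.2, fun x y h => ?_⟩
      have h' : x.1 = c.app n y := congrArg Subtype.val h
      have h'' : c.app n y ∈ F.obj n := h' ▸ x.2
      exact ⟨⟨y, h''⟩, Subtype.ext h'.symm, rfl⟩
    · refine Set.eq_univ_of_forall fun x => ?_
      rcases x.2 with h | ⟨y, h⟩
      · exact Or.inl ⟨⟨x.1, h⟩, rfl⟩
      · exact Or.inr ⟨y, Subtype.ext h⟩
    · intro x y hx hy h
      exact hc n x y (fun h' => hx ⟨⟨x, h'⟩, rfl⟩) (congrArg Subtype.val h))⟩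

lemma IsAnodyne.attach {N : SSet.{u}} (c : N ⟶ T) (F : T.Subcomplex)
    (hc : ∀ n (x y : N.obj n), c.app n x ∉ F.obj n → c.app n x = c.app n y → x = y)
    (h : anodyneExtensions (F.preimage c).ι) : IsAnodyne F (F ⊔ range c) :=
  ⟨le_sup_left, MorphismProperty.of_isPushout (isPushout_of_injective c F hc) h⟩

end Subcomplex

end SSet

/-! ### Diagonals of bisimplicial sets -/

namespace SSet

open Simplicial HomotopicalAlgebra modelCategoryQuillen CartesianMonoidalCategory

section Diagonal

variable (M : SimplicialObject SSet.{u})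

/-- The simplicial set formed by the `n`-simplices of the rows of a bisimplicial set. -/
abbrev columnSSet (n : SimplexCategoryᵒᵖ) : SSet.{u} :=
  M ⋙ (CategoryTheory.evaluation SimplexCategoryᵒᵖ (Type u)).obj n

/-- The part of the latching subcomplex of `M _⦋n + 1⦌` that is generated by the degeneracies with
index less than `k`. -/
def degeneracySup (n k : ℕ) : (M _⦋n + 1⦌).Subcomplex :=
  ⨆ (i : Fin (n + 1)) (_ : i.1 < k), Subcomplex.range (M.σ i)

variable {M} in
lemma mem_degeneracySup {n k : ℕ} {m : SimplexCategoryᵒᵖ} {x : (M _⦋n + 1⦌).obj m} :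
    x ∈ (degeneracySup M n k).obj m ↔ ∃ i : Fin (n + 1), i.1 < k ∧ ∃ y, (M.σ i).app m y = x := by
  simp [degeneracySup]

lemma degeneracySup_zero (n : ℕ) : degeneracySup M n 0 = ⊥ := by
  simp [degeneracySup]

lemma degeneracySup_succ (n k : ℕ) (hk : k < n + 1) :
    degeneracySup M n (k + 1) = degeneracySup M n k ⊔ Subcomplex.range (M.σ ⟨k, hk⟩) := by
  refine Subfunctor.ext (funext fun m => Set.ext fun x => ?_)
  refine mem_degeneracySup.trans ⟨?_, ?_⟩
  · rintro ⟨i, hi, y, rfl⟩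
    rcases Nat.lt_succ_iff_lt_or_eq.1 hi with hi | rfl
    · exact Or.inl (mem_degeneracySup.2 ⟨i, hi, y, rfl⟩)
    · exact Or.inr ⟨y, rfl⟩
  · rintro (h | ⟨y, rfl⟩)
    · obtain ⟨i, hi, y, rfl⟩ := mem_degeneracySup.1 h
      exact ⟨i, by omega, y, rfl⟩
    · exact ⟨_, by simp, y, rfl⟩

lemma degeneracySup_of_le (n k : ℕ) (hk : n + 1 ≤ k) :
    degeneracySup M n (k + 1) = degeneracySup M n k := by
  refine Subfunctor.ext (funext fun m => Set.ext fun x => ?_)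
  refine mem_degeneracySup.trans (Iff.trans ?_ mem_degeneracySup.symm)
  exact exists_congr fun i => and_congr_left fun _ => by omega

lemma σ_app_δ_succ_app {n : ℕ} (i : Fin (n + 1)) {m : SimplexCategoryᵒᵖ}
    (x : (M _⦋n⦌).obj m) : (M.δ i.succ).app m ((M.σ i).app m x) = x :=
  ConcreteCategory.congr_hom (NatTrans.congr_app (M.δ_comp_σ_succ (i := i)) m) x

instance mono_σ {n : ℕ} (i : Fin (n + 1)) : Mono (M.σ i) := by
  have : Mono (M.σ i ≫ M.δ i.succ) := by
    rw [M.δ_comp_σ_succ]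
    infer_instance
  exact mono_of_mono _ (M.δ i.succ)

/-- The intersections that occur when degeneracies are attached one by one are of the same type in
one row lower, so induction on the row is possible. -/
lemma degeneracySup_inf_range (n k : ℕ) (hk : k < n + 2) :
    degeneracySup M (n + 1) k ⊓ Subcomplex.range (M.σ ⟨k, hk⟩) =
      (degeneracySup M n k).image (M.σ ⟨k, hk⟩) := by
  refine Subfunctor.ext (funext fun m => Set.ext fun x => ⟨?_, ?_⟩)
  · rintro ⟨h, b, rfl⟩
    obtain ⟨i, hi, a, ha⟩ := mem_degeneracySup.1 h
    -- If `σ_k b = σ_i a` with `i < k`, then `b = d_{k+1} σ_k b = d_{k+1} σ_i a = σ_i d_k a`.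
    refine ⟨b, mem_degeneracySup.2 ⟨⟨i, by omega⟩, hi, (M.δ ⟨k, hk⟩).app m a, ?_⟩, rfl⟩
    have h₁ := M.δ_comp_σ_of_gt (i := ⟨k, hk⟩) (j := ⟨i, by omega⟩) hi
    have h₂ := ConcreteCategory.congr_hom (NatTrans.congr_app h₁ m) a
    have h₃ := σ_app_δ_succ_app M ⟨k, hk⟩ b
    exact h₂.symm.trans ((congrArg ((M.δ (Fin.succ ⟨k, hk⟩)).app m) ha).trans h₃)
  · rintro ⟨b, h, rfl⟩
    obtain ⟨i, hi, a, rfl⟩ := mem_degeneracySup.1 h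
    -- The identity is `σ_k σ_i = σ_i σ_{k-1}`; the truncated subtraction is harmless since `i < k`.
    refine ⟨mem_degeneracySup.2 ⟨i.castSucc, hi, (M.σ ⟨k - 1, by omega⟩).app m a, ?_⟩, _, rfl⟩
    have h₁ := M.σ_comp_σ (i := i) (j := ⟨k - 1, by omega⟩) (by rw [Fin.le_def]; simp; omega)
    have h₂ := ConcreteCategory.congr_hom (NatTrans.congr_app h₁ m) a
    have h₃ : Fin.succ ⟨k - 1, by omega⟩ = (⟨k, hk⟩ : Fin (n + 2)) := by
      ext
      simp
      omega
    rw [h₃] at h₂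
    exact h₂

variable {M} (Xs : ∀ n, (M.obj n).Subcomplex)

/-- The family `Xs` is stable under `σ i` and under its left inverse `d_{i+1}`, so `σ i` detects
membership in it. -/
lemma inf_image_σ (hXs : ∀ {m n} (f : m ⟶ n), Xs m ≤ (Xs n).preimage (M.map f))
    {n : ℕ} (i : Fin (n + 1)) (A : (M _⦋n⦌).Subcomplex) :
    Xs (op ⦋n + 1⦌) ⊓ A.image (M.σ i) = (Xs (op ⦋n⦌) ⊓ A).image (M.σ i) := by
  refine Subfunctor.ext (funext fun m => Set.ext fun x => ⟨?_, ?_⟩)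
  · rintro ⟨h, b, hb, rfl⟩
    refine ⟨b, ⟨?_, hb⟩, rfl⟩
    have h₁ := hXs (SimplexCategory.δ i.succ).op m h
    have h₂ := σ_app_δ_succ_app M i b
    exact (Set.mem_of_eq_of_mem h₂.symm h₁ :)
  · rintro ⟨b, ⟨h, hb⟩, rfl⟩
    exact ⟨hXs (SimplexCategory.σ i).op m h, b, hb, rfl⟩

/-- Double induction, on the row and on the number of degeneracies. Each further `σ_k` is attached
by `IsAnodyne.glue`: its range is a copy of a lower row, and the intersection is a copy of a stage
of the induction in that row. -/
lemma isAnodyne_degeneracySup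
    (hXs : ∀ {m n} (f : m ⟶ n), Xs m ≤ (Xs n).preimage (M.map f))
    (hX : ∀ n, Subcomplex.IsAnodyne (Xs n) ⊤) (n k : ℕ) :
    Subcomplex.IsAnodyne (Xs (op ⦋n + 1⦌) ⊓ degeneracySup M n k) (degeneracySup M n k) := by
  induction n generalizing k with
  | zero =>
    induction k with
    | zero =>
      rw [degeneracySup_zero, inf_bot_eq]
      exact .refl _
    | succ k ih =>
      rcases Nat.lt_or_ge k 1 with hk | hk
      · obtain rfl : k = 0 := by omega
        rw [degeneracySup_succ _ _ _ hk, degeneracySup_zero, bot_sup_eq, ← Subcomplex.image_top,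
          inf_image_σ Xs hXs, inf_top_eq]
        exact (hX _).image _
      · rwa [degeneracySup_of_le _ _ _ hk]
  | succ n ihn =>
    induction k with
    | zero =>
      rw [degeneracySup_zero, inf_bot_eq]
      exact .refl _
    | succ k ih =>
      rcases Nat.lt_or_ge k (n + 2) with hk | hk
      · rw [degeneracySup_succ _ _ _ hk]
        refine .glue ih ?_ ?_
        · rw [← Subcomplex.image_top, inf_image_σ Xs hXs, inf_top_eq]
          exact (hX _).image _
        · rw [degeneracySup_inf_range, inf_image_σ Xs hXs]
          exact (ihn k).image _
      · rwa [degeneracySup_of_le _ _ _ hk]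

variable (M) in
/-- The latching subcomplex of `M _⦋m⦌`. -/
def latching (m : ℕ) : (M _⦋m⦌).Subcomplex where
  obj n := (columnSSet M n).degenerate m
  map {n n'} g := by
    rintro _ ⟨k, hk, f, z, rfl⟩
    refine ⟨k, hk, f, (M _⦋k⦌).map g z, ?_⟩
    exact ConcreteCategory.congr_hom ((M.map f.op).naturality g) z

/-- Attaching the latching subcomplex to `Xs` is anodyne by the previous lemma, and so is `Xs` in
the entire row; cancellation leaves the relative latching map. -/
lemma isAnodyne_sup_latching
    (hXs : ∀ {m n} (f : m ⟶ n), Xs m ≤ (Xs n).preimage (M.map f))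
    (hX : ∀ n, Subcomplex.IsAnodyne (Xs n) ⊤) (m : ℕ) :
    Subcomplex.IsAnodyne (Xs (op ⦋m⦌) ⊔ latching M m) ⊤ := by
  cases m with
  | zero =>
    have : latching M 0 = ⊥ := by
      refine Subfunctor.ext (funext fun n => Set.ext fun x => ⟨?_, False.elim⟩)
      rintro ⟨k, hk, _⟩
      omega
    rw [this, sup_bot_eq]
    exact hX _
  | succ m =>
    have : latching M (m + 1) = degeneracySup M m (m + 1) := by
      refine Subfunctor.ext (funext fun n => Set.ext fun x => ?_)
      rw [mem_degeneracySup]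
      have h₁ := Set.ext_iff.1 ((columnSSet M n).degenerate_eq_iUnion_range_σ (n := m)) x
      refine h₁.trans ?_
      rw [Set.mem_iUnion]
      exact exists_congr fun i => ⟨fun ⟨y, hy⟩ => ⟨i.2, y, hy⟩, fun ⟨_, y, hy⟩ => ⟨y, hy⟩⟩
    rw [this]
    exact .cancel (.sup (isAnodyne_degeneracySup Xs hXs hX m (m + 1))) (hX _) le_top

/-- The filtration of the diagonal of `M`: simplices that lie in the subcomplexes `Xs` or come
from the first `m` rows. -/
def diagonalFiltration
    (hXs : ∀ {m n} (f : m ⟶ n), Xs m ≤ (Xs n).preimage (M.map f)) (m : ℕ) :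
    (diagonal.obj M).Subcomplex where
  obj n := {x | x ∈ (Xs n).obj n ∨ ∃ k, k < m ∧ ∃ (f : n.unop ⟶ ⦋k⦌) (y : (M _⦋k⦌).obj n),
    (M.map f.op).app n y = x}
  map {n n'} g := by
    rintro x (h | ⟨k, hk, f, y, rfl⟩)
    · exact Or.inl (hXs g _ ((Xs n).map g h))
    · refine Or.inr ⟨k, hk, g.unop ≫ f, (M _⦋k⦌).map g y, ?_⟩
      have h₁ := ConcreteCategory.congr_hom ((M.map f.op).naturality g) y
      have h₂ := ConcreteCategory.congr_hom
        (NatTrans.congr_app (M.map_comp f.op g) n') ((M _⦋k⦌).map g y)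
      exact h₂.trans (congrArg ((M.map g).app n') h₁)

variable (M) in
/-- The map `M _⦋m⦌ ⊗ Δ[m] ⟶ diagonal.obj M` that sends `(y, θ)` to `θ^* y`. -/
def diagonalCell (m : ℕ) : (M _⦋m⦌) ⊗ Δ[m] ⟶ diagonal.obj M where
  app n := ↾fun z => (M.map (stdSimplex.objEquiv z.2).op).app n z.1
  naturality n n' g := by
    ext ⟨y, θ⟩
    obtain ⟨θ, rfl⟩ := stdSimplex.objEquiv.symm.surjective θ
    have h₁ := ConcreteCategory.congr_hom ((M.map θ.op).naturality g) y
    have h₂ := ConcreteCategory.congr_hom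
      (NatTrans.congr_app (M.map_comp θ.op g) n') ((M _⦋m⦌).map g y)
    exact h₂.trans (congrArg ((M.map g).app n') h₁)

lemma diagonalCell_app {m : ℕ} {n : SimplexCategoryᵒᵖ} (y : (M _⦋m⦌).obj n) (θ : n.unop ⟶ ⦋m⦌) :
    (diagonalCell M m).app n (y, stdSimplex.objEquiv.symm θ) = (M.map θ.op).app n y := rfl

variable (hXs : ∀ {m n} (f : m ⟶ n), Xs m ≤ (Xs n).preimage (M.map f))

lemma diagonalFiltration_succ (m : ℕ) :
    diagonalFiltration Xs hXs (m + 1) =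
      diagonalFiltration Xs hXs m ⊔ Subcomplex.range (diagonalCell M m) := by
  refine Subfunctor.ext (funext fun n => Set.ext fun x => ⟨?_, ?_⟩)
  · rintro (h | ⟨k, hk, f, y, rfl⟩)
    · exact Or.inl (Or.inl h)
    · rcases Nat.lt_succ_iff_lt_or_eq.1 hk with hk | rfl
      · exact Or.inl (Or.inr ⟨k, hk, f, y, rfl⟩)
      · exact Or.inr ⟨(y, stdSimplex.objEquiv.symm f), rfl⟩
  · rintro ((h | ⟨k, hk, f, y, rfl⟩) | ⟨⟨y, f⟩, rfl⟩)
    · exact Or.inl h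
    · exact Or.inr ⟨k, by omega, f, y, rfl⟩
    · exact Or.inr ⟨m, by omega, stdSimplex.objEquiv f, y, rfl⟩

/-- A map that is not surjective factors through a coface, so the simplex already comes from the
preceding row. -/
lemma mem_diagonalFiltration_of_not_epi {m : ℕ} {n : SimplexCategoryᵒᵖ} (y : (M _⦋m⦌).obj n)
    (θ : n.unop ⟶ ⦋m⦌) (hθ : ¬ Function.Surjective θ.toOrderHom) :
    (M.map θ.op).app n y ∈ (diagonalFiltration Xs hXs m).obj n := by
  cases m with
  | zero =>
    refine (hθ fun j => ⟨0, ?_⟩).elim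
    exact Subsingleton.elim (α := Fin 1) _ _
  | succ m =>
    obtain ⟨i, θ', rfl⟩ := SimplexCategory.eq_comp_δ_of_not_surjective θ hθ
    refine Or.inr ⟨m, by omega, θ', (M.δ i).app n y, ?_⟩
    exact (ConcreteCategory.congr_hom
      (NatTrans.congr_app (M.map_comp (SimplexCategory.δ i).op θ'.op) n) y).symm

lemma mem_diagonalFiltration_of_mem_degenerate {m : ℕ} {n : SimplexCategoryᵒᵖ}
    (y : (M _⦋m⦌).obj n) (θ : n.unop ⟶ ⦋m⦌) (hy : y ∈ (columnSSet M n).degenerate m) :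
    (M.map θ.op).app n y ∈ (diagonalFiltration Xs hXs m).obj n := by
  obtain ⟨k, hk, f, z, rfl⟩ := hy
  exact Or.inr ⟨k, hk, θ ≫ f, z,
    ConcreteCategory.congr_hom (NatTrans.congr_app (M.map_comp f.op θ.op) n) z⟩

/-- This identifies the attaching data: the `m`-th step glues on `M _⦋m⦌ × Δ[m]` along the
pushout-product of the relative latching inclusion with `∂Δ[m] ⊂ Δ[m]`. -/
lemma preimage_diagonalCell (m : ℕ) :
    (diagonalFiltration Xs hXs m).preimage (diagonalCell M m) =
      (Xs (op ⦋m⦌) ⊔ latching M m).unionProd (boundary m) := by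
  refine Subfunctor.ext (funext fun n => Set.ext fun ⟨y, θ⟩ => ?_)
  obtain ⟨θ, rfl⟩ := stdSimplex.objEquiv.symm.surjective θ
  have key : ((y, stdSimplex.objEquiv.symm θ) : ((M _⦋m⦌) ⊗ Δ[m] : SSet.{u}).obj n) ∈
      ((Xs (op ⦋m⦌) ⊔ latching M m).unionProd (boundary m)).obj n ↔
      ¬ Function.Surjective θ.toOrderHom ∨ (y ∈ (Xs (op ⦋m⦌)).obj n ∨
        y ∈ (columnSSet M n).degenerate m) := by
    exact Subcomplex.mem_unionProd_iff _ _ _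
  refine Iff.trans ?_ key.symm
  constructor
  · intro h
    by_cases hθ : Function.Surjective θ.toOrderHom
    · right
      have : Epi θ := SimplexCategory.epi_iff_surjective.2 hθ
      -- A surjective `θ` has a section, and pulling back along it recovers `y` from `θ^* y`. Hence
      -- what is known of `θ^* y` descends to `y`.
      have := isSplitEpi_of_epi θ
      have hs : ∀ w : (M _⦋m⦌).obj n,
          (M.map (section_ θ).op).app n ((M.map θ.op).app n w) = w := fun w => by
        have h₁ : M.map θ.op ≫ M.map (section_ θ).op = 𝟙 _ := by
          rw [← M.map_comp, ← op_comp, IsSplitEpi.id]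
          exact M.map_id _
        exact ConcreteCategory.congr_hom (NatTrans.congr_app h₁ n) w
      rcases h with h | ⟨k, hk, f, z, h⟩
      · exact Or.inl (Set.mem_of_eq_of_mem (hs y).symm (hXs (section_ θ).op n h) :)
      · refine Or.inr ⟨k, hk, section_ θ ≫ f, z, ?_⟩
        have h₁ := ConcreteCategory.congr_hom
          (NatTrans.congr_app (M.map_comp f.op (section_ θ).op) n) z
        exact h₁.trans ((congrArg ((M.map (section_ θ).op).app n) h).trans (hs y))
    · exact Or.inl hθ
  · rintro (h | h | h)
    · exact mem_diagonalFiltration_of_not_epi Xs hXs y θ h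
    · exact Or.inl (hXs θ.op n h)
    · exact mem_diagonalFiltration_of_mem_degenerate Xs hXs y θ h

/-- Outside the filtration `θ` is surjective and `y` is nondegenerate in its column. The
Eilenberg–Zilber lemma says that a simplex determines such a presentation `θ^* y`. -/
lemma diagonalCell_injective (m : ℕ) (n : SimplexCategoryᵒᵖ) (x y : ((M _⦋m⦌) ⊗ Δ[m]).obj n)
    (hx : (diagonalCell M m).app n x ∉ (diagonalFiltration Xs hXs m).obj n)
    (hxy : (diagonalCell M m).app n x = (diagonalCell M m).app n y) : x = y := by
  obtain ⟨y₁, θ₁⟩ := x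
  obtain ⟨y₂, θ₂⟩ := y
  obtain ⟨θ₁, rfl⟩ := stdSimplex.objEquiv.symm.surjective θ₁
  obtain ⟨θ₂, rfl⟩ := stdSimplex.objEquiv.symm.surjective θ₂
  have hy := hx
  rw [hxy] at hy
  rw [diagonalCell_app] at hx hy hxy
  have : Epi θ₁ := SimplexCategory.epi_iff_surjective.2
    (by_contra fun h => hx (mem_diagonalFiltration_of_not_epi Xs hXs y₁ θ₁ h))
  have h₁ : y₁ ∈ (columnSSet M n).nonDegenerate m :=
    fun h => hx (mem_diagonalFiltration_of_mem_degenerate Xs hXs y₁ θ₁ h)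
  have h₂ : y₂ ∈ (columnSSet M n).nonDegenerate m :=
    fun h => hy (mem_diagonalFiltration_of_mem_degenerate Xs hXs y₂ θ₂ h)
  have e₁ := (columnSSet M n).unique_nonDegenerate_simplex (n := n.unop.len) _ θ₁ ⟨y₁, h₁⟩ rfl
    θ₂ ⟨y₂, h₂⟩ hxy
  have e₂ := (columnSSet M n).unique_nonDegenerate_map (n := n.unop.len) _ θ₁ ⟨y₁, h₁⟩ rfl
    θ₂ ⟨y₂, h₂⟩ hxy
  subst e₂
  exact Prod.ext (congrArg Subtype.val e₁) rfl

lemma isAnodyne_diagonalFiltration_succ (hX : ∀ n, Subcomplex.IsAnodyne (Xs n) ⊤) (m : ℕ) :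
    Subcomplex.IsAnodyne (diagonalFiltration Xs hXs m) (diagonalFiltration Xs hXs (m + 1)) := by
  rw [diagonalFiltration_succ]
  refine .attach _ _ (diagonalCell_injective Xs hXs m) ?_
  rw [preimage_diagonalCell]
  exact anodyneExtensions_unionProd_ι' _ _ ((Subcomplex.isAnodyne_top_iff _).1
    (isAnodyne_sup_latching Xs hXs hX m))

lemma diagonalFiltration_monotone : Monotone (diagonalFiltration Xs hXs) := by
  intro m m' h n x
  rintro (hx | ⟨k, hk, f, y, rfl⟩)
  · exact Or.inl hx
  · exact Or.inr ⟨k, by omega, f, y, rfl⟩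

lemma iSup_diagonalFiltration : ⨆ m, diagonalFiltration Xs hXs m = ⊤ := by
  refine Subfunctor.ext (funext fun n => Set.eq_univ_of_forall fun x => ?_)
  simp only [Subfunctor.iSup_obj, Set.mem_iUnion]
  -- An `n`-simplex of the diagonal lies in row `n` itself. Stage `m` contains only rows below `m`,
  -- hence the shift by one.
  refine ⟨n.unop.len + 1, Or.inr ⟨n.unop.len, by omega, 𝟙 _, x, ?_⟩⟩
  exact ConcreteCategory.congr_hom (NatTrans.congr_app (M.map_id n) n) x

lemma anodyneExtensions_diagonalFiltration_zero (hX : ∀ n, Subcomplex.IsAnodyne (Xs n) ⊤) :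
    anodyneExtensions (diagonalFiltration Xs hXs 0).ι := by
  -- Anodyne maps are closed under countable composition, and the stages exhaust the diagonal.
  let t : anodyneExtensions.{u}.TransfiniteCompositionOfShape ℕ
      (diagonalFiltration Xs hXs 0).ι :=
    { F := (diagonalFiltration_monotone Xs hXs).functor ⋙ Subcomplex.toSSetFunctor
      isoBot := Iso.refl _
      incl := { app := fun _ => Subcomplex.ι _ }
      isColimit := Limits.IsColimit.ofIsoColimit
        (Limits.isColimitOfPreserves Subcomplex.toSSetFunctor
          (Limits.CompleteLattice.colimitCocone
            (diagonalFiltration_monotone Xs hXs).functor).isColimit)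
        (Limits.Cocone.ext (Subcomplex.eqToIso (iSup_diagonalFiltration Xs hXs) ≪≫
          Subcomplex.topIso _))
      map_mem := fun m _ => (isAnodyne_diagonalFiltration_succ Xs hXs hX m).2 }
  exact anodyneExtensions.transfiniteCompositionsOfShape_le ℕ _ t.mem

end Diagonal

/-- A map of bisimplicial sets that is anodyne in each row has an anodyne diagonal. -/
lemma anodyneExtensions_diagonal_map {X M : SimplicialObject SSet.{u}} (j : X ⟶ M)
    [∀ n, Mono (j.app n)] (hj : ∀ n, anodyneExtensions (j.app n)) :
    anodyneExtensions (diagonal.map j) := by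
  let Xs : ∀ n, (M.obj n).Subcomplex := fun n => Subcomplex.range (j.app n)
  have hXs : ∀ {m n} (f : m ⟶ n), Xs m ≤ (Xs n).preimage (M.map f) := by
    rintro m n f k _ ⟨x, rfl⟩
    exact ⟨(X.map f).app k x,
      ConcreteCategory.congr_hom (NatTrans.congr_app (j.naturality f) k) x⟩
  have hX : ∀ n, Subcomplex.IsAnodyne (Xs n) ⊤ := fun n => by
    rw [Subcomplex.isAnodyne_top_iff, ← MorphismProperty.cancel_left_of_respectsIso
      anodyneExtensions (Subcomplex.toRange (j.app n))]
    exact hj n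
  have h := anodyneExtensions_diagonalFiltration_zero Xs hXs hX
  have hm : Mono (diagonal.map j) := by
    rw [NatTrans.mono_iff_mono_app]
    intro n
    exact inferInstanceAs (Mono ((j.app n).app n))
  have e : diagonalFiltration Xs hXs 0 = Subcomplex.range (diagonal.map j) := by
    refine Subfunctor.ext (funext fun n => Set.ext fun x => ⟨?_, Or.inl⟩)
    rintro (h | ⟨k, hk, _⟩)
    · exact h
    · omega
  rw [e] at h
  rw [← Subcomplex.toRange_ι (diagonal.map j),
    MorphismProperty.cancel_left_of_respectsIso anodyneExtensions]
  exact h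

end SSet

/-! ### Topological simplices, horns and the homotopy lifting property -/

/-- Faces of a simplex are retracts of it by order-preserving vertex maps, so a map on a face of a
horn extends to the full simplex as a degenerate one. -/
lemma exists_monotone_retraction {α : Type*} [LinearOrder α] (S : Finset α) (hS : S.Nonempty) :
    ∃ e : α →o α, (∀ l ∈ S, e l = l) ∧ ∀ l, e l ∈ S := by
  -- The value at `l` is the largest element of `S` that is at most `l`, or the least element of `S`
  -- if there is none.
  refine ⟨⟨fun l => S.sup' hS fun s => if s ≤ l then s else S.min' hS, fun l l' h => ?_⟩,
    fun l hl => ?_, fun l => ?_⟩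
  · refine Finset.sup'_mono_fun fun s hs => ?_
    by_cases h₁ : s ≤ l
    · simp [h₁, h₁.trans h]
    · by_cases h₂ : s ≤ l'
      · simpa [h₁, h₂] using S.min'_le s hs
      · simp [h₁, h₂]
  · refine le_antisymm (Finset.sup'_le hS _ fun s hs => ?_) ?_
    · by_cases h₁ : s ≤ l
      · simp [h₁]
      · simpa [h₁] using S.min'_le l hl
    · exact (by simp : l ≤ if l ≤ l then l else S.min' hS).trans
        (Finset.le_sup' (fun s => if s ≤ l then s else S.min' hS) hl)
  · obtain ⟨s, hs, h⟩ := Finset.exists_mem_eq_sup' hS fun s => if s ≤ l then s else S.min' hS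
    change S.sup' hS (fun s => if s ≤ l then s else S.min' hS) ∈ S
    rw [h]
    split_ifs
    · exact hs
    · exact S.min'_mem hS

namespace stdSimplex

variable {n : ℕ} (i : Fin (n + 2))

lemma map_eq_self {ι : Type*} [Fintype ι] (e : ι → ι) (x : stdSimplex ℝ ι)
    (h : ∀ l, x l ≠ 0 → e l = l) : map e x = x := by
  classical
  ext l
  rw [map_coe, FunOnFinite.linearMap_apply_apply]
  have : ∀ k ∈ Finset.univ.filter (fun k => e k = l), k ≠ l → x k = 0 := fun k hk hkl => by
    by_contra h'
    exact hkl ((h k h').symm.trans (Finset.mem_filter.1 hk).2)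
  by_cases hl : e l = l
  · rw [Finset.sum_eq_single_of_mem l (by simp [hl]) this]
  · have h₀ : x l = 0 := by_contra fun h' => hl (h l h')
    rw [h₀]
    refine Finset.sum_eq_zero fun k hk => this k hk ?_
    rintro rfl
    exact hl (Finset.mem_filter.1 hk).2

lemma map_apply_eq_zero {ι κ : Type*} [Fintype ι] [Fintype κ] (f : ι → κ) (x : stdSimplex ℝ ι)
    (j : κ) (hj : ∀ l, f l ≠ j) : map f x j = 0 := by
  classical
  rw [map_coe, FunOnFinite.linearMap_apply_apply]
  exact Finset.sum_eq_zero fun k hk => (hj k (Finset.mem_filter.1 hk).2).elim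

lemma erase_nonempty : (Finset.univ.erase i).Nonempty :=
  ⟨i + 1, by simp⟩

/-- The least of the barycentric coordinates other than the `i`-th one. -/
noncomputable def minCoord (x : stdSimplex ℝ (Fin (n + 2))) : ℝ :=
  (Finset.univ.erase i).inf' (erase_nonempty i) fun j => x j

lemma continuous_minCoord : Continuous (minCoord i) :=
  Continuous.finset_inf'_apply _ fun j _ => (continuous_apply j).comp continuous_subtype_val

lemma minCoord_le (x : stdSimplex ℝ (Fin (n + 2))) (j : Fin (n + 2)) (hj : j ≠ i) :
    minCoord i x ≤ x j :=
  Finset.inf'_le _ (by simp [hj])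

lemma exists_minCoord_eq (x : stdSimplex ℝ (Fin (n + 2))) :
    ∃ j, j ≠ i ∧ minCoord i x = x j := by
  obtain ⟨j, hj, h⟩ := Finset.exists_mem_eq_inf' (erase_nonempty i) fun j => x j
  exact ⟨j, (Finset.mem_erase.1 hj).1, h⟩

lemma minCoord_nonneg (x : stdSimplex ℝ (Fin (n + 2))) : 0 ≤ minCoord i x := by
  obtain ⟨j, -, h⟩ := exists_minCoord_eq i x
  rw [h]
  exact zero_le x j

lemma minCoord_le_one (x : stdSimplex ℝ (Fin (n + 2))) : minCoord i x ≤ 1 := by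
  obtain ⟨j, -, h⟩ := exists_minCoord_eq i x
  rw [h]
  exact le_one x j

lemma minCoord_eq_zero (x : stdSimplex ℝ (Fin (n + 2))) (j : Fin (n + 2)) (hj : j ≠ i)
    (h : x j = 0) : minCoord i x = 0 :=
  le_antisymm ((minCoord_le i x j hj).trans h.le) (minCoord_nonneg i x)

/-- Move a point of the simplex towards the `i`-th vertex, until a face that contains this vertex
is reached. -/
noncomputable def slide (x : stdSimplex ℝ (Fin (n + 2))) (c : ℝ) : stdSimplex ℝ (Fin (n + 2)) :=
  -- There are `n + 1` coordinates other than the `i`-th, so the sum stays `1`. Clamping the step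
  -- between `0` and `minCoord` keeps every coordinate nonnegative.
  ⟨fun j => x j + max 0 (min c (minCoord i x)) * if j = i then (n + 1 : ℝ) else -1, by
    have h₀ : 0 ≤ max 0 (min c (minCoord i x)) := le_max_left _ _
    constructor
    · intro j
      dsimp only
      split_ifs with h
      · exact add_nonneg (zero_le x j) (mul_nonneg h₀ (by positivity))
      · have : max 0 (min c (minCoord i x)) ≤ x j :=
          max_le (zero_le x j) ((min_le_right _ _).trans (minCoord_le i x j h))
        linarith
    · have : ∑ j : Fin (n + 2), (if j = i then (n + 1 : ℝ) else -1) = 0 := by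
        rw [Finset.sum_ite, Finset.filter_eq' Finset.univ i, Finset.filter_ne' Finset.univ i]
        simp
      rw [Finset.sum_add_distrib, ← Finset.mul_sum, this, mul_zero, add_zero]
      exact x.2.2⟩

lemma slide_apply (x : stdSimplex ℝ (Fin (n + 2))) (c : ℝ) (j : Fin (n + 2)) :
    slide i x c j = x j + max 0 (min c (minCoord i x)) * if j = i then (n + 1 : ℝ) else -1 := rfl

lemma continuous_slide :
    Continuous fun z : stdSimplex ℝ (Fin (n + 2)) × ℝ => slide i z.1 z.2 := by
  refine Continuous.subtype_mk (continuous_pi fun j => ?_) _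
  have h₁ := (continuous_minCoord i).comp
    (continuous_fst : Continuous fun z : stdSimplex ℝ (Fin (n + 2)) × ℝ => z.1)
  have h₂ : Continuous fun z : stdSimplex ℝ (Fin (n + 2)) × ℝ => z.1 j :=
    (continuous_apply j).comp (continuous_subtype_val.comp continuous_fst)
  exact h₂.add ((continuous_const.max (continuous_snd.min h₁)).mul continuous_const)

lemma slide_of_nonpos (x : stdSimplex ℝ (Fin (n + 2))) (c : ℝ) (hc : c ≤ 0) :
    slide i x c = x := by
  ext j
  rw [slide_apply, max_eq_left ((min_le_left _ _).trans hc), zero_mul, add_zero]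

lemma slide_of_minCoord_eq_zero (x : stdSimplex ℝ (Fin (n + 2))) (c : ℝ)
    (hx : minCoord i x = 0) : slide i x c = x := by
  ext j
  rw [slide_apply, max_eq_left ((min_le_right _ _).trans hx.le), zero_mul, add_zero]

lemma exists_slide_minCoord_eq_zero (x : stdSimplex ℝ (Fin (n + 2))) :
    ∃ j, j ≠ i ∧ slide i x (minCoord i x) j = 0 := by
  obtain ⟨j, hj, h⟩ := exists_minCoord_eq i x
  refine ⟨j, hj, ?_⟩
  rw [slide_apply, min_self, max_eq_right (minCoord_nonneg i x), if_neg hj, h]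
  ring

end stdSimplex

/-- A continuous map has the homotopy lifting property (with respect to all spaces). -/
def HasHomotopyLifting {P B : Type*} [TopologicalSpace P] [TopologicalSpace B] (q : C(P, B)) :
    Prop :=
  ∀ (W : Type) [TopologicalSpace W] (H : C(W × unitInterval, B)) (f : C(W, P)),
    (∀ w, H (w, 0) = q (f w)) →
      ∃ F : C(W × unitInterval, P), (∀ w, F (w, 0) = f w) ∧ ∀ z, q (F z) = H z

open stdSimplex in
/-- Extension of a map from a horn to a simplex along a map with the homotopy lifting property. -/
lemma HasHomotopyLifting.exists_lift_horn {P B : Type*} [TopologicalSpace P] [TopologicalSpace B]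
    {q : C(P, B)} (hq : HasHomotopyLifting q) {n : ℕ} (i : Fin (n + 2))
    (g : {j // j ≠ i} → C(stdSimplex ℝ (Fin (n + 2)), P)) (b : C(stdSimplex ℝ (Fin (n + 2)), B))
    (hg : ∀ j k x, x j.1 = 0 → x k.1 = 0 → g j x = g k x)
    (hb : ∀ j x, x j.1 = 0 → q (g j x) = b x) :
    ∃ φ : C(stdSimplex ℝ (Fin (n + 2)), P), (∀ j x, x j.1 = 0 → φ x = g j x) ∧
      ∀ x, q (φ x) = b x := by
  let D := stdSimplex ℝ (Fin (n + 2))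
  choose J hJ₁ hJ₂ using exists_slide_minCoord_eq_zero i
  -- This retracts the simplex onto the horn: some coordinate other than the `i`-th becomes `0`, and
  -- points with such a coordinate stay fixed.
  let r : D → D := fun x => slide i x (minCoord i x)
  have hr : Continuous r :=
    (continuous_slide i).comp (continuous_id.prodMk (continuous_minCoord i))
  let f₀ : D → P := fun x => g ⟨J x, hJ₁ x⟩ (r x)
  have hf₀ : ∀ x j, r x j.1 = 0 → f₀ x = g j (r x) := fun x j h => hg _ _ _ (hJ₂ x) h
  have hc : Continuous f₀ := by
    -- The choice `J` of a face is not continuous, but `f₀` does not depend on it and is continuous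
    -- on each member of a finite closed cover.
    refine (locallyFinite_of_finite fun j : {j // j ≠ i} => {x : D | r x j = 0}).continuous
      ?_ ?_ ?_
    · exact Set.eq_univ_of_forall fun x => Set.mem_iUnion.2 ⟨⟨J x, hJ₁ x⟩, hJ₂ x⟩
    · exact fun j => isClosed_eq ((continuous_apply j.1).comp (continuous_subtype_val.comp hr))
        continuous_const
    · exact fun j => (((g j).continuous.comp hr).continuousOn).congr fun x hx => hf₀ x j hx
  -- The homotopy undoes the retraction at unit speed: it starts at `r x` and has reached `x` at
  -- time `minCoord i x`.
  let Hh : C(D × unitInterval, B) := ⟨fun z => b (slide i z.1 (minCoord i z.1 - z.2)), by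
    refine b.continuous.comp ((continuous_slide i).comp (continuous_fst.prodMk ?_))
    exact ((continuous_minCoord i).comp continuous_fst).sub
      (continuous_subtype_val.comp continuous_snd)⟩
  obtain ⟨F, hF₁, hF₂⟩ := hq D Hh ⟨f₀, hc⟩ fun x => by
    refine Eq.trans ?_ (hb ⟨J x, hJ₁ x⟩ _ (hJ₂ x)).symm
    change b (slide i x (minCoord i x - 0)) = _
    rw [sub_zero]
  -- Stopping the lift at time `minCoord i x` makes it cover `b x`. On the horn that time is `0`, so
  -- the given maps are kept there although the lifting property is not relative.
  refine ⟨⟨fun x => F (x, ⟨minCoord i x, minCoord_nonneg i x, minCoord_le_one i x⟩), ?_⟩, ?_, ?_⟩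
  · exact F.continuous.comp (continuous_id.prodMk
      (Continuous.subtype_mk (continuous_minCoord i) _))
  · intro j x h
    have h₀ := minCoord_eq_zero i x j.1 j.2 h
    have h₁ : (⟨minCoord i x, minCoord_nonneg i x, minCoord_le_one i x⟩ : unitInterval) = 0 :=
      Subtype.ext h₀
    have h₂ : r x = x := slide_of_minCoord_eq_zero i x _ h₀
    change F (x, _) = _
    rw [h₁, hF₁]
    refine (hf₀ x j (by rw [h₂]; exact h)).trans ?_
    rw [h₂]
  · intro x
    refine (hF₂ _).trans ?_
    change b (slide i x (minCoord i x - minCoord i x)) = b x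
    rw [slide_of_nonpos i x _ (by simp)]

lemma hasHomotopyLifting_const {P : Type*} [TopologicalSpace P] :
    HasHomotopyLifting (ContinuousMap.const P PUnit.unit) :=
  fun _ _ _ f _ => ⟨f.comp ⟨Prod.fst, continuous_fst⟩, fun _ => rfl, fun _ => rfl⟩

/-- The evaluation of paths at both ends. -/
def pathEnds (T : Type*) [TopologicalSpace T] : C(C(unitInterval, T), T × T) :=
  ⟨fun γ => (γ 0, γ 1),
    (ContinuousEvalConst.continuous_eval_const 0).prodMk
      (ContinuousEvalConst.continuous_eval_const 1)⟩

lemma hasHomotopyLifting_pathEnds (T : Type*) [TopologicalSpace T] :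
    HasHomotopyLifting (pathEnds T) := by
  intro W _ H f hf
  let pr : ℝ → unitInterval := Set.projIcc 0 1 zero_le_one
  have hpr : Continuous pr := continuous_projIcc
  have hpr' : ∀ t : unitInterval, pr t = t := fun t => Set.projIcc_val zero_le_one t
  have hfc : Continuous fun z : W × unitInterval => f z.1 z.2 :=
    (ContinuousMap.uncurry f).continuous
  -- At time `s` the path `f w` is squeezed into `[s/3, 1 - s/3]`; the two outer pieces run along
  -- the traces of the end points under `H`. As `s ≤ 1` these pieces do not overlap, and the
  -- denominator `3 - 2s` is positive.
  let k : (W × unitInterval) × unitInterval → T := fun z =>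
    if 3 * (z.2 : ℝ) ≤ z.1.2 then (H (z.1.1, pr (z.1.2 - 3 * z.2))).1
    else if 3 * (1 - (z.2 : ℝ)) ≤ z.1.2 then (H (z.1.1, pr (z.1.2 - 3 * (1 - z.2)))).2
    else f z.1.1 (pr ((3 * z.2 - z.1.2) / (3 - 2 * z.1.2)))
  have hs : ∀ z : (W × unitInterval) × unitInterval, (z.1.2 : ℝ) ≤ 1 := fun z => z.1.2.2.2
  have c₁ : Continuous fun z : (W × unitInterval) × unitInterval => (z.2 : ℝ) :=
    continuous_subtype_val.comp continuous_snd
  have c₂ : Continuous fun z : (W × unitInterval) × unitInterval => (z.1.2 : ℝ) :=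
    continuous_subtype_val.comp (continuous_snd.comp continuous_fst)
  have c₃ : Continuous fun z : (W × unitInterval) × unitInterval => z.1.1 :=
    continuous_fst.comp continuous_fst
  have hk : Continuous k := by
    refine Continuous.if_le ?_ (Continuous.if_le ?_ ?_ ?_ ?_ ?_) ?_ ?_ ?_
    · exact continuous_fst.comp (H.continuous.comp
        (c₃.prodMk (hpr.comp (c₂.sub (continuous_const.mul c₁)))))
    · exact continuous_snd.comp (H.continuous.comp
        (c₃.prodMk (hpr.comp (c₂.sub (continuous_const.mul (continuous_const.sub c₁))))))
    · refine hfc.comp (c₃.prodMk (hpr.comp ?_))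
      refine ((continuous_const.mul c₁).sub c₂).div
        (continuous_const.sub (continuous_const.mul c₂)) fun z => ?_
      have := hs z
      linarith
    · exact continuous_const.mul (continuous_const.sub c₁)
    · exact c₂
    · intro z hz
      have h₁ : (3 * (z.2 : ℝ) - z.1.2) / (3 - 2 * z.1.2) = 1 := by
        have := hs z
        rw [div_eq_one_iff_eq (by linarith)]
        linarith
      have h₂ := congrArg Prod.snd (hf z.1.1)
      rw [h₁, hz, sub_self]
      have e₀ : pr 0 = 0 := hpr' 0
      have e₁ : pr 1 = 1 := hpr' 1
      rw [e₀, e₁]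
      exact h₂
    · exact continuous_const.mul c₁
    · exact c₂
    · intro z hz
      have h₂ := congrArg Prod.fst (hf z.1.1)
      have e₀ : pr 0 = 0 := hpr' 0
      have := hs z
      rw [if_neg (by linarith), hz, sub_self, zero_div, e₀]
      exact h₂
  refine ⟨ContinuousMap.curry ⟨k, hk⟩, fun w => ContinuousMap.ext fun t => ?_, fun z => ?_⟩
  · change k ((w, 0), t) = f w t
    have ht₀ := t.2.1
    have ht₁ := t.2.2
    have h₀ : ((0 : unitInterval) : ℝ) = 0 := rfl
    have e₀ : pr 0 = 0 := hpr' 0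
    simp only [k, h₀]
    split_ifs with h₁ h₂
    · have h₃ : (t : ℝ) = 0 := by linarith
      have h₄ : t = 0 := Subtype.ext h₃
      rw [h₃, mul_zero, sub_zero, e₀, h₄]
      exact congrArg Prod.fst (hf w)
    · have h₃ : (t : ℝ) = 1 := by linarith
      have h₄ : t = 1 := Subtype.ext h₃
      rw [h₃, sub_self, mul_zero, sub_zero, e₀, h₄]
      exact congrArg Prod.snd (hf w)
    · have h₃ : (3 * (t : ℝ) - 0) / (3 - 2 * 0) = t := by ring
      rw [h₃, hpr']
  · have hz₀ := z.2.2.1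
    have hz₁ := z.2.2.2
    have h₀ : ((0 : unitInterval) : ℝ) = 0 := rfl
    have h₁ : ((1 : unitInterval) : ℝ) = 1 := rfl
    refine Prod.ext ?_ ?_
    · change k (z, 0) = (H z).1
      simp only [k, h₀]
      rw [if_pos (by linarith), mul_zero, sub_zero, hpr']
    · change k (z, 1) = (H z).2
      simp only [k, h₁]
      rw [if_neg (by linarith), if_pos (by linarith), sub_self, mul_zero, sub_zero, hpr']

/-! ### Realizations of anodyne extensions -/

namespace SSet

open Simplicial HomotopicalAlgebra modelCategoryQuillen CartesianMonoidalCategory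

lemma mem_horn_of_forall_ne {n m : ℕ} {i j : Fin (n + 1)} (hj : j ≠ i) (e : ⦋m⦌ ⟶ ⦋n⦌)
    (he : ∀ l, e.toOrderHom l ≠ j) :
    stdSimplex.objEquiv.symm e ∈ (horn.{u} n i).obj (op ⦋m⦌) := by
  rw [mem_horn_iff]
  intro h
  rcases Set.eq_univ_iff_forall.1 h j with ⟨k, hk⟩ | hk
  · exact he k hk
  · exact hj hk

/-- The singular simplicial set of a map with the homotopy lifting property is a fibration. -/
lemma fibrations_toSSet_map {P B : TopCat.{u}} (q : P ⟶ B) (hq : HasHomotopyLifting q.hom) :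
    fibrations SSet (TopCat.toSSet.map q) := by
  rw [fibrations_eq]
  intro _ _ _ hf
  simp only [J, MorphismProperty.iSup_iff] at hf
  obtain ⟨n, ⟨i⟩⟩ := hf
  refine ⟨fun {t b} sq => ?_⟩
  have hex : ∀ j : Fin (n + 2), ∃ e : Fin (n + 2) →o Fin (n + 2),
      (∀ l, l ≠ j → e l = l) ∧ ∀ l, e l ≠ j := fun j => by
    obtain ⟨e, h₁, h₂⟩ := exists_monotone_retraction (Finset.univ.erase j)
      (stdSimplex.erase_nonempty j)
    exact ⟨e, fun l hl => h₁ l (by simp [hl]), fun l => (Finset.mem_erase.1 (h₂ l)).1⟩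
  choose e he₁ he₂ using hex
  -- The map `t` on the horn, read as a compatible family of continuous maps on topological
  -- simplices, one for each simplex of the horn.
  let ev : ∀ {m : ℕ} (s : ⦋m⦌ ⟶ ⦋n + 1⦌) (_ : stdSimplex.objEquiv.symm s ∈
      (horn.{u} (n + 1) i).obj (op ⦋m⦌)), C(_root_.stdSimplex ℝ (Fin (m + 1)), P) :=
    fun {m} s hs => P.toSSetObjEquiv (op ⦋m⦌) (t.app (op ⦋m⦌) ⟨_, hs⟩)
  have ev_comp : ∀ {m k : ℕ} (s : ⦋m⦌ ⟶ ⦋n + 1⦌) (hs) (f : ⦋k⦌ ⟶ ⦋m⦌) (hs')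
      (x : _root_.stdSimplex ℝ (Fin (k + 1))),
      ev (f ≫ s) hs' x = ev s hs (stdSimplex.map f.toOrderHom x) := by
    intro m k s hs f hs' x
    have h₁ := ConcreteCategory.congr_hom (t.naturality f.op) ⟨_, hs⟩
    exact DFunLike.congr_fun (congrArg (P.toSSetObjEquiv (op ⦋k⦌)) h₁) x
  -- The `j`-th face of the horn enters through this degenerate simplex, so that its map is defined
  -- on the full topological simplex as `exists_lift_horn` requires; it is right on the points with
  -- `x j = 0`.
  let eh : ∀ j, ⦋n + 1⦌ ⟶ ⦋n + 1⦌ := fun j => SimplexCategory.Hom.mk (e j)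
  have heh : ∀ j, j ≠ i → stdSimplex.objEquiv.symm (eh j) ∈
      (horn.{u} (n + 1) i).obj (op ⦋n + 1⦌) := fun j hj => mem_horn_of_forall_ne hj _ (he₂ j)
  let β : C(_root_.stdSimplex ℝ (Fin (n + 2)), B) :=
    B.toSSetObjEquiv (op ⦋n + 1⦌) (yonedaEquiv b)
  have ev_fix : ∀ {m : ℕ} (s : ⦋m⦌ ⟶ ⦋n + 1⦌) (hs) (j) (hj : j ≠ i)
      (_ : ∀ l, s.toOrderHom l ≠ j) (x : _root_.stdSimplex ℝ (Fin (m + 1))),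
      ev (eh j) (heh j hj) (stdSimplex.map s.toOrderHom x) = ev s hs x := by
    intro m s hs j hj h x
    have h₁ : s ≫ eh j = s := by
      ext l : 3
      exact he₁ j _ (h l)
    have h₂ : stdSimplex.objEquiv.symm (s ≫ eh j) ∈ (horn.{u} (n + 1) i).obj (op ⦋m⦌) := by
      rw [h₁]
      exact hs
    rw [← ev_comp _ _ _ h₂]
    have h₃ : ∀ {s s' : ⦋m⦌ ⟶ ⦋n + 1⦌} (_ : s = s') (k k'), ev s k = ev s' k' := by
      rintro s _ rfl k k'
      rfl
    rw [h₃ h₁ h₂ hs]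
  have ev_base : ∀ {m : ℕ} (s : ⦋m⦌ ⟶ ⦋n + 1⦌) (hs) (x : _root_.stdSimplex ℝ (Fin (m + 1))),
      q.hom (ev s hs x) = β (stdSimplex.map s.toOrderHom x) := by
    intro m s hs x
    have h₁ := ConcreteCategory.congr_hom (NatTrans.congr_app sq.w (op ⦋m⦌)) ⟨_, hs⟩
    have h₂ := DFunLike.congr_fun (congrArg (B.toSSetObjEquiv (op ⦋m⦌)) h₁) x
    refine h₂.trans ?_
    have h₃ : b.app (op ⦋m⦌) (stdSimplex.objEquiv.symm s) =
        (TopCat.toSSet.obj B).map s.op (yonedaEquiv b) := by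
      rw [← yonedaEquiv_symm_app_objEquiv_symm, Equiv.symm_apply_apply]
    exact DFunLike.congr_fun (congrArg (B.toSSetObjEquiv (op ⦋m⦌)) h₃) x
  obtain ⟨φ, hφ₁, hφ₂⟩ := hq.exists_lift_horn i (fun j => ev (eh j.1) (heh j.1 j.2)) β
    (by
      rintro ⟨j, hj⟩ ⟨k, hk⟩ x hxj hxk
      -- On the common part of two faces both maps are computed by a simplex that avoids both
      -- vertices. The vertex `i` shows that some vertex remains.
      obtain ⟨d, hd₁, hd₂⟩ := exists_monotone_retraction ((Finset.univ.erase j).erase k)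
        ⟨i, by simp [hj.symm, hk.symm]⟩
      have hd₃ : ∀ l, d l ≠ k ∧ d l ≠ j := fun l => by simpa using hd₂ l
      have hx : stdSimplex.map d x = x := _root_.stdSimplex.map_eq_self _ x fun l hl => hd₁ l (by
        simp only [Finset.mem_erase, Finset.mem_univ, and_true]
        exact ⟨fun h => hl (h ▸ hxk), fun h => hl (h ▸ hxj)⟩)
      let dh : ⦋n + 1⦌ ⟶ ⦋n + 1⦌ := SimplexCategory.Hom.mk d
      have hdh := mem_horn_of_forall_ne.{u} hj dh fun l => (hd₃ l).2
      have h₁ := ev_fix dh hdh j hj (fun l => (hd₃ l).2) x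
      have h₂ := ev_fix dh hdh k hk (fun l => (hd₃ l).1) x
      change ev (eh j) (heh j hj) (stdSimplex.map d x) = _ at h₁
      change ev (eh k) (heh k hk) (stdSimplex.map d x) = _ at h₂
      rw [hx] at h₁ h₂
      exact h₁.trans h₂.symm)
    (by
      rintro ⟨j, hj⟩ x hx
      refine (ev_base _ _ x).trans (congrArg β ?_)
      refine _root_.stdSimplex.map_eq_self _ x fun l hl => he₁ j l ?_
      rintro rfl
      exact hl hx)
  refine ⟨⟨{ l := yonedaEquiv.symm ((P.toSSetObjEquiv (op ⦋n + 1⦌)).symm φ)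
             fac_left := ?_
             fac_right := ?_ }⟩⟩
  · ext ⟨⟨m⟩⟩ ⟨s, hs⟩
    obtain ⟨s, rfl⟩ := stdSimplex.objEquiv.symm.surjective s
    refine (P.toSSetObjEquiv (op ⦋m⦌)).injective (ContinuousMap.ext fun x => ?_)
    have h₁ : ∃ j, j ≠ i ∧ ∀ l, s.toOrderHom l ≠ j := by
      by_contra h
      push Not at h
      refine (mem_horn_iff _ _).1 hs (Set.eq_univ_of_forall fun j => ?_)
      by_cases hj : j = i
      · exact Or.inr hj
      · exact Or.inl (h j hj)
    obtain ⟨j, hj, hl⟩ := h₁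
    refine Eq.trans ?_ (ev_fix s hs j hj hl x)
    exact hφ₁ ⟨j, hj⟩ _ (_root_.stdSimplex.map_apply_eq_zero _ x j hl)
  · refine yonedaEquiv.injective ?_
    refine (B.toSSetObjEquiv (op ⦋n + 1⦌)).injective (ContinuousMap.ext fun x => ?_)
    refine Eq.trans ?_ (hφ₂ x)
    rw [yonedaEquiv_comp, Equiv.apply_symm_apply]
    rfl

-- By adjunction, the realization of `j` lifts against every map with the homotopy lifting property.
-- Two such maps suffice to make it the inclusion of a deformation retract.
open SymmetricSpectrum in
lemma weakEquiv_of_anodyneExtensions {D M : SSet.{u}} (j : D ⟶ M) (hj : anodyneExtensions j) :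
    WeakEquiv j := by
  have adj_sq : ∀ {P B : TopCat.{u}} (q : P ⟶ B) (_ : HasHomotopyLifting q.hom)
      (f : toTop.obj D ⟶ P) (g : toTop.obj M ⟶ B) (_ : f ≫ q = toTop.map j ≫ g),
      ∃ l : toTop.obj M ⟶ P, toTop.map j ≫ l = f ∧ l ≫ q = g := by
    intro P B q hq f g w
    have := hj _ (fibrations_toSSet_map q hq)
    have sq : CommSq (sSetTopAdj.homEquiv _ _ f) j (TopCat.toSSet.map q)
        (sSetTopAdj.homEquiv _ _ g) := ⟨by
      rw [← Adjunction.homEquiv_naturality_right, ← Adjunction.homEquiv_naturality_left, w]⟩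
    refine ⟨(sSetTopAdj.homEquiv _ _).symm sq.lift, ?_, ?_⟩
    · rw [← Adjunction.homEquiv_naturality_left_symm, sq.fac_left, Equiv.symm_apply_apply]
    · rw [← Adjunction.homEquiv_naturality_right_symm, sq.fac_right, Equiv.symm_apply_apply]
  -- Extending the identity of the realization of `D` against the map to a point gives a retraction.
  obtain ⟨r, hr, -⟩ := adj_sq
    (TopCat.ofHom (ContinuousMap.const (toTop.obj D) PUnit.unit.{u + 1}))
    hasHomotopyLifting_const (𝟙 _) (TopCat.ofHom (ContinuousMap.const _ PUnit.unit)) rfl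
  -- On the realization of `D` the constant paths connect `x` with its image under the retraction.
  -- Extending this family of paths gives a homotopy from the identity to the retraction followed by
  -- the inclusion.
  obtain ⟨l, -, hl⟩ := adj_sq (TopCat.ofHom (pathEnds (toTop.obj M)))
    (hasHomotopyLifting_pathEnds _)
    (toTop.map j ≫ TopCat.ofHom (ContinuousMap.curry ⟨Prod.fst, continuous_fst⟩))
    (TopCat.ofHom ((ContinuousMap.id _).prodMk ((r ≫ toTop.map j).hom))) (by
      have h : toTop.map j ≫ r ≫ toTop.map j = toTop.map j := by
        rw [← Category.assoc, hr, Category.id_comp]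
      exact TopCat.hom_ext (ContinuousMap.ext fun x =>
        Prod.ext rfl (ConcreteCategory.congr_hom h x).symm))
  have hl' : ∀ x, (l.hom x 0, l.hom x 1) = (x, (r ≫ toTop.map j).hom x) := fun x =>
    ConcreteCategory.congr_hom hl x
  refine ⟨⟨(toTop.map j).hom, r.hom, ?_, ?_⟩, rfl⟩
  · have : r.hom.comp (toTop.map j).hom = ContinuousMap.id _ := congrArg TopCat.Hom.hom hr
    rw [this]
  · refine ContinuousMap.Homotopic.symm ⟨⟨⟨fun z => l.hom z.2 z.1, ?_⟩, ?_, ?_⟩⟩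
    · exact (ContinuousMap.uncurry l.hom).continuous.comp continuous_swap
    · exact fun x => congrArg Prod.fst (hl' x)
    · exact fun x => congrArg Prod.snd (hl' x)

end SSet

/-! ### Natural transformations as homotopies of nerves -/

namespace CategoryTheory

section Cylinder

variable {C D : Type*} [Category C] [Category D] {F G : C ⥤ D}

/-- The functor `C × {0 < 1} ⥤ D` given by a natural transformation. -/
def cylinderFunctor (α : F ⟶ G) : C × Fin 2 ⥤ D where
  obj z := match z with
    | (c, 0) => F.obj c
    | (c, 1) => G.obj c
  map {z z'} f := match z, z', f with
    | (_, 0), (_, 0), f => F.map f.1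
    | (c, 0), (_, 1), f => α.app c ≫ G.map f.1
    | (_, 1), (_, 1), f => G.map f.1
    | (_, 1), (_, 0), f => (Nat.not_succ_le_zero 0 (leOfHom f.2)).elim
  map_id z := by
    obtain ⟨c, i⟩ := z
    match i with
    | 0 => exact F.map_id c
    | 1 => exact G.map_id c
  map_comp {z z' z''} f g := by
    obtain ⟨c, i⟩ := z
    obtain ⟨c', i'⟩ := z'
    obtain ⟨c'', i''⟩ := z''
    match i, i', i'', f, g with
    | 0, 0, 0, f, g => exact F.map_comp f.1 g.1
    | 1, 1, 1, f, g => exact G.map_comp f.1 g.1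
    | 0, 0, 1, f, g =>
      change α.app c ≫ G.map (f.1 ≫ g.1) = F.map f.1 ≫ α.app c' ≫ G.map g.1
      simp
    | 0, 1, 1, f, g =>
      change α.app c ≫ G.map (f.1 ≫ g.1) = (α.app c ≫ G.map f.1) ≫ G.map g.1
      simp
    | 1, 0, 0, f, g => exact (Nat.not_succ_le_zero 0 (leOfHom f.2)).elim
    | 1, 0, 1, f, g => exact (Nat.not_succ_le_zero 0 (leOfHom f.2)).elim
    | 0, 1, 0, f, g => exact (Nat.not_succ_le_zero 0 (leOfHom g.2)).elim
    | 1, 1, 0, f, g => exact (Nat.not_succ_le_zero 0 (leOfHom g.2)).elim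

lemma cylinderFunctor_whiskerLeft {B : Type*} [Category B] (i : B ⥤ C) (α : F ⟶ G) :
    cylinderFunctor (Functor.whiskerLeft i α) =
      Functor.prod i (𝟭 (Fin 2)) ⋙ cylinderFunctor α := by
  refine CategoryTheory.Functor.hext (fun z => ?_) (fun z z' f => ?_)
  · obtain ⟨c, k⟩ := z
    match k with
    | 0 => rfl
    | 1 => rfl
  · obtain ⟨c, k⟩ := z
    obtain ⟨c', k'⟩ := z'
    match k, k', f with
    | 0, 0, f => rfl
    | 0, 1, f => rfl
    | 1, 1, f => rfl
    | 1, 0, f => exact (Nat.not_succ_le_zero 0 (leOfHom f.2)).elim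

lemma cylinderFunctor_whiskerRight {E : Type*} [Category E] (α : F ⟶ G) (p : D ⥤ E) :
    cylinderFunctor (Functor.whiskerRight α p) = cylinderFunctor α ⋙ p := by
  refine CategoryTheory.Functor.hext (fun z => ?_) (fun z z' f => ?_)
  · obtain ⟨c, k⟩ := z
    match k with
    | 0 => rfl
    | 1 => rfl
  · obtain ⟨c, k⟩ := z
    obtain ⟨c', k'⟩ := z'
    match k, k', f with
    | 0, 0, f => rfl
    | 0, 1, f =>
      exact heq_of_eq (p.map_comp (α.app c) (G.map f.1)).symm
    | 1, 1, f => rfl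
    | 1, 0, f => exact (Nat.not_succ_le_zero 0 (leOfHom f.2)).elim

end Cylinder

end CategoryTheory

namespace SSet

open Simplicial HomotopicalAlgebra modelCategoryQuillen CartesianMonoidalCategory

/-- The criterion for subcomplexes, transported along the isomorphism of `D` with the range of `j`.
-/
lemma anodyneExtensions_of_mono_deformation (e e' : Fin 2) {D B : SSet.{u}} (j : D ⟶ B) [Mono j]
    (h : B ⊗ Δ[1] ⟶ B) (hD : D ⊗ Δ[1] ⟶ D) (r : B ⟶ D) (h₁ : endIncl e ≫ h = r ≫ j)
    (h₂ : endIncl e' ≫ h = 𝟙 B) (h₃ : j ▷ _ ≫ h = hD ≫ j) : anodyneExtensions j := by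
  rw [← Subcomplex.toRange_ι j, MorphismProperty.cancel_left_of_respectsIso anodyneExtensions]
  refine anodyneExtensions_of_deformation e e' (Subcomplex.range j) h
    (inv (Subcomplex.toRange j) ▷ _ ≫ hD ≫ Subcomplex.toRange j)
    (r ≫ Subcomplex.toRange j) ?_ h₂ ?_
  · rw [h₁, Category.assoc, Subcomplex.toRange_ι]
  · rw [Category.assoc, Category.assoc, Subcomplex.toRange_ι, ← h₃, ← comp_whiskerRight_assoc,
      IsIso.inv_comp_eq (Subcomplex.toRange j) |>.2 (Subcomplex.toRange_ι j).symm]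

/-- The homotopy between maps of nerves that is given by a functor from `C × {0 < 1}`. -/
noncomputable def nerveHomotopy {C D : Type u} [Category.{u} C] [Category.{u} D]
    (H : C × Fin 2 ⥤ D) : nerve C ⊗ Δ[1] ⟶ nerve D where
  app n := ↾fun z => (Functor.prod' z.1 (stdSimplex.asOrderHom z.2).monotone.functor ⋙ H :
    Fin (n.unop.len + 1) ⥤ D)
  naturality _ _ _ := rfl

section

variable {C D : Type u} [Category.{u} C] [Category.{u} D]

lemma whiskerRight_nerveHomotopy {B : Type u} [Category.{u} B] (i : B ⥤ C) (H : C × Fin 2 ⥤ D) :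
    nerveMap i ▷ _ ≫ nerveHomotopy H = nerveHomotopy (Functor.prod i (𝟭 (Fin 2)) ⋙ H) := rfl

lemma nerveHomotopy_comp {E : Type u} [Category.{u} E] (H : C × Fin 2 ⥤ D) (p : D ⥤ E) :
    nerveHomotopy H ≫ nerveMap p = nerveHomotopy (H ⋙ p) := rfl

lemma mono_nerveMap (i : C ⥤ D) [i.Faithful] (hi : Function.Injective i.obj) :
    Mono (nerveMap i) := by
  rw [NatTrans.mono_iff_mono_app]
  intro n
  rw [mono_iff_injective]
  intro (x : Fin (n.unop.len + 1) ⥤ C) (y : Fin (n.unop.len + 1) ⥤ C) (h : x ⋙ i = y ⋙ i)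
  refine CategoryTheory.Functor.ext (fun k => hi (Functor.congr_obj h k)) (fun a b f => ?_)
  refine i.map_injective ?_
  rw [i.map_comp, i.map_comp, eqToHom_map, eqToHom_map]
  exact Functor.congr_hom h f

/-- A functor `i : C ⥤ D` with a natural transformation `r ⋙ i ⟶ 𝟭 D` that restricts to `C`. -/
lemma anodyneExtensions_nerveMap_of_counit (i : C ⥤ D) [i.Faithful]
    (hi : Function.Injective i.obj) (r : D ⥤ C) (ε : r ⋙ i ⟶ 𝟭 D) (K : i ⋙ r ⟶ 𝟭 C)
    (h : ∀ X, i.map (K.app X) = ε.app (i.obj X)) : anodyneExtensions (nerveMap i) := by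
  have := mono_nerveMap i hi
  -- The source of `ε` sits at the end `0` and the identity at the end `1`; for a transformation out
  -- of the identity the ends are exchanged.
  refine anodyneExtensions_of_mono_deformation 0 1 (nerveMap i)
    (nerveHomotopy (cylinderFunctor ε)) (nerveHomotopy (cylinderFunctor K)) (nerveMap r) rfl rfl ?_
  rw [whiskerRight_nerveHomotopy, nerveHomotopy_comp, ← cylinderFunctor_whiskerLeft,
    ← cylinderFunctor_whiskerRight]
  -- The hypothesis `h` says exactly that the homotopy preserves the nerve of `C`, where it is the
  -- one given by `K`.
  have e : Functor.whiskerLeft i ε = (Functor.whiskerRight K i :) :=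
    NatTrans.ext (funext fun X => (h X).symm)
  exact congrArg (fun α : i ⋙ r ⋙ i ⟶ i => nerveHomotopy (cylinderFunctor α)) e

/-- A functor `i : C ⥤ D` with a natural transformation `𝟭 D ⟶ r ⋙ i` that restricts to `C`. -/
lemma anodyneExtensions_nerveMap_of_unit (i : C ⥤ D) [i.Faithful]
    (hi : Function.Injective i.obj) (r : D ⥤ C) (η : 𝟭 D ⟶ r ⋙ i) (K : 𝟭 C ⟶ i ⋙ r)
    (h : ∀ X, i.map (K.app X) = η.app (i.obj X)) : anodyneExtensions (nerveMap i) := by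
  have := mono_nerveMap i hi
  refine anodyneExtensions_of_mono_deformation 1 0 (nerveMap i)
    (nerveHomotopy (cylinderFunctor η)) (nerveHomotopy (cylinderFunctor K)) (nerveMap r) rfl rfl ?_
  rw [whiskerRight_nerveHomotopy, nerveHomotopy_comp, ← cylinderFunctor_whiskerLeft,
    ← cylinderFunctor_whiskerRight]
  have e : Functor.whiskerLeft i η = (Functor.whiskerRight K i :) :=
    NatTrans.ext (funext fun X => (h X).symm)
  exact congrArg (fun α : i ⟶ i ⋙ r ⋙ i => nerveHomotopy (cylinderFunctor α)) e

end

end SSet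

/-! ### The collage of a functor -/

namespace CategoryTheory

/-- The collage of a functor `L : X ⥤ Y`: the disjoint union of `X` and `Y` with the morphisms
`L.obj x ⟶ y` adjoined as morphisms from `x` to `y`. -/
def Collage {X Y : Type u} [Category.{u} X] [Category.{u} Y] (_ : X ⥤ Y) : Type u := X ⊕ Y

namespace Collage

section

variable {X Y : Type u} [Category.{u} X] [Category.{u} Y] {L : X ⥤ Y}

/-- The morphisms of the collage. -/
def Hom : Collage L → Collage L → Type u
  | .inl x, .inl x' => x ⟶ x'
  | .inl x, .inr y => L.obj x ⟶ y
  | .inr _, .inl _ => PEmpty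
  | .inr y, .inr y' => y ⟶ y'

/-- The composition of morphisms of the collage. -/
def comp : ∀ {a b c : Collage L}, Hom a b → Hom b c → Hom a c
  | .inl x, .inl x', .inl x'', f, g => (show x ⟶ x' from f) ≫ (show x' ⟶ x'' from g)
  | .inl x, .inl x', .inr y, f, g => L.map (show x ⟶ x' from f) ≫ (show L.obj x' ⟶ y from g)
  | .inl x, .inr y, .inr y', f, g => (show L.obj x ⟶ y from f) ≫ (show y ⟶ y' from g)
  | .inr y, .inr y', .inr y'', f, g => (show y ⟶ y' from f) ≫ (show y' ⟶ y'' from g)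
  | .inr _, .inl _, _, f, _ => PEmpty.elim f
  | _, .inr _, .inl _, _, g => PEmpty.elim g

instance : Category.{u} (Collage L) where
  Hom := Hom
  id
    | .inl x => 𝟙 x
    | .inr y => 𝟙 y
  comp := comp
  id_comp {a b} f := by
    match a, b, f with
    | .inl _, .inl _, f => exact Category.id_comp (obj := X) f
    | .inl _, .inr _, f =>
      change L.map (𝟙 _) ≫ f = f
      rw [L.map_id]
      exact Category.id_comp (obj := Y) f
    | .inr _, .inr _, f => exact Category.id_comp (obj := Y) f
    | .inr _, .inl _, f => exact PEmpty.elim f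
  comp_id {a b} f := by
    match a, b, f with
    | .inl _, .inl _, f => exact Category.comp_id (obj := X) f
    | .inl _, .inr _, f => exact Category.comp_id (obj := Y) f
    | .inr _, .inr _, f => exact Category.comp_id (obj := Y) f
    | .inr _, .inl _, f => exact PEmpty.elim f
  assoc {a b c d} f g h := by
    match a, b, c, d, f, g, h with
    | .inl _, .inl _, .inl _, .inl _, f, g, h => exact Category.assoc (obj := X) f g h
    | .inl _, .inl _, .inl _, .inr _, f, g, h =>
      exact (congrArg (· ≫ (show L.obj _ ⟶ _ from h)) (L.map_comp f g)).trans
        (Category.assoc (obj := Y) _ _ _)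
    | .inl _, .inl _, .inr _, .inr _, f, g, h => exact Category.assoc (obj := Y) _ g h
    | .inl _, .inr _, .inr _, .inr _, f, g, h => exact Category.assoc (obj := Y) f g h
    | .inr _, .inr _, .inr _, .inr _, f, g, h => exact Category.assoc (obj := Y) f g h
    | .inr _, .inl _, _, _, f, _, _ => exact PEmpty.elim f
    | _, .inr _, .inl _, _, _, g, _ => exact PEmpty.elim g
    | _, _, .inr _, .inl _, _, _, h => exact PEmpty.elim h

variable (L)

/-- The inclusion of `X` in the collage. -/
def inlFunctor : X ⥤ Collage L where
  obj x := .inl x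
  map f := f
  map_id _ := rfl
  map_comp _ _ := rfl

/-- The inclusion of `Y` in the collage. -/
def inrFunctor : Y ⥤ Collage L where
  obj y := .inr y
  map f := f
  map_id _ := rfl
  map_comp _ _ := rfl

instance : (inlFunctor L).Faithful := ⟨fun h => h⟩

instance : (inrFunctor L).Faithful := ⟨fun h => h⟩

variable {L}

/-- The morphism of the collage that is given by `f : L.obj x ⟶ y`. -/
def cross {x : X} {y : Y} (f : L.obj x ⟶ y) : (inlFunctor L).obj x ⟶ (inrFunctor L).obj y := f

/-- A functor on the collage, from functors on both parts and the values on the morphisms between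
them. -/
def descFunctor {Z : Type u} [Category.{u} Z] (F : X ⥤ Z) (G : Y ⥤ Z) (κ : F ⟶ L ⋙ G) :
    Collage L ⥤ Z where
  obj
    | .inl x => F.obj x
    | .inr y => G.obj y
  map {a b} f := match a, b, f with
    | .inl x, .inl x', f => F.map (show x ⟶ x' from f)
    | .inl x, .inr y, f => κ.app x ≫ G.map (show L.obj x ⟶ y from f)
    | .inr y, .inr y', f => G.map (show y ⟶ y' from f)
    | .inr _, .inl _, f => PEmpty.elim f
  map_id
    | .inl x => F.map_id x
    | .inr y => G.map_id y
  map_comp {a b c} f g := by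
    match a, b, c, f, g with
    | .inl _, .inl _, .inl _, f, g => exact F.map_comp _ _
    | .inl x, .inl x', .inr y, f, g =>
      change κ.app x ≫ G.map (L.map (show x ⟶ x' from f) ≫ (show L.obj x' ⟶ y from g)) =
        F.map (show x ⟶ x' from f) ≫ κ.app x' ≫ G.map (show L.obj x' ⟶ y from g)
      rw [G.map_comp, ← Category.assoc, ← Category.assoc, κ.naturality]
      rfl
    | .inl x, .inr y, .inr y', f, g =>
      change κ.app x ≫ G.map ((show L.obj x ⟶ y from f) ≫ (show y ⟶ y' from g)) =
        (κ.app x ≫ G.map (show L.obj x ⟶ y from f)) ≫ G.map (show y ⟶ y' from g)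
      rw [G.map_comp, Category.assoc]
    | .inr _, .inr _, .inr _, f, g => exact G.map_comp _ _
    | .inr _, .inl _, _, f, _ => exact PEmpty.elim f
    | _, .inr _, .inl _, _, g => exact PEmpty.elim g

/-- Each morphism `f : L.obj x ⟶ y` of the collage factors as `cross (𝟙 _)` followed by `f` in `Y`,
so the values on the morphisms `cross (𝟙 _)` determine the rest. -/
lemma functor_ext {Z : Type u} [Category.{u} Z] {F G : Collage L ⥤ Z}
    (h₁ : inlFunctor L ⋙ F = inlFunctor L ⋙ G) (h₂ : inrFunctor L ⋙ F = inrFunctor L ⋙ G)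
    (h₃ : ∀ x, HEq (F.map (cross (𝟙 (L.obj x)))) (G.map (cross (𝟙 (L.obj x))))) : F = G := by
  have hobj : ∀ a, F.obj a = G.obj a
    | .inl x => Functor.congr_obj h₁ x
    | .inr y => Functor.congr_obj h₂ y
  refine CategoryTheory.Functor.hext hobj fun a b f => ?_
  match a, b, f with
  | .inl x, .inl x', f => exact congr_arg_heq (fun T : X ⥤ Z => T.map (show x ⟶ x' from f)) h₁
  | .inr x, .inr x', f => exact congr_arg_heq (fun T : Y ⥤ Z => T.map (show x ⟶ x' from f)) h₂
  | .inr _, .inl _, f => exact PEmpty.elim f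
  | .inl x, .inr y, f =>
    have e : (show (inlFunctor L).obj x ⟶ (inrFunctor L).obj y from f) =
        cross (𝟙 (L.obj x)) ≫ (inrFunctor L).map (show L.obj x ⟶ y from f) :=
      (Category.id_comp (obj := Y) _).symm
    have h₄ := congr_arg_heq (fun T : Y ⥤ Z => T.map (show L.obj x ⟶ y from f)) h₂
    change HEq (F.map (show (inlFunctor L).obj x ⟶ (inrFunctor L).obj y from f))
      (G.map (show (inlFunctor L).obj x ⟶ (inrFunctor L).obj y from f))
    rw [e, F.map_comp, G.map_comp]
    have aux : ∀ {a b c a' b' c' : Z} (_ : a = a') (_ : b = b') (_ : c = c') (s : a ⟶ b)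
        (t : b ⟶ c) (s' : a' ⟶ b') (t' : b' ⟶ c'), HEq s s' → HEq t t' →
        HEq (s ≫ t) (s' ≫ t') := by
      rintro a b c _ _ _ rfl rfl rfl s t _ _ ⟨⟩ ⟨⟩
      rfl
    exact aux (hobj _) (hobj _) (hobj _) _ _ _ _ (h₃ x) h₄

/-- The projection of the collage to `Y`. -/
def proj (L : X ⥤ Y) : Collage L ⥤ Y := descFunctor L (𝟭 Y) (𝟙 L)

lemma cross_comp_inr {x : X} {y y' : Y} (f : L.obj x ⟶ y) (g : y ⟶ y') :
    cross f ≫ (inrFunctor L).map g = cross (f ≫ g) := rfl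

lemma inl_comp_cross {x x' : X} {y : Y} (f : x ⟶ x') (g : L.obj x' ⟶ y) :
    (inlFunctor L).map f ≫ cross g = cross (L.map f ≫ g) := rfl

/-- A natural transformation between functors on the collage. -/
def descNatTrans {Z : Type u} [Category.{u} Z] {F G : Collage L ⥤ Z}
    (α : inlFunctor L ⋙ F ⟶ inlFunctor L ⋙ G) (β : inrFunctor L ⋙ F ⟶ inrFunctor L ⋙ G)
    (h : ∀ x, F.map (cross (𝟙 (L.obj x))) ≫ β.app (L.obj x) =
      α.app x ≫ G.map (cross (𝟙 (L.obj x)))) : F ⟶ G where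
  app
    | .inl x => α.app x
    | .inr y => β.app y
  naturality a b f := by
    match a, b, f with
    | .inl _, .inl _, f => exact α.naturality f
    | .inr _, .inr _, f => exact β.naturality f
    | .inr _, .inl _, f => exact PEmpty.elim f
    | .inl x, .inr y, f =>
      have e : (show (inlFunctor L).obj x ⟶ (inrFunctor L).obj y from f) =
          cross (𝟙 (L.obj x)) ≫ (inrFunctor L).map (show L.obj x ⟶ y from f) :=
        (Category.id_comp (obj := Y) _).symm
      change F.map (show (inlFunctor L).obj x ⟶ (inrFunctor L).obj y from f) ≫ β.app y =
        α.app x ≫ G.map (show (inlFunctor L).obj x ⟶ (inrFunctor L).obj y from f)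
      have h₁ := β.naturality (show L.obj x ⟶ y from f)
      rw [e, F.map_comp, G.map_comp, Category.assoc]
      refine (congrArg (F.map (cross (𝟙 (L.obj x))) ≫ ·) h₁).trans ?_
      rw [← Category.assoc, h, Category.assoc]
      rfl

-- A mapping cylinder retracts to its target: the unit is `cross (𝟙 _)` on `X` and the identity on
-- `Y`.
open SSet in
lemma anodyneExtensions_nerveMap_inr (L : X ⥤ Y) : anodyneExtensions (nerveMap (inrFunctor L)) :=
  anodyneExtensions_nerveMap_of_unit _ (fun _ _ h => Sum.inr.inj h) (proj L)
    (descNatTrans { app := fun x => cross (𝟙 (L.obj x)), naturality := fun x x' f => by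
                      refine (inl_comp_cross f _).trans ((congrArg cross ?_).trans
                        (cross_comp_inr _ (L.map f)).symm)
                      exact (Category.comp_id _).trans (Category.id_comp _).symm }
      (𝟙 (inrFunctor L)) (fun x => by
        change cross (𝟙 (L.obj x)) ≫ 𝟙 _ = cross (𝟙 (L.obj x)) ≫ (inrFunctor L).map (𝟙 _ ≫ 𝟙 _)
        simp))
    (𝟙 (𝟭 Y)) fun _ => rfl

-- The retraction to `X` is `L ⋙ R` on `X` and `R` on `Y`, and the counit is `K` on `X` and `cross
-- (ε.app y)` on `Y`. Naturality across the collage is precisely the hypothesis `h`; no triangle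
-- identity is needed.
open SSet in
lemma anodyneExtensions_nerveMap_inl (L : X ⥤ Y) (R : Y ⥤ X) (ε : R ⋙ L ⟶ 𝟭 Y)
    (K : L ⋙ R ⟶ 𝟭 X) (h : ∀ x, L.map (K.app x) = ε.app (L.obj x)) :
    anodyneExtensions (nerveMap (inlFunctor L)) :=
  anodyneExtensions_nerveMap_of_counit _ (fun _ _ h => Sum.inl.inj h)
    (descFunctor (L ⋙ R) R (𝟙 _))
    (descNatTrans { app := fun x => (inlFunctor L).map (K.app x), naturality := fun x x' f =>
                      K.naturality f }
      { app := fun y => cross (ε.app y), naturality := fun y y' f => by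
          refine (inl_comp_cross (R.map f) _).trans ((congrArg cross ?_).trans
            (cross_comp_inr _ f).symm)
          exact ε.naturality f }
      (fun x => by
        change (inlFunctor L).map (𝟙 _ ≫ R.map (𝟙 _)) ≫ cross (ε.app (L.obj x)) =
          (inlFunctor L).map (K.app x) ≫ cross (𝟙 _)
        rw [inl_comp_cross, inl_comp_cross, h]
        simp))
    K fun _ => rfl

end

section Functoriality

variable {I : Type*} [Category I] {F G : I ⥤ Cat.{u, u}} (L : F ⟶ G)

lemma naturality_toFunctor {a b : I} (f : a ⟶ b) :
    (F.map f).toFunctor ⋙ (L.app b).toFunctor = (L.app a).toFunctor ⋙ (G.map f).toFunctor :=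
  congrArg Cat.Hom.toFunctor (L.naturality f)

/-- The functor between collages that is given by a square that commutes strictly. -/
def mapFunctor {X Y X' Y' : Type u} [Category.{u} X] [Category.{u} Y] [Category.{u} X']
    [Category.{u} Y'] {L : X ⥤ Y} {L' : X' ⥤ Y'} (S : X ⥤ X') (T : Y ⥤ Y')
    (h : S ⋙ L' = L ⋙ T) : Collage L ⥤ Collage L' :=
  descFunctor (S ⋙ inlFunctor L') (T ⋙ inrFunctor L')
    { app := fun x => cross (eqToHom (Functor.congr_obj h x))
      naturality := fun x x' f => by
        refine (inl_comp_cross (L := L') _ _).trans ((congrArg cross ?_).trans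
          (cross_comp_inr _ _).symm)
        have h₁ := Functor.congr_hom h f
        change L'.map (S.map f) ≫ eqToHom _ = eqToHom _ ≫ T.map (L.map f)
        rw [← Functor.comp_map, h₁]
        simp }

lemma mapFunctor_map_cross {X Y X' Y' : Type u} [Category.{u} X] [Category.{u} Y]
    [Category.{u} X'] [Category.{u} Y'] {L : X ⥤ Y} {L' : X' ⥤ Y'} (S : X ⥤ X') (T : Y ⥤ Y')
    (h : S ⋙ L' = L ⋙ T) {x : X} {y : Y} (e : L.obj x = y) :
    (mapFunctor S T h).map (cross (eqToHom e)) =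
      cross (L := L') (eqToHom ((Functor.congr_obj h x).trans (congrArg T.obj e))) := by
  subst e
  change cross (eqToHom (Functor.congr_obj h x) ≫ T.map (𝟙 _)) = _
  rw [T.map_id]
  exact congrArg cross (Category.comp_id _)

/-- The squares that define functors between collages commute up to equality of objects.
Functoriality therefore compares such morphisms between end points that are only propositionally
equal. -/
lemma cross_eqToHom_heq {X Y : Type u} [Category.{u} X] [Category.{u} Y] {L : X ⥤ Y} {x x' : X}
    {y y' : Y} (hx : x = x') (e : L.obj x = y) (e' : L.obj x' = y') :
    HEq (cross (eqToHom e)) (cross (eqToHom e')) := by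
  subst hx e e'
  rfl

/-- The collage of a natural transformation between functors to the category of categories. -/
def collageFunctor : I ⥤ Cat.{u, u} where
  obj a := Cat.of (Collage (L.app a).toFunctor)
  map f := (mapFunctor (F.map f).toFunctor (G.map f).toFunctor
    (naturality_toFunctor L f)).toCatHom
  map_id a := by
    refine congrArg Functor.toCatHom (functor_ext ?_ ?_ ?_)
    · exact congrArg (fun T : F.obj a ⟶ F.obj a => T.toFunctor ⋙ inlFunctor _) (F.map_id a)
    · exact congrArg (fun T : G.obj a ⟶ G.obj a => T.toFunctor ⋙ inrFunctor _) (G.map_id a)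
    · intro x
      refine (heq_of_eq (mapFunctor_map_cross _ _ (naturality_toFunctor L (𝟙 a)) rfl)).trans ?_
      exact cross_eqToHom_heq
        (congrArg (fun T : F.obj a ⟶ F.obj a => T.toFunctor.obj x) (F.map_id a)) _ rfl
  map_comp {a b c} f g := by
    refine congrArg Functor.toCatHom (functor_ext ?_ ?_ ?_)
    · exact congrArg (fun T : F.obj a ⟶ F.obj c => T.toFunctor ⋙ inlFunctor _) (F.map_comp f g)
    · exact congrArg (fun T : G.obj a ⟶ G.obj c => T.toFunctor ⋙ inrFunctor _) (G.map_comp f g)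
    · intro x
      refine (heq_of_eq (mapFunctor_map_cross _ _ (naturality_toFunctor L (f ≫ g)) rfl)).trans ?_
      have h₁ := mapFunctor_map_cross _ _ (naturality_toFunctor L f)
        (rfl : (L.app a).toFunctor.obj x = _)
      have h₂ := mapFunctor_map_cross _ _ (naturality_toFunctor L g)
        (Functor.congr_obj (naturality_toFunctor L f) x)
      refine HEq.trans ?_ (heq_of_eq (((congrArg (mapFunctor _ _
        (naturality_toFunctor L g)).map h₁).trans h₂).symm))
      exact cross_eqToHom_heq
        (congrArg (fun T : F.obj a ⟶ F.obj c => T.toFunctor.obj x) (F.map_comp f g)) _ _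

/-- The inclusion of the source in the collage. -/
def inlTrans : F ⟶ collageFunctor L where
  app a := (inlFunctor (L.app a).toFunctor).toCatHom
  naturality _ _ _ := rfl

/-- The inclusion of the target in the collage. -/
def inrTrans : G ⟶ collageFunctor L where
  app a := (inrFunctor (L.app a).toFunctor).toCatHom
  naturality _ _ _ := rfl

/-- The projection of the collage to the target. -/
def projTrans : collageFunctor L ⟶ G where
  app a := (proj (L.app a).toFunctor).toCatHom
  naturality a b f := by
    refine congrArg Functor.toCatHom (functor_ext ?_ ?_ ?_)
    · exact naturality_toFunctor L f
    · rfl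
    · intro x
      refine (heq_of_eq (congrArg (proj (L.app b).toFunctor).map
        (mapFunctor_map_cross _ _ (naturality_toFunctor L f) rfl))).trans ?_
      have h₁ : (proj (L.app a).toFunctor).map (cross (𝟙 ((L.app a).toFunctor.obj x))) = 𝟙 _ :=
        Category.comp_id _
      refine HEq.trans ?_ (heq_of_eq ((congrArg (G.map f).toFunctor.map h₁).trans
        ((G.map f).toFunctor.map_id _)).symm)
      refine (heq_of_eq (Category.id_comp _)).trans ?_
      have h₂ := Functor.congr_obj (naturality_toFunctor L f) x
      exact eqToHom_heq_eqToHom h₂ h₂ rfl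

lemma inlTrans_projTrans : inlTrans L ≫ projTrans L = L := rfl

lemma inrTrans_projTrans : inrTrans L ≫ projTrans L = 𝟙 G := rfl

end Functoriality

end Collage

end CategoryTheory

/-! ### Weak equivalences of diagonals of nerves -/

namespace SymmetricSpectrum

open SSet

lemma WeakEquiv.comp {X Y Z : SSet.{u}} {f : X ⟶ Y} {g : Y ⟶ Z} (hf : WeakEquiv f)
    (hg : WeakEquiv g) : WeakEquiv (f ≫ g) := by
  obtain ⟨e, he⟩ := hf
  obtain ⟨e', he'⟩ := hg
  refine ⟨e.trans e', ?_⟩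
  rw [toTop.map_comp, TopCat.hom_comp, ← he, ← he']
  rfl

/-- With `j` a homotopy inverse of `i`, one has `i p ≃ i p i j = i j ≃ id`, so `i` is also a
homotopy inverse of `p`. -/
lemma WeakEquiv.of_section {X Y : SSet.{u}} {i : X ⟶ Y} {p : Y ⟶ X} (hi : WeakEquiv i)
    (h : i ≫ p = 𝟙 X) : WeakEquiv p := by
  obtain ⟨e, he⟩ := hi
  have h₁ : (toTop.map p).hom.comp e.toFun = ContinuousMap.id _ := by
    rw [he, ← TopCat.hom_comp, ← toTop.map_comp, h, toTop.map_id]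
    rfl
  refine ⟨⟨(toTop.map p).hom, e.toFun, ?_, ?_⟩, rfl⟩
  · have h₂ : (e.toFun.comp (toTop.map p).hom).comp (e.toFun.comp e.invFun) =
        e.toFun.comp e.invFun := by
      rw [ContinuousMap.comp_assoc, ← ContinuousMap.comp_assoc _ e.toFun, h₁,
        ContinuousMap.id_comp]
    have h₃ := (ContinuousMap.Homotopic.refl (e.toFun.comp (toTop.map p).hom)).comp e.right_inv
    rw [h₂, ContinuousMap.comp_id] at h₃
    exact h₃.symm.trans e.right_inv
  · rw [h₁]

lemma weakEquiv_diagonal_of_anodyneExtensions {X M : SimplicialObject SSet.{u}} (j : X ⟶ M)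
    [∀ n, Mono (j.app n)] (hj : ∀ n, anodyneExtensions (j.app n)) : WeakEquiv (diagonal.map j) :=
  weakEquiv_of_anodyneExtensions _ (anodyneExtensions_diagonal_map j hj)

open Collage in
/-- A map of simplicial categories that has, in each degree, an inverse up to natural
transformations induces a weak equivalence of the diagonals of the nerves. -/
theorem weakEquiv_diagonal_nerve {F G : SimplexCategoryᵒᵖ ⥤ Cat.{u, u}} (L : F ⟶ G)
    (R : ∀ n, G.obj n ⥤ F.obj n) (ε : ∀ n, R n ⋙ (L.app n).toFunctor ⟶ 𝟭 (G.obj n))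
    (K : ∀ n, (L.app n).toFunctor ⋙ R n ⟶ 𝟭 (F.obj n))
    (h : ∀ n x, (L.app n).toFunctor.map ((K n).app x) = (ε n).app ((L.app n).toFunctor.obj x)) :
    WeakEquiv (diagonal.map (Functor.whiskerRight L nerveFunctor)) := by
  have m₁ : ∀ n, Mono ((Functor.whiskerRight (inlTrans L) nerveFunctor).app n) := fun n =>
    mono_nerveMap (inlFunctor (L.app n).toFunctor) fun _ _ h => Sum.inl.inj h
  have m₂ : ∀ n, Mono ((Functor.whiskerRight (inrTrans L) nerveFunctor).app n) := fun n =>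
    mono_nerveMap (inrFunctor (L.app n).toFunctor) fun _ _ h => Sum.inr.inj h
  -- Only the inclusion has to be natural in `n`; that it is anodyne is checked degree by degree, so
  -- `R`, `ε` and `K` may be unrelated for different `n`.
  have w₁ : WeakEquiv (diagonal.map (Functor.whiskerRight (inlTrans L) nerveFunctor)) :=
    weakEquiv_diagonal_of_anodyneExtensions _ fun n =>
      anodyneExtensions_nerveMap_inl _ (R n) (ε n) (K n) (h n)
  have w₂ : WeakEquiv (diagonal.map (Functor.whiskerRight (inrTrans L) nerveFunctor)) :=
    weakEquiv_diagonal_of_anodyneExtensions _ fun n => anodyneExtensions_nerveMap_inr _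
  have w₃ : WeakEquiv (diagonal.map (Functor.whiskerRight (projTrans L) nerveFunctor)) :=
    w₂.of_section (by
      rw [← diagonal.map_comp, ← Functor.whiskerRight_comp, inrTrans_projTrans]
      exact diagonal.map_id _)
  have w₄ := w₁.comp w₃
  rwa [← diagonal.map_comp, ← Functor.whiskerRight_comp, inlTrans_projTrans] at w₄

end SymmetricSpectrum

/-! ### Objectwise sums of systems -/

section TensorSystems

variable {C : Type u} [Category.{v} C] [MonoidalCategory C]

lemma eqToHom_tensorHom_eqToHom {X Y X' Y' : C} (h : X = Y) (h' : X' = Y') :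
    eqToHom h ⊗ₘ eqToHom h' = eqToHom (congrArg₂ tensorObj h h') := by
  subst h h'
  simp

variable [SymmetricCategory C]

/-- On the left `X₁` and `Y₂` cross twice, on the right not at all; the double crossing cancels
because the braiding is a symmetry. -/
lemma braiding_tensorμ (X₁ X₂ Y₁ Y₂ : C) :
    (β_ (X₁ ⊗ X₂) (Y₁ ⊗ Y₂)).hom ≫ tensorμ Y₁ Y₂ X₁ X₂ =
      tensorμ X₁ X₂ Y₁ Y₂ ≫ ((β_ X₁ Y₁).hom ⊗ₘ (β_ X₂ Y₂).hom) := by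
  simp [tensorμ, SymmetricCategory.braiding_swap_eq_inv_braiding Y₁ X₂,
    MonoidalCategory.tensorHom_def, SymmetricCategory.braiding_swap_eq_inv_braiding Y₂ X₁]

instance isIso_tensorμ (X₁ X₂ Y₁ Y₂ : C) : IsIso (tensorμ X₁ X₂ Y₁ Y₂) :=
  ⟨tensorδ X₁ X₂ Y₁ Y₂, tensorμ_tensorδ _ _ _ _, tensorδ_tensorμ _ _ _ _⟩

lemma tensorμ_comp_tensorHom {P Q R P' Q' R' X Y Z X' Y' Z' : C} {r : Q ⊗ R ⟶ P}
    {r' : Q' ⊗ R' ⟶ P'} {s : Y ⊗ Z ⟶ X} {s' : Y' ⊗ Z' ⟶ X'}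
    {f : P ⟶ X} {g : Q ⟶ Y} {h : R ⟶ Z} {f' : P' ⟶ X'} {g' : Q' ⟶ Y'} {h' : R' ⟶ Z'}
    (e : r ≫ f = (g ⊗ₘ h) ≫ s) (e' : r' ≫ f' = (g' ⊗ₘ h') ≫ s') :
    (tensorμ Q Q' R R' ≫ (r ⊗ₘ r')) ≫ (f ⊗ₘ f') =
      ((g ⊗ₘ g') ⊗ₘ (h ⊗ₘ h')) ≫ tensorμ Y Y' Z Z' ≫ (s ⊗ₘ s') := by
  rw [Category.assoc, tensorHom_comp_tensorHom, e, e', tensorμ_natural_assoc,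
    tensorHom_comp_tensorHom]

namespace System

variable {K : Shape} {W : MorphismProperty C}

/-- Two families of maps that commute with sums still do so after they are added by the maps `ρ`
of a further splitting. -/
lemma tensorμ_comp_ρ (X : System C K W) {i j : K.Dir} {S T U S' T' U' S'' T'' U'' : K.Idx}
    (h : K.Split i S T U) (h' : K.Split i S' T' U') (h'' : K.Split i S'' T'' U'')
    (hS : K.Split j S S' S'') (hT : K.Split j T T' T'') (hU : K.Split j U U' U'')
    {P Q R P' Q' R' : C} {r : Q ⊗ R ⟶ P} {r' : Q' ⊗ R' ⟶ P'}
    {fP : P ⟶ X.obj S'} {fQ : Q ⟶ X.obj T'} {fR : R ⟶ X.obj U'}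
    {gP : P' ⟶ X.obj S''} {gQ : Q' ⟶ X.obj T''} {gR : R' ⟶ X.obj U''}
    (hf : r ≫ fP = (fQ ⊗ₘ fR) ≫ X.ρ h') (hg : r' ≫ gP = (gQ ⊗ₘ gR) ≫ X.ρ h'') :
    (tensorμ Q Q' R R' ≫ (r ⊗ₘ r')) ≫ (fP ⊗ₘ gP) ≫ X.ρ hS =
      ((fQ ⊗ₘ gQ) ≫ X.ρ hT ⊗ₘ (fR ⊗ₘ gR) ≫ X.ρ hU) ≫ X.ρ h := by
  -- `interchange` also covers `i = j`, which occurs when a splitting to be respected has the same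
  -- direction as the one that is summed over.
  rw [← Category.assoc, tensorμ_comp_tensorHom hf hg, ← tensorHom_comp_tensorHom, Category.assoc,
    Category.assoc, Category.assoc, X.interchange hT hU h h' h'' hS]

lemma tensorHom_comp_ρ_heq (X : System C K W) {i : K.Dir} {S T U S' T' U' : K.Idx}
    (h : K.Split i S T U) (h' : K.Split i S' T' U') (hS : S = S') (hT : T = T') (hU : U = U')
    {P Q : C} {f : P ⟶ X.obj T} {f' : P ⟶ X.obj T'} {g : Q ⟶ X.obj U} {g' : Q ⟶ X.obj U'}
    (hf : HEq f f') (hg : HEq g g') : HEq ((f ⊗ₘ g) ≫ X.ρ h) ((f' ⊗ₘ g') ≫ X.ρ h') := by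
  subst hS hT hU
  rw [eq_of_heq hf, eq_of_heq hg]

lemma tensorHom_comp_ρ_of_isEmpty (X : System C K W) {i : K.Dir} {S T U : K.Idx} {P Q : C}
    (h : K.Split i S T U) (hT : K.IsEmpty T) {f : P ⟶ X.obj T} {g : Q ⟶ X.obj U}
    {e : P = X.obj T} {e' : Q = X.obj U} (hf : f = eqToHom e) (hg : g = eqToHom e')
    (k : P ⊗ Q = X.obj S) : (f ⊗ₘ g) ≫ X.ρ h = eqToHom k := by
  obtain ⟨l, hl⟩ := X.ρ_empty h (Or.inl hT)
  rw [hl, hf, hg, eqToHom_tensorHom_eqToHom, eqToHom_trans]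

lemma app_eqToHom {X Y : System C K W} (h : X = Y) (S : K.Idx) :
    Hom.app (eqToHom h) S = eqToHom (congrArg (fun Z : System C K W => Z.obj S) h) := by
  subst h
  rfl

end System

variable [PermutativeCategory C]

open PermutativeCategory

/-- Interchanging a unit with `X` is an identity in a permutative category. This makes the sum maps
of a sum of systems trivial at empty sets. -/
lemma tensorμ_unit_left (X Y : C) : ∃ e, tensorμ (𝟙_ C) (𝟙_ C) X Y = eqToHom e := by
  have h := interchange_unit₃ X Y (𝟙 (X ⊗ Y))
  rw [Category.comp_id, ← eqToHom_refl _ rfl, eqToHom_tensorHom_eqToHom,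
    eqToHom_tensorHom_eqToHom, eqToHom_trans, eq_comm, comp_eqToHom_iff, eqToHom_trans] at h
  exact ⟨_, h⟩

lemma tensorμ_unit_right (X Y : C) : ∃ e, tensorμ X Y (𝟙_ C) (𝟙_ C) = eqToHom e := by
  have h := interchange_unit₄ X Y (𝟙 (X ⊗ Y))
  rw [Category.comp_id, ← eqToHom_refl _ rfl, eqToHom_tensorHom_eqToHom,
    eqToHom_tensorHom_eqToHom, eqToHom_trans, eq_comm, comp_eqToHom_iff, eqToHom_trans] at h
  exact ⟨_, h⟩

namespace System

/-- The objectwise tensor product of two systems on the subsets of a based set. -/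
def tensor {A : Pointed.{0}} (X Y : System C (segShape A) ⊤) : System C (segShape A) ⊤ where
  obj S := X.obj S ⊗ Y.obj S
  ρ h := tensorμ _ _ _ _ ≫ (X.ρ h ⊗ₘ Y.ρ h)
  mem _ := trivial
  obj_empty h := by rw [X.obj_empty h, Y.obj_empty h, unit_tensor]
  ρ_empty {i S T U} h h' := by
    obtain ⟨e, he⟩ := X.ρ_empty h h'
    obtain ⟨e', he'⟩ := Y.ρ_empty h h'
    have hμ : ∃ e, tensorμ (X.obj T) (Y.obj T) (X.obj U) (Y.obj U) = eqToHom e := by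
      rcases h' with h' | h'
      · rw [X.obj_empty h', Y.obj_empty h']
        exact tensorμ_unit_left _ _
      · rw [X.obj_empty h', Y.obj_empty h']
        exact tensorμ_unit_right _ _
    obtain ⟨k, hk⟩ := hμ
    rw [he, he', hk, eqToHom_tensorHom_eqToHom, eqToHom_trans]
    exact ⟨_, rfl⟩
  ρ_symm h := by
    rw [← Category.assoc, braiding_tensorμ, Category.assoc, tensorHom_comp_tensorHom,
      X.ρ_symm h, Y.ρ_symm h]
  ρ_assoc {i S TU UV T U V} h₁ h₂ h₃ h₄ := by
    have e := X.ρ_assoc h₁ h₂ h₃ h₄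
    have e' := Y.ρ_assoc h₁ h₂ h₃ h₄
    simp only [comp_whiskerRight, MonoidalCategory.whiskerLeft_comp, Category.assoc]
    rw [tensorμ_natural_left_assoc, tensorμ_natural_right_assoc, tensorHom_comp_tensorHom,
      tensorHom_comp_tensorHom, e, e', ← tensor_associativity_assoc, tensorHom_comp_tensorHom]
  -- Systems on the subsets of a single based set have only one direction, so there is no
  -- interchange law to verify.
  ρ_interchange hij := (hij rfl).elim

/-- The objectwise tensor product of functors to systems on the subsets of a based set. -/
def tensorFunctor {D : Type*} [Category* D] {A : Pointed.{0}} (F G : D ⥤ System C (segShape A) ⊤) :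
    D ⥤ System C (segShape A) ⊤ where
  obj d := (F.obj d).tensor (G.obj d)
  map f :=
    { app := fun S => Hom.app (F.map f) S ⊗ₘ Hom.app (G.map f) S
      app_empty := fun h => (congrArg₂ (· ⊗ₘ ·) (Hom.app_empty _ h) (Hom.app_empty _ h)).trans
        (eqToHom_tensorHom_eqToHom _ _)
      comm := fun h => tensorμ_comp_tensorHom (Hom.comm (F.map f) h) (Hom.comm (G.map f) h) }
  map_id d := Hom.ext (funext fun S => by
    rw [F.map_id, G.map_id]
    exact id_tensorHom_id _ _)
  map_comp f g := Hom.ext (funext fun S => by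
    rw [F.map_comp, G.map_comp]
    exact (tensorHom_comp_tensorHom _ _ _ _).symm)

end System

end TensorSystems

/-! ### Restriction of systems to parts of the index sets -/

section Restriction

/-- The endomorphism of shapes that intersects a subset with `D`. -/
def segRestrict {A : Pointed.{0}} (D : FreeSet A) : Shape.Hom (segShape A) (segShape A) where
  idx S := ⟨S.1 ∩ D.1, fun h => S.2 h.1⟩
  dir := id
  empty {S} h := by
    show S.1 ∩ D.1 = ∅
    rw [show S.1 = ∅ from h, Set.empty_inter]
  split {i S T U} h := by
    refine ⟨?_, ?_⟩
    · show T.1 ∩ D.1 ∪ U.1 ∩ D.1 = S.1 ∩ D.1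
      rw [← Set.union_inter_distrib_right, h.1]
    · show T.1 ∩ D.1 ∩ (U.1 ∩ D.1) = ∅
      rw [← Set.inter_inter_distrib_right, h.2, Set.empty_inter]

/-- The endomorphism of shapes that intersects a tuple of subsets with a tuple `B`. -/
def multiRestrict {ι : Type} {A : ι → Pointed.{0}} (B : ∀ i, FreeSet (A i)) :
    Shape.Hom (multiShape A) (multiShape A) where
  idx S i := (segRestrict (B i)).idx (S i)
  dir := id
  empty := fun ⟨i, h⟩ => ⟨i, (segRestrict (B i)).empty h⟩
  split {i _ _ _} h := ⟨fun j hj => ⟨congrArg _ (h.1 j hj).1, congrArg _ (h.1 j hj).2⟩,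
    (segRestrict (B i)).split (i := ()) h.2⟩

/-- A splitting of the set restricted to splits every restricted index. The resulting maps `ρ` add
up the transformations for the two parts. -/
lemma segRestrict_split {A : Pointed.{0}} {D D' D'' : FreeSet A}
    (h : IsDisjUnion D.1 D'.1 D''.1) (S : FreeSet A) :
    (segShape A).Split () ((segRestrict D).idx S) ((segRestrict D').idx S)
      ((segRestrict D'').idx S) := by
  refine ⟨?_, ?_⟩
  · show S.1 ∩ D'.1 ∪ S.1 ∩ D''.1 = S.1 ∩ D.1
    rw [← Set.inter_union_distrib_left, h.1]
  · show S.1 ∩ D'.1 ∩ (S.1 ∩ D''.1) = ∅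
    rw [← Set.inter_inter_distrib_left, h.2, Set.inter_empty]

variable {ι : Type} {A : ι → Pointed.{0}}

lemma multiRestrict_split {i : ι} {B B' B'' : ∀ i, FreeSet (A i)}
    (h : (multiShape A).Split i B B' B'') (S : ∀ i, FreeSet (A i)) :
    (multiShape A).Split i ((multiRestrict B).idx S) ((multiRestrict B').idx S)
      ((multiRestrict B'').idx S) :=
  ⟨fun j hj => ⟨congrArg (fun D => (segRestrict D).idx (S j)) (h.1 j hj).1,
    congrArg (fun D => (segRestrict D).idx (S j)) (h.1 j hj).2⟩, segRestrict_split h.2 (S i)⟩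

/-- The product of the intersections is the intersection of the products, so restriction is
compatible with the comparison functor. -/
lemma prodShapeMap_multiRestrict (B S : ∀ i, FreeSet (A i)) :
    (prodShapeMap A).idx ((multiRestrict B).idx S) =
      (segRestrict ((prodShapeMap A).idx B)).idx ((prodShapeMap A).idx S) := by
  refine smash.freeSet_ext fun a _ => ?_
  show _ ↔ _ ∧ _
  rw [mk_mem_prodShapeMap, mk_mem_prodShapeMap, mk_mem_prodShapeMap]
  exact forall_and

end Restriction

/-! ### The approximate adjoint of the comparison functor -/

section Approximation

lemma tensorHom_comp_naturality {C : Type u} [Category.{v} C] [MonoidalCategory C]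
    {P Q P' Q' X Y Z X' Y' Z' : C} {a : P ⟶ P'} {b : Q ⟶ Q'} {f : P ⟶ X} {f' : P' ⟶ X'}
    {g : Q ⟶ Y} {g' : Q' ⟶ Y'} {x : X ⟶ X'} {y : Y ⟶ Y'} {z : Z ⟶ Z'} {r : X ⊗ Y ⟶ Z}
    {r' : X' ⊗ Y' ⟶ Z'} (hf : a ≫ f' = f ≫ x) (hg : b ≫ g' = g ≫ y)
    (hr : r ≫ z = (x ⊗ₘ y) ≫ r') :
    (a ⊗ₘ b) ≫ (f' ⊗ₘ g') ≫ r' = ((f ⊗ₘ g) ≫ r) ≫ z := by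
  rw [Category.assoc, hr, ← Category.assoc, ← Category.assoc, tensorHom_comp_tensorHom,
    tensorHom_comp_tensorHom, hf, hg]

variable {C : Type u} [Category.{v} C] [MonoidalCategory C] [SymmetricCategory C]
  [PermutativeCategory C] {ι : Type} {A : ι → Pointed.{0}}

variable (C A) in
/-- The comparison functor from systems on the subsets of a smash product, whose maps `ρ` need
not be isomorphisms, to multivariable systems. -/
abbrev laxCompare : System C (segShape (smash A)) ⊤ ⥤ System C (multiShape A) ⊤ :=
  System.pull (Shape.PMap.ofTotal (prodShapeMap A)) le_rfl

variable (C) in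
/-- A functor `R` from multivariable systems to systems on the subsets of the smash product that is
adjoint to the comparison functor on the part of the systems indexed by subsets of `B`. -/
structure CompareApprox (B : ∀ i, FreeSet (A i)) where
  R : System C (multiShape A) ⊤ ⥤ System C (segShape (smash A)) ⊤
  isIso : ∀ X {i S T U} (h : (segShape (smash A)).Split i S T U), IsIso ((R.obj X).ρ h)
  ε : R ⋙ laxCompare C A ⟶ System.pull (Shape.PMap.ofTotal (multiRestrict B)) le_rfl
  η : laxCompare C A ⋙ R ⟶
    System.pull (Shape.PMap.ofTotal (segRestrict ((prodShapeMap A).idx B))) le_rfl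
  -- This is `L η = ε L`. The targets agree only by `prodShapeMap_multiRestrict`, hence the
  -- heterogeneous equality.
  heq : ∀ X S, HEq (System.Hom.app (ε.app ((laxCompare C A).obj X)) S)
    (System.Hom.app (η.app X) ((prodShapeMap A).idx S))

namespace CompareApprox

/-- Approximations on the two parts of a splitting of `B` can be added. -/
def add {i : ι} {B B' B'' : ∀ i, FreeSet (A i)} (h : (multiShape A).Split i B B' B'')
    (F : CompareApprox C B') (G : CompareApprox C B'') : CompareApprox C B where
  R := System.tensorFunctor F.R G.R
  isIso X _ _ _ _ k := by
    have := F.isIso X k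
    have := G.isIso X k
    exact inferInstanceAs (IsIso (tensorμ _ _ _ _ ≫ ((F.R.obj X).ρ k ⊗ₘ (G.R.obj X).ρ k)))
  ε :=
    { app := fun X => System.Hom.mk
        -- The transformations over `B'` and `B''` land in the values at `S ∩ B'` and `S ∩ B''`, and
        -- `ρ` adds these to the value at `S ∩ B`.
        (fun S => (System.Hom.app (F.ε.app X) S ⊗ₘ System.Hom.app (G.ε.app X) S) ≫
          X.ρ (multiRestrict_split h S))
        (fun k => X.tensorHom_comp_ρ_of_isEmpty _ ((multiRestrict B').empty k)
          (System.Hom.app_empty (F.ε.app X) k) (System.Hom.app_empty (G.ε.app X) k) _)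
        (fun {_ S T U} k => X.tensorμ_comp_ρ ((multiRestrict B).split k)
          ((multiRestrict B').split k) ((multiRestrict B'').split k) (multiRestrict_split h S)
          (multiRestrict_split h T) (multiRestrict_split h U)
          (System.Hom.comm (F.ε.app X) k) (System.Hom.comm (G.ε.app X) k))
      naturality := fun X Y f => System.Hom.ext (funext fun S =>
        tensorHom_comp_naturality (congrArg (fun g => System.Hom.app g S) (F.ε.naturality f))
          (congrArg (fun g => System.Hom.app g S) (G.ε.naturality f))
          (System.Hom.comm f (multiRestrict_split h S))) }
  η :=
    { app := fun X => System.Hom.mk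
        (fun S => (System.Hom.app (F.η.app X) S ⊗ₘ System.Hom.app (G.η.app X) S) ≫
          X.ρ (segRestrict_split ((prodShapeMap A).split h) S))
        (fun k => X.tensorHom_comp_ρ_of_isEmpty _ ((segRestrict ((prodShapeMap A).idx B')).empty k)
          (System.Hom.app_empty (F.η.app X) k) (System.Hom.app_empty (G.η.app X) k) _)
        (fun {_ S T U} k => X.tensorμ_comp_ρ ((segRestrict ((prodShapeMap A).idx B)).split k)
          ((segRestrict ((prodShapeMap A).idx B')).split k)
          ((segRestrict ((prodShapeMap A).idx B'')).split k)
          (segRestrict_split ((prodShapeMap A).split h) S)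
          (segRestrict_split ((prodShapeMap A).split h) T)
          (segRestrict_split ((prodShapeMap A).split h) U)
          (System.Hom.comm (F.η.app X) k) (System.Hom.comm (G.η.app X) k))
      naturality := fun X Y f => System.Hom.ext (funext fun S =>
        tensorHom_comp_naturality (congrArg (fun g => System.Hom.app g S) (F.η.naturality f))
          (congrArg (fun g => System.Hom.app g S) (G.η.naturality f))
          (System.Hom.comm f (segRestrict_split ((prodShapeMap A).split h) S))) }
  heq X S := System.tensorHom_comp_ρ_heq X _ _ (prodShapeMap_multiRestrict B S)
    (prodShapeMap_multiRestrict B' S) (prodShapeMap_multiRestrict B'' S) (F.heq X S) (G.heq X S)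

open Classical in
/-- If `B` has at most one element, the partial map of shapes that sends `T` to `B` if `T`
contains this element. -/
noncomputable def pointMap (B : ∀ i, FreeSet (A i)) (hB : ((prodShapeMap A).idx B).1.Subsingleton) :
    Shape.PMap (segShape (smash A)) (multiShape A) where
  idx T := if (((prodShapeMap A).idx B).1 ∩ T.1).Nonempty then some B else none
  -- Of two disjoint sets at most one contains the point, so every splitting becomes a trivial one.
  dir _ := none
  empty {T} h := by
    have : T.1 = ∅ := h
    simp [this]
  split {_ S T U} h := by
    show (_ ∧ _) ∨ (_ ∧ _)
    have h₁ : (((prodShapeMap A).idx B).1 ∩ S.1).Nonempty ↔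
        (((prodShapeMap A).idx B).1 ∩ T.1).Nonempty ∨
          (((prodShapeMap A).idx B).1 ∩ U.1).Nonempty := by
      rw [← h.1, Set.inter_union_distrib_left, Set.union_nonempty]
    have h₂ : ¬ ((((prodShapeMap A).idx B).1 ∩ T.1).Nonempty ∧
          (((prodShapeMap A).idx B).1 ∩ U.1).Nonempty) := by
      rintro ⟨⟨x, hx, hx'⟩, y, hy, hy'⟩
      have : x ∈ T.1 ∩ U.1 := ⟨hx', hB hx hy ▸ hy'⟩
      rw [h.2] at this
      exact this
    by_cases hT : (((prodShapeMap A).idx B).1 ∩ T.1).Nonempty <;>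
      by_cases hU : (((prodShapeMap A).idx B).1 ∩ U.1).Nonempty <;> simp_all

lemma pointMap_idx_of_nonempty {B : ∀ i, FreeSet (A i)}
    (hB : ((prodShapeMap A).idx B).1.Subsingleton) {T : FreeSet (smash A)}
    (h : (((prodShapeMap A).idx B).1 ∩ T.1).Nonempty) : (pointMap B hB).idx T = some B := if_pos h

lemma pointMap_idx_of_not_nonempty {B : ∀ i, FreeSet (A i)}
    (hB : ((prodShapeMap A).idx B).1.Subsingleton) {T : FreeSet (smash A)}
    (h : ¬ (((prodShapeMap A).idx B).1 ∩ T.1).Nonempty) : (pointMap B hB).idx T = none := if_neg h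

lemma pointMap_isEmpty_or {B : ∀ i, FreeSet (A i)}
    (hB : ((prodShapeMap A).idx B).1.Subsingleton) {S T U : FreeSet (smash A)}
    (h : IsDisjUnion S.1 T.1 U.1) : (pointMap B hB).idx T = none ∨ (pointMap B hB).idx U = none := by
  rcases (pointMap B hB).split (i := ()) h with h | h
  · exact Or.inr h.2
  · exact Or.inl h.1

/-- If the product of `S` contains the point of `B`, then `S ∩ B = B`. Otherwise `S ∩ B` has an
empty entry, and both functors give `0`. -/
lemma pull_pointMap_comp_laxCompare {B : ∀ i, FreeSet (A i)} (h : ∀ i, (B i).1.Subsingleton)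
    (hB : ((prodShapeMap A).idx B).1.Subsingleton) :
    System.pull (C := C) (W := ⊤) (W' := ⊤) (pointMap B hB) le_rfl ⋙ laxCompare C A =
      System.pull (Shape.PMap.ofTotal (multiRestrict B)) le_rfl := by
  refine (System.pull_comp _ _ _ _).trans (System.pull_congr _ (fun S => ?_) (fun i => Or.inr ?_))
  · show (pointMap B hB).idx ((prodShapeMap A).idx S) = some _ ∨
      ((multiShape A).plus.IsEmpty ((pointMap B hB).idx ((prodShapeMap A).idx S)) ∧ _)
    by_cases hS : (((prodShapeMap A).idx B).1 ∩ ((prodShapeMap A).idx S).1).Nonempty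
    · left
      rw [pointMap_idx_of_nonempty hB hS]
      refine congrArg some (funext fun i => Subtype.ext ?_)
      obtain ⟨_, ⟨a, rfl, ha⟩, b, hb, hb'⟩ := hS
      cases hb
      refine (Set.inter_eq_right.2 fun x hx => ?_).symm
      rw [h i hx (ha i)]
      exact hb' i
    · right
      rw [pointMap_idx_of_not_nonempty hB hS]
      refine ⟨fun _ k => by (cases k), ?_⟩
      rintro _ ⟨⟩
      by_contra hne
      have hne' : ∀ i, ((S i).1 ∩ (B i).1).Nonempty := fun i =>
        Set.nonempty_iff_ne_empty.2 fun e => hne ⟨i, e⟩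
      choose a ha using hne'
      exact hS ⟨smash.mk a, (mk_mem_prodShapeMap B a).2 fun i => (ha i).2,
        (mk_mem_prodShapeMap S a).2 fun i => (ha i).1⟩
  · intro S T U k
    refine (pointMap_isEmpty_or hB ((prodShapeMap A).split k)).imp (fun e => ?_) (fun e => ?_)
    · show (multiShape A).plus.IsEmpty ((pointMap B hB).idx ((prodShapeMap A).idx T))
      rw [e]
      exact fun _ k => by cases k
    · show (multiShape A).plus.IsEmpty ((pointMap B hB).idx ((prodShapeMap A).idx U))
      rw [e]
      exact fun _ k => by cases k

lemma laxCompare_comp_pull_pointMap {B : ∀ i, FreeSet (A i)}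
    (hB : ((prodShapeMap A).idx B).1.Subsingleton) :
    laxCompare C A ⋙ System.pull (W := ⊤) (W' := ⊤) (pointMap B hB) le_rfl =
      System.pull (Shape.PMap.ofTotal (segRestrict ((prodShapeMap A).idx B))) le_rfl := by
  refine (System.pull_comp _ _ _ _).trans (System.pull_congr _ (fun S => ?_) (fun i => Or.inr ?_))
  · show Option.bind ((pointMap B hB).idx S) _ = some _ ∨
      ((segShape (smash A)).plus.IsEmpty (Option.bind ((pointMap B hB).idx S) _) ∧ _)
    by_cases hS : (((prodShapeMap A).idx B).1 ∩ S.1).Nonempty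
    · left
      rw [pointMap_idx_of_nonempty hB hS]
      refine congrArg some (Subtype.ext ?_)
      obtain ⟨x, hx, hx'⟩ := hS
      refine (Set.inter_eq_right.2 fun y hy => ?_).symm
      rw [hB hy hx]
      exact hx'
    · right
      rw [pointMap_idx_of_not_nonempty hB hS]
      refine ⟨fun _ k => by (cases k), ?_⟩
      rintro _ ⟨⟩
      show S.1 ∩ ((prodShapeMap A).idx B).1 = ∅
      rw [Set.inter_comm]
      exact Set.not_nonempty_iff_eq_empty.1 hS
  · intro S T U k
    refine (pointMap_isEmpty_or hB k).imp (fun e => ?_) (fun e => ?_)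
    · show (segShape (smash A)).plus.IsEmpty (Option.bind ((pointMap B hB).idx T) _)
      rw [e]
      exact fun _ k => by cases k
    · show (segShape (smash A)).plus.IsEmpty (Option.bind ((pointMap B hB).idx U) _)
      rw [e]
      exact fun _ k => by cases k

lemma prodShapeMap_subsingleton {B : ∀ i, FreeSet (A i)} (h : ∀ i, (B i).1.Subsingleton) :
    ((prodShapeMap A).idx B).1.Subsingleton := by
  rintro _ ⟨a, rfl, ha⟩ _ ⟨b, rfl, hb⟩
  exact congrArg some (Subtype.ext (funext fun i => h i (ha i) (hb i)))

/-- The approximation for a tuple of subsets with at most one element. -/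
noncomputable def point {B : ∀ i, FreeSet (A i)} (h : ∀ i, (B i).1.Subsingleton) :
    CompareApprox C B where
  R := System.pull (pointMap B (prodShapeMap_subsingleton h)) le_rfl
  -- In the adjoined direction the maps `ρ` are identities up to equality of objects. This is where
  -- isomorphisms arise from a system whose own maps `ρ` are arbitrary.
  isIso X _ _ _ _ k := inferInstanceAs (IsIso (eqToHom (X.objPlus_eq
    ((pointMap B (prodShapeMap_subsingleton h)).split k))))
  ε := eqToHom (pull_pointMap_comp_laxCompare h _)
  η := eqToHom (laxCompare_comp_pull_pointMap _)
  heq X S := by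
    rw [eqToHom_app, eqToHom_app, System.app_eqToHom, System.app_eqToHom]
    exact eqToHom_heq_eqToHom rfl _ _

/-- Induction on the total number of elements of the entries of `B`: one entry is split until all
have at most one element. The order of splitting is arbitrary, so the result is not natural in `A`.
-/
theorem nonempty [Finite ι] [∀ i, Finite (A i)] (B : ∀ i, FreeSet (A i)) :
    Nonempty (CompareApprox C B) := by
  classical
  have := Fintype.ofFinite ι
  generalize hn : ∑ i, (B i).1.ncard = n
  induction n using Nat.strong_induction_on generalizing B with
  | _ n ih =>
    by_cases h : ∀ i, (B i).1.Subsingleton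
    · exact ⟨point h⟩
    · push Not at h
      obtain ⟨i, b, hb, c, hc, hbc⟩ := h
      have hsplit : ∀ D D' : FreeSet (A i), IsDisjUnion (B i).1 D.1 D'.1 →
          (multiShape A).Split i B (Function.update B i D) (Function.update B i D') := by
        intro D D' hD
        refine ⟨fun j hj => ?_, ?_⟩
        · rw [Function.update_of_ne hj, Function.update_of_ne hj]
          exact ⟨rfl, rfl⟩
        · rw [Function.update_self, Function.update_self]
          exact hD
      have hlt : ∀ D : FreeSet (A i), D.1 ⊂ (B i).1 →
          ∑ j, (Function.update B i D j).1.ncard < n := by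
        intro D hD
        rw [← hn]
        refine Finset.sum_lt_sum (fun j _ => ?_) ⟨i, Finset.mem_univ i, ?_⟩
        · by_cases hj : j = i
          · subst hj
            rw [Function.update_self]
            exact Set.ncard_le_ncard hD.1 (Set.toFinite _)
          · rw [Function.update_of_ne hj]
        · rw [Function.update_self]
          exact Set.ncard_lt_ncard hD (Set.toFinite _)
      -- Splitting off `b` gives two proper subsets: `c` is missing from the first and `b` from the
      -- second.
      let D : FreeSet (A i) := ⟨{b}, fun h => (B i).2 (Set.mem_of_eq_of_mem h hb)⟩
      let D' : FreeSet (A i) := ⟨(B i).1 \ {b}, fun h => (B i).2 h.1⟩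
      have hD : IsDisjUnion (B i).1 D.1 D'.1 :=
        ⟨Set.union_sdiff_cancel (Set.singleton_subset_iff.2 hb), Set.inter_sdiff_self _ _⟩
      obtain ⟨F⟩ := ih _ (hlt D ⟨Set.singleton_subset_iff.2 hb, fun k => hbc (k hc).symm⟩) _ rfl
      obtain ⟨G⟩ := ih _ (hlt D' ⟨Set.sdiff_subset, fun k => (k hb).2 rfl⟩) _ rfl
      exact ⟨add (hsplit D D' hD) F G⟩

/-- The tuple of the subsets of all elements but the basepoints. -/
def total (A : ι → Pointed.{0}) (i : ι) : FreeSet (A i) := ⟨{x | x ≠ (A i).point}, fun h => h rfl⟩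

lemma pull_multiRestrict_total :
    System.pull (C := C) (W := ⊤) (Shape.PMap.ofTotal (multiRestrict (total A))) (le_refl _) =
      𝟭 _ := by
  refine Eq.trans (System.pull_congr (ψ := Shape.PMap.ofTotal ⟨id, id, id, id⟩) _
    (fun S => Or.inl ?_) (fun i => Or.inl rfl)) System.pull_ofTotal_id
  exact congrArg some (funext fun i => Subtype.ext (Set.inter_eq_left.2 fun x hx e =>
    (S i).2 (Set.mem_of_eq_of_mem e.symm hx)))

lemma pull_segRestrict_total :
    System.pull (C := C) (W := ⊤)
      (Shape.PMap.ofTotal (segRestrict ((prodShapeMap A).idx (total A)))) (le_refl _) = 𝟭 _ := by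
  refine Eq.trans (System.pull_congr (ψ := Shape.PMap.ofTotal ⟨id, id, id, id⟩) _
    (fun S => Or.inl ?_) (fun i => Or.inl rfl)) System.pull_ofTotal_id
  refine congrArg some (smash.freeSet_ext fun a ha => ?_)
  show _ ∧ _ ↔ _
  rw [mk_mem_prodShapeMap]
  exact and_iff_left ha

end CompareApprox

/-- The inclusion of the systems with all maps `ρ` in `W` into all systems. -/
def System.forget (J : Shape) (W : MorphismProperty C) : System C J W ⥤ System C J ⊤ where
  obj X :=
    { obj := X.obj
      ρ := X.ρ
      mem := fun _ => trivial
      obj_empty := X.obj_empty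
      ρ_empty := X.ρ_empty
      ρ_symm := X.ρ_symm
      ρ_assoc := X.ρ_assoc
      ρ_interchange := X.ρ_interchange }
  map {X Y} f := System.Hom.mk (fun S => System.Hom.app (X := X) (Y := Y) f S)
    (System.Hom.app_empty f) (System.Hom.comm f)

/-- A functor to systems all of whose values have maps `ρ` in `W` lifts to systems with maps `ρ`
in `W`. -/
def System.lift {D : Type*} [Category* D] {J : Shape} {W : MorphismProperty C}
    (F : D ⥤ System C J ⊤)
    (hF : ∀ d {i S T U} (h : J.Split i S T U), W ((F.obj d).ρ h)) : D ⥤ System C J W where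
  obj d :=
    { obj := (F.obj d).obj
      ρ := (F.obj d).ρ
      mem := hF d
      obj_empty := (F.obj d).obj_empty
      ρ_empty := (F.obj d).ρ_empty
      ρ_symm := (F.obj d).ρ_symm
      ρ_assoc := (F.obj d).ρ_assoc
      ρ_interchange := (F.obj d).ρ_interchange }
  map {d e} f := System.Hom.mk
    (fun S => System.Hom.app (X := F.obj d) (Y := F.obj e) (F.map f) S)
    (System.Hom.app_empty (F.map f)) (System.Hom.comm (F.map f))
  map_id d := System.Hom.ext (funext fun S =>
    (congrArg (fun g => System.Hom.app g S) (F.map_id d) :))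
  map_comp f g := System.Hom.ext (funext fun S =>
    (congrArg (fun g => System.Hom.app g S) (F.map_comp f g) :))

end Approximation

/-! ### The comparison theorem -/

/-- The comparison functor has an approximate right adjoint: a functor `R` with transformations
`L R ⟶ 𝟭` and `R L ⟶ 𝟭` that agree after application of the comparison functor `L`. -/
theorem exists_compareFunctor_counit (C : Type u) [SmallCategory C] [MonoidalCategory C]
    [SymmetricCategory C] [PermutativeCategory C] {ι : Type} [Finite ι] (A : ι → Pointed.{0})
    [∀ i, Finite (A i)] :
    ∃ (R : (multiCat C ι).obj A ⥤ (segalCat C).obj (smash A))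
      (ε : R ⋙ (compareFunctor C A).toFunctor ⟶ 𝟭 _)
      (η : (compareFunctor C A).toFunctor ⋙ R ⟶ 𝟭 _),
      ∀ X, (compareFunctor C A).toFunctor.map (η.app X) =
        ε.app ((compareFunctor C A).toFunctor.obj X) := by
  obtain ⟨F⟩ := CompareApprox.nonempty (C := C) (CompareApprox.total A)
  let ε : F.R ⋙ laxCompare C A ⟶ 𝟭 _ := F.ε ≫ eqToHom CompareApprox.pull_multiRestrict_total
  let η : laxCompare C A ⋙ F.R ⟶ 𝟭 _ := F.η ≫ eqToHom CompareApprox.pull_segRestrict_total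
  have hεη : ∀ X S, System.Hom.app (η.app X) ((prodShapeMap A).idx S) =
      System.Hom.app (ε.app ((laxCompare C A).obj X)) S := by
    intro X S
    dsimp only [ε, η]
    rw [NatTrans.comp_app, NatTrans.comp_app, System.comp_app, System.comp_app, eqToHom_app,
      eqToHom_app, System.app_eqToHom, System.app_eqToHom]
    exact eq_of_heq ((comp_eqToHom_heq _ _).trans
      ((F.heq X S).symm.trans (comp_eqToHom_heq _ _).symm))
  clear_value ε η
  let I := System.forget (C := C) (segShape (smash A)) (MorphismProperty.isomorphisms C)
  -- The values of `F.R` have invertible maps `ρ`, so they are systems in Segal's sense. Morphisms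
  -- of systems do not involve this condition, and the components of `ε` and `η` are reused as they
  -- are.
  refine ⟨System.lift (W := MorphismProperty.isomorphisms C) F.R (fun X _ _ _ _ h => F.isIso X h),
    { app := fun X => System.Hom.mk
        (fun S => System.Hom.app (X := (F.R ⋙ laxCompare C A).obj X) (Y := X) (ε.app X) S)
        (System.Hom.app_empty (ε.app X)) (System.Hom.comm (ε.app X))
      naturality := fun X Y f => System.Hom.ext (funext fun S =>
        congrArg (fun g => System.Hom.app g S) (ε.naturality f)) },
    { app := fun X => System.Hom.mk
        (fun S => System.Hom.app (X := (laxCompare C A ⋙ F.R).obj (I.obj X)) (Y := I.obj X)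
          (η.app (I.obj X)) S)
        (System.Hom.app_empty (η.app (I.obj X))) (System.Hom.comm (η.app (I.obj X)))
      naturality := fun X Y f => System.Hom.ext (funext fun S =>
        (congrArg (fun g => System.Hom.app g S) (η.naturality (I.map f)) :)) }, fun X => ?_⟩
  exact System.Hom.ext (funext fun S => hεη (I.obj X) S)

theorem mainTheorem5 (C : Type u) [SmallCategory C] [MonoidalCategory C] [SymmetricCategory C]
    [PermutativeCategory C] : SymmetricSpectrum.IsLevelEquiv (segalToNew C) := by
  intro p
  have hfin : ∀ n, Finite (circle.obj n) := fun n => inferInstanceAs (Finite (Fin _))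
  -- The circle is finite in each degree. The choices made in different degrees need not be
  -- compatible, since `weakEquiv_diagonal_nerve` asks for naturality of the comparison functor
  -- alone.
  choose R ε η h using fun n : SimplexCategoryᵒᵖ =>
    exists_compareFunctor_counit C (fun _ : Fin p => circle.obj n)
  exact SymmetricSpectrum.weakEquiv_diagonal_nerve
    (F := circle ⋙ (segalSequence C).F p) (G := circle ⋙ (multiSequence C).F p)
    (Functor.whiskerLeft circle ((compareHom C).app p)) R ε η h
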